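/- Fix $\alpha\in(1,2]$. For $j\in\mathbb Z$, $k=(k_1,k_2)\in\mathbb Z^2$ and $c=(c_1,c_2)\in(0,\infty)^2$ put \[ A_{2^j}=\mathrm{diag}(2^{j\alpha/2},2^{j/2},2^{j/2}),\qquad S_k=\begin{pmatrix}1&k_1&k_2\\0&1&0\\0&0&1\end{pmatrix},\qquad M_c=\mathrm{diag}(c_1,c_2,c_2), \] and write $|k|\le N$ for $|k_1|\le N$ and $|k_2|\le N$. Let $\hat f(\xi)=\int f(x)e^{-2\pi i\langle\xi,x\rangle}\,dx$ (extended to $L^2$), let \[ \mathcal P=\{\xi\in\mathbb R^3:\ |\xi_1|\ge1,\ |\xi_2/\xi_1|\le1,\ |\xi_3/\xi_1|\le1\},\qquad \check L^2(\mathcal P)=\{f\in L^2(\mathbb R^3):\ \operatorname{supp}\hat f\subset\mathcal P\}. \] For $\psi\in L^2(\mathbb R^3)$ let $\Psi(\psi)=\Psi(\psi;c,\alpha)$ be the family of the functions $\psi_{j,k,m}=2^{j(\alpha+2)/4}\,\psi(S_kA_{2^j}\,\cdot\,-m)$ with $j\in\mathbb N_0$, $k\in\mathbb Z^2$, $|k|\le\lceil2^{j(\alpha-1)/2}\rceil$,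 $m\in M_c\mathbb Z^3$. Put \[ \Phi(\xi,\omega)=\sum_{j\ge0}\ \sum_{|k|\le\lceil2^{j(\alpha-1)/2}\rceil}\bigl|\hat\psi(S_{-k}^TA_{2^{-j}}\xi)\bigr|\,\bigl|\hat\psi(S_{-k}^TA_{2^{-j}}\xi+\omega)\bigr|,\qquad \Gamma(\omega)=\operatorname*{ess\,sup}_{\xi\in\mathcal P}\Phi(\xi,\omega), \] \[ L_{\mathit{inf}}=\operatorname*{ess\,inf}_{\xi\in\mathcal P}\Phi(\xi,0),\quad L_{\mathit{sup}}=\operatorname*{ess\,sup}_{\xi\in\mathcal P}\Phi(\xi,0),\quad R(c)=\sum_{m\in\mathbb Z^3\setminus\{0\}}\bigl[\Gamma(M_c^{-1}m)\,\Gamma(-M_c^{-1}m)\bigr]^{1/2}. \] Let $K,L\in\mathbb N$ with $L\ge10$ and $\frac{3L}2\le K\le3L-2$. Let $m_0,m_1:\mathbb R\to\mathbb C$ be measurable functions such that for all $\xi\in\mathbb R$ \[ |m_0(\xi)|^2=(\cos\pi\xi)^{2K}\sum_{n=0}^{L-1}\binom{K-1+n}{n}(\sin\pi\xi)^{2n},\qquad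 |m_1(\xi)|^2=|m_0(\xi+1/2)|^2, \] and such that for every $\xi\in\mathbb R$ the partial products of $\prod_{j=0}^\infty m_0(2^{-j}\xi)$ converge. Then there are $\phi\in L^2(\mathbb R)$ and $\psi\in L^2(\mathbb R^3)$ with \[ \hat\phi(\xi)=\prod_{j=0}^\infty m_0(2^{-j}\xi),\qquad \hat\psi(\xi_1,\xi_2,\xi_3)=m_1(4\xi_1)\,\hat\phi(\xi_1)\,\hat\phi(2\xi_2)\,\hat\phi(2\xi_3) \] almost everywhere, and there is a constant $\hat c_1>0$ such that for all $c=(c_1,c_2)$ with $0<c_2\le c_1\le\hat c_1$ the system $\Psi(\psi)$ forms a frame for $\check L^2(\mathcal P)$; that is, there are $0<A\le B<\infty$ with \[ A\|f\|^2\le\sum_{j,k,m}|\langle f,\psi_{j,k,m}\rangle|^2\le B\|f\|^2\qquad\text{for all }f\in\check L^2(\mathcal P). \] Moreover $R(c)<L_{\mathit{inf}}\le L_{\mathit{sup}}<\infty$, and the optimal (largest lower and smallest upper) frame bounds $A$ and $B$ satisfy \[ \frac{1}{|\det M_c|}\bigl[L_{\mathit{inf}}-R(c)\bigr]\le A\le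 B\le\frac{1}{|\det M_c|}\bigl[L_{\mathit{sup}}+R(c)\bigr]. \] -/

import Mathlib

open MeasureTheory Filter Topology
open scoped ENNReal FourierTransform

namespace Shearlet

noncomputable section

/-- Euclidean space `ℝ³`; the coordinates `ξ₁, ξ₂, ξ₃` are `ξ 0, ξ 1, ξ 2`. -/
abbrev E3 : Type := EuclideanSpace ℝ (Fin 3)

/-- The Hilbert space `L²(ℝ³)` of complex valued functions. -/
abbrev L2R3 : Type := Lp (α := E3) ℂ 2 volume

/-- The Hilbert space `L²(ℝ)` of complex valued functions. -/
abbrev L2R : Type := Lp (α := ℝ) ℂ 2 volume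

/-! ### Frames -/

section Frames

variable {ι H : Type*} [NormedAddCommGroup H] [InnerProductSpace ℂ H]

/-- `∑ᵢ |⟨f, vᵢ⟩|²`, with values in `[0, ∞]`. -/
def frameSum (v : ι → H) (f : H) : ℝ≥0∞ := ∑' i, ‖inner ℂ (v i) f‖ₑ ^ 2

/-- `A ‖f‖² ≤ ∑ᵢ |⟨f, vᵢ⟩|²` for all `f` in the subspace `W`. -/
def IsLowerFrameBound (W : Submodule ℂ H) (v : ι → H) (A : ℝ) : Prop :=
  ∀ f ∈ W, ENNReal.ofReal (A * ‖f‖ ^ 2) ≤ frameSum v f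

/-- `∑ᵢ |⟨f, vᵢ⟩|² ≤ B ‖f‖²` for all `f` in the subspace `W`. -/
def IsUpperFrameBound (W : Submodule ℂ H) (v : ι → H) (B : ℝ) : Prop :=
  ∀ f ∈ W, frameSum v f ≤ ENNReal.ofReal (B * ‖f‖ ^ 2)

/-- The family `v` is a frame for the subspace `W`: the two frame inequalities hold on `W` with
some `0 < A ≤ B < ∞`. The vectors `vᵢ` are not required to lie in `W`. -/
def IsFrameFor (W : Submodule ℂ H) (v : ι → H) : Prop :=
  ∃ A B : ℝ, 0 < A ∧ A ≤ B ∧ IsLowerFrameBound W v A ∧ IsUpperFrameBound W v B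

end Frames

/-! ### Scaling, shear and sampling matrices -/

/-- The scaling matrix `A_{2^j} = diag(2^{jα/2}, 2^{j/2}, 2^{j/2})`, `j ∈ ℤ`. -/
def scalingMatrix (α : ℝ) (j : ℤ) : Matrix (Fin 3) (Fin 3) ℝ :=
  Matrix.diagonal ![(2 : ℝ) ^ ((j : ℝ) * α / 2), (2 : ℝ) ^ ((j : ℝ) / 2), (2 : ℝ) ^ ((j : ℝ) / 2)]

/-- The shear matrix `S_k`, `k = (k₁, k₂) ∈ ℤ²`. -/
def shearMatrix (k : ℤ × ℤ) : Matrix (Fin 3) (Fin 3) ℝ :=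
  !![1, (k.1 : ℝ), (k.2 : ℝ);
     0, 1, 0;
     0, 0, 1]

/-- The sampling matrix `M_c = diag(c₁, c₂, c₂)`. -/
def samplingMatrix (c₁ c₂ : ℝ) : Matrix (Fin 3) (Fin 3) ℝ :=
  Matrix.diagonal ![c₁, c₂, c₂]

/-- The action of a `3 × 3` matrix on `ℝ³`. -/
abbrev act (M : Matrix (Fin 3) (Fin 3) ℝ) (x : E3) : E3 := Matrix.toEuclideanLin M x

/-- An integer vector regarded as a point of `ℝ³`. -/
def intVec (n : Fin 3 → ℤ) : E3 := WithLp.toLp 2 (fun i => (n i : ℝ))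

theorem det_shear_mul_scaling_ne_zero (α : ℝ) (j : ℤ) (k : ℤ × ℤ) :
    (shearMatrix k * scalingMatrix α j).det ≠ 0 := by
  rw [Matrix.det_mul]
  refine mul_ne_zero ?_ ?_
  · simp [shearMatrix, Matrix.det_fin_three]
  · have h1 : (2 : ℝ) ^ ((j : ℝ) * α / 2) ≠ 0 := (Real.rpow_pos_of_pos two_pos _).ne'
    have h2 : (2 : ℝ) ^ ((j : ℝ) / 2) ≠ 0 := (Real.rpow_pos_of_pos two_pos _).ne'
    simp [scalingMatrix, Matrix.det_diagonal, Fin.prod_univ_three, h1, h2]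

/-! ### The shearlet system -/

/-- The index set `{(j, k) : j ≥ 0, |k₁|, |k₂| ≤ ⌈2^{j(α-1)/2}⌉}`. -/
abbrev ScaleShear (α : ℝ) : Type :=
  {p : ℕ × ℤ × ℤ // |p.2.1| ≤ ⌈(2 : ℝ) ^ ((p.1 : ℝ) * (α - 1) / 2)⌉ ∧
    |p.2.2| ≤ ⌈(2 : ℝ) ^ ((p.1 : ℝ) * (α - 1) / 2)⌉}

/-- The function `x ↦ 2^{j(α+2)/4} ψ(S_k A_{2^j} x - m)`. -/
def shearletFun (α : ℝ) (ψ : E3 → ℂ) (j : ℕ) (k : ℤ × ℤ) (m : E3) : E3 → ℂ := fun x =>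
  (((2 : ℝ) ^ ((j : ℝ) * (α + 2) / 4) : ℝ) : ℂ) *
    ψ (act (shearMatrix k * scalingMatrix α j) x - m)

theorem memLp_shearletFun (α : ℝ) {ψ : E3 → ℂ} (hψ : MemLp ψ 2 volume) (j : ℕ) (k : ℤ × ℤ)
    (m : E3) : MemLp (shearletFun α ψ j k m) 2 volume := by
  refine MemLp.const_mul ?_ _
  have hdet : LinearMap.det (Matrix.toEuclideanLin (shearMatrix k * scalingMatrix α j)) ≠ 0 := by
    rw [Matrix.toEuclideanLin_eq_toLin, LinearMap.det_toLin]
    exact det_shear_mul_scaling_ne_zero α j k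
  have h1 : MemLp (fun y : E3 => ψ (y - m)) 2 volume :=
    hψ.comp_measurePreserving (measurePreserving_sub_right volume m)
  have h2 : MemLp (fun y : E3 => ψ (y - m)) 2 (Measure.map
      (Matrix.toEuclideanLin (shearMatrix k * scalingMatrix α j)) volume) := by
    rw [Measure.map_linearMap_addHaar_eq_smul_addHaar volume hdet]
    exact h1.smul_measure ENNReal.ofReal_ne_top
  exact h2.comp_of_map (LinearMap.continuous_of_finiteDimensional _).aemeasurable

/-- The shearlet system `Ψ(ψ; c, α)`: the family of the
`ψ_{j,k,m} = 2^{j(α+2)/4} ψ(S_k A_{2^j} · - m)` with `j ≥ 0`, `|k| ≤ ⌈2^{j(α-1)/2}⌉` and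
`m = M_c n ∈ M_c ℤ³`, indexed by `((j, k), n)`. -/
def shearletSystem (α c₁ c₂ : ℝ) (ψ : L2R3) (i : ScaleShear α × (Fin 3 → ℤ)) : L2R3 :=
  (memLp_shearletFun α (Lp.memLp ψ) i.1.1.1 i.1.1.2
    (act (samplingMatrix c₁ c₂) (intVec i.2))).toLp _

/-! ### The pyramid pair and its function space -/

/-- The pyramid `𝒫₁`. -/
def pyramid₁ : Set E3 := {ξ | 1 ≤ ξ 0 ∧ |ξ 1 / ξ 0| ≤ 1 ∧ |ξ 2 / ξ 0| ≤ 1}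

/-- The pyramid `𝒫₄`. -/
def pyramid₄ : Set E3 := {ξ | ξ 0 ≤ -1 ∧ |ξ 1 / ξ 0| ≤ 1 ∧ |ξ 2 / ξ 0| ≤ 1}

/-- The pyramid pair `𝒫 = 𝒫₁ ∪ 𝒫₄`. -/
def pyramid : Set E3 := pyramid₁ ∪ pyramid₄

/-- The space `{f ∈ L²(ℝ³) : supp f̂ ⊂ 𝒫}`, where `f̂` is the `L²` Fourier transform. -/
def pyramidSpace : Submodule ℂ L2R3 where
  carrier := {f | ∀ᵐ ξ ∂(volume : Measure E3), ξ ∉ pyramid → (𝓕 f : L2R3) ξ = 0}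
  zero_mem' := by
    have h : (𝓕 (0 : L2R3) : L2R3) = 0 := (Lp.fourierTransformₗᵢ E3 ℂ).map_zero
    simp only [Set.mem_ofPred_eq, h]
    filter_upwards [Lp.coeFn_zero ℂ 2 (volume : Measure E3)] with ξ hξ _
    simp
  add_mem' := by
    intro f g hf hg
    have h : (𝓕 (f + g) : L2R3) = 𝓕 f + 𝓕 g := (Lp.fourierTransformₗᵢ E3 ℂ).map_add f g
    simp only [Set.mem_ofPred_eq] at hf hg ⊢
    rw [h]
    filter_upwards [hf, hg, Lp.coeFn_add (𝓕 f : L2R3) (𝓕 g)] with ξ h1 h2 h3 hξ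
    rw [h3, Pi.add_apply, h1 hξ, h2 hξ, add_zero]
  smul_mem' := by
    intro a f hf
    have h : (𝓕 (a • f) : L2R3) = a • 𝓕 f := (Lp.fourierTransformₗᵢ E3 ℂ).map_smul a f
    simp only [Set.mem_ofPred_eq] at hf ⊢
    rw [h]
    filter_upwards [hf, Lp.coeFn_smul a (𝓕 f : L2R3)] with ξ h1 h2 hξ
    rw [h2, Pi.smul_apply, h1 hξ, smul_zero]

/-! ### The covering quantities

All of them take values in `[0, ∞]`, and none depends on the representative of `𝓕 ψ`. -/

/-- `Φ(ξ, ω) = ∑_{j ≥ 0} ∑_{|k| ≤ ⌈2^{j(α-1)/2}⌉}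
|ψ̂(S_{-k}ᵀ A_{2^{-j}} ξ)| |ψ̂(S_{-k}ᵀ A_{2^{-j}} ξ + ω)|`. -/
def overlap (α : ℝ) (ψ : L2R3) (ξ ω : E3) : ℝ≥0∞ :=
  ∑' p : ScaleShear α,
    ‖(𝓕 ψ : L2R3) (act ((shearMatrix (-p.1.2)).transpose *
        scalingMatrix α (-(p.1.1 : ℤ))) ξ)‖ₑ *
      ‖(𝓕 ψ : L2R3) (act ((shearMatrix (-p.1.2)).transpose *
        scalingMatrix α (-(p.1.1 : ℤ))) ξ + ω)‖ₑ

/-- `Γ(ω)`, the essential supremum of `Φ(ξ, ω)` over `ξ ∈ 𝒫`. -/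
def maxOverlap (α : ℝ) (ψ : L2R3) (ω : E3) : ℝ≥0∞ :=
  essSup (fun ξ => overlap α ψ ξ ω) (volume.restrict pyramid)

/-- `L_inf`, the essential infimum of `Φ(ξ, 0)` over `ξ ∈ 𝒫`. -/
def Linf (α : ℝ) (ψ : L2R3) : ℝ≥0∞ :=
  essInf (fun ξ => overlap α ψ ξ 0) (volume.restrict pyramid)

/-- `L_sup`, the essential supremum of `Φ(ξ, 0)` over `ξ ∈ 𝒫`. -/
def Lsup (α : ℝ) (ψ : L2R3) : ℝ≥0∞ :=
  essSup (fun ξ => overlap α ψ ξ 0) (volume.restrict pyramid)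

/-- `R(c) = ∑_{m ∈ ℤ³ ∖ {0}} (Γ(M_c⁻¹ m) Γ(-M_c⁻¹ m))^{1/2}`. -/
def Rsum (α c₁ c₂ : ℝ) (ψ : L2R3) : ℝ≥0∞ :=
  ∑' m : {m : Fin 3 → ℤ // m ≠ 0},
    (maxOverlap α ψ (act (samplingMatrix c₁ c₂)⁻¹ (intVec m)) *
      maxOverlap α ψ (-act (samplingMatrix c₁ c₂)⁻¹ (intVec m))) ^ (1 / 2 : ℝ)

/-! ### The generator -/

/-- `m₀` is a low pass filter of order `(K, L)`:
`|m₀(ξ)|² = cos(πξ)^{2K} ∑_{n=0}^{L-1} binom(K-1+n, n) sin(πξ)^{2n}`. -/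
def IsLowPassFilter (K L : ℕ) (m₀ : ℝ → ℂ) : Prop :=
  ∀ ξ : ℝ, ‖m₀ ξ‖ ^ 2 = Real.cos (Real.pi * ξ) ^ (2 * K) *
    ∑ n ∈ Finset.range L, ((K - 1 + n).choose n : ℝ) * Real.sin (Real.pi * ξ) ^ (2 * n)

/-- `m₁` is a bandpass filter associated with `m₀`: `|m₁(ξ)|² = |m₀(ξ + 1/2)|²`. -/
def IsBandPassFilter (m₀ m₁ : ℝ → ℂ) : Prop :=
  ∀ ξ : ℝ, ‖m₁ ξ‖ ^ 2 = ‖m₀ (ξ + 1 / 2)‖ ^ 2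

/-- `φhat(ξ) = ∏_{j=0}^∞ m₀(2^{-j} ξ)`, as the limit of the partial products, for every `ξ`. -/
def IsInfiniteProduct (m₀ φhat : ℝ → ℂ) : Prop :=
  ∀ ξ : ℝ, Tendsto (fun N : ℕ => ∏ j ∈ Finset.range N, m₀ (ξ / 2 ^ j)) atTop (𝓝 (φhat ξ))

/-- `ξ ↦ m₁(4ξ₁) φhat(ξ₁) φhat(2ξ₂) φhat(2ξ₃)`. -/
def generatorFT (m₁ φhat : ℝ → ℂ) (ξ : E3) : ℂ :=
  m₁ (4 * ξ 0) * φhat (ξ 0) * φhat (2 * ξ 1) * φhat (2 * ξ 2)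

end

end Shearlet

/-!
At a fixed scale and shear the coefficients of `f` are Fourier coefficients of a periodization of
`𝓕 f · conj (𝓕 ψ)`, so by Parseval their sum of squares is a diagonal term, in which `𝓕 ψ` is
paired with itself, plus correlations of `𝓕 ψ` with its translates by the nonzero points of the
dual lattice `M_c⁻¹ ℤ³`. Summed over scales and shears, the diagonal term lies between
`L_inf ‖f‖²` and `L_sup ‖f‖²`, and by Cauchy–Schwarz the correlation at `ω` is at most
`(Γ(ω) Γ(-ω))^{1/2} ‖f‖²`; this gives the frame inequalities once `R(c) < L_inf`.

Viète's product `∏_{j < N} cos(π ξ / 2^j) = sin(2 π ξ) / (2^N sin(2 π ξ / 2^N))` turns the zero of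
order `K` of `m₀` at `1/2` into cubic decay of `𝓕 ψ`, even though the binomial factor of `|m₀|²`
takes part of it back. Hence `Γ(ω)` is at most a constant times `∏ (1 + |ωᵢ|)⁻²`, and
`R(c) = O(c₁²)`. Conversely, rounding the shear parameter moves some dual image of each `ξ ∈ 𝒫`
into a fixed set near the origin on which `𝓕 ψ` is bounded below, so `L_inf > 0` does not depend
on `c`.
-/

namespace Shearlet

noncomputable section

/-! ### Low pass and band pass filters -/

theorem one_sub_pow_mul_sum_choose_le_one {K : ℕ} (hK : 1 ≤ K) (L : ℕ) {y : ℝ} (hy0 : 0 ≤ y)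
    (hy1 : y ≤ 1) :
    (1 - y) ^ K * ∑ n ∈ Finset.range L, ((K - 1 + n).choose n : ℝ) * y ^ n ≤ 1 := by
  obtain ⟨k, rfl⟩ : ∃ k, K = k + 1 := ⟨K - 1, by omega⟩
  rcases hy1.lt_or_eq with hlt | rfl
  · have hnorm : ‖y‖ < 1 := by rwa [Real.norm_of_nonneg hy0]
    have hsum : ∑ n ∈ Finset.range L, ((k + 1 - 1 + n).choose n : ℝ) * y ^ n ≤
        1 / (1 - y) ^ (k + 1) := by
      rw [← tsum_choose_mul_geometric_of_norm_lt_one k hnorm]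
      refine le_trans (le_of_eq (Finset.sum_congr rfl fun n _ => ?_))
        ((summable_choose_mul_geometric_of_norm_lt_one k hnorm).sum_le_tsum (Finset.range L)
          fun n _ => by positivity)
      rw [Nat.add_sub_cancel, add_comm k n, Nat.choose_symm_add]
    have hpos : 0 < (1 - y) ^ (k + 1) := pow_pos (by linarith) _
    calc _ ≤ (1 - y) ^ (k + 1) * (1 / (1 - y) ^ (k + 1)) :=
          mul_le_mul_of_nonneg_left hsum hpos.le
      _ = 1 := mul_one_div_cancel hpos.ne'
  · simp

/-- The sum `∑_{n < L} binom(K-1+n, n)`, which is the maximum of the polynomial factor of the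
squared modulus of a low pass filter of order `(K, L)`. -/
def binomSum (K L : ℕ) : ℝ := ∑ n ∈ Finset.range L, ((K - 1 + n).choose n : ℝ)

theorem binomSum_nonneg (K L : ℕ) : 0 ≤ binomSum K L :=
  Finset.sum_nonneg fun _ _ => Nat.cast_nonneg _

theorem one_sub_pow_mul_binomSum_mul_pow_le {K : ℕ} (hK : 1 ≤ K) (L : ℕ) {y : ℝ} (hy0 : 0 ≤ y)
    (hy1 : y ≤ 1) : (1 - y) ^ K * (binomSum K L * y ^ L) ≤ y := by
  have hterm : binomSum K L * y ^ L ≤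
      y * ∑ n ∈ Finset.range L, ((K - 1 + n).choose n : ℝ) * y ^ n := by
    rw [binomSum, Finset.sum_mul, Finset.mul_sum]
    refine Finset.sum_le_sum fun n hn => ?_
    calc ((K - 1 + n).choose n : ℝ) * y ^ L ≤ ((K - 1 + n).choose n : ℝ) * y ^ (n + 1) := by
          gcongr ?_ * ?_
          exact pow_le_pow_of_le_one hy0 hy1 (Finset.mem_range.1 hn)
      _ = y * (((K - 1 + n).choose n : ℝ) * y ^ n) := by ring
  calc (1 - y) ^ K * (binomSum K L * y ^ L)
      ≤ (1 - y) ^ K * (y * ∑ n ∈ Finset.range L, ((K - 1 + n).choose n : ℝ) * y ^ n) :=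
        mul_le_mul_of_nonneg_left hterm (pow_nonneg (sub_nonneg.2 hy1) K)
    _ = y * ((1 - y) ^ K * ∑ n ∈ Finset.range L, ((K - 1 + n).choose n : ℝ) * y ^ n) := by ring
    _ ≤ y := mul_le_of_le_one_right hy0 (one_sub_pow_mul_sum_choose_le_one hK L hy0 hy1)

theorem binomSum_le_four_pow {K L : ℕ} (hK : 13 ≤ K) (hKL : 3 * L ≤ 2 * K) :
    4 ^ 3 * binomSum K L ≤ 4 ^ K := by
  have hP := binomSum_nonneg K L
  -- `y = 2/5` maximizes `(1 - y)³ y²`, the rate of the bound when `3 L = 2 K`.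
  have hbase := one_sub_pow_mul_binomSum_mul_pow_le (K := K) (by omega) L
    (y := 2 / 5) (by norm_num) (by norm_num)
  have hcube : (27 / 125 : ℝ) ^ K * (4 / 25) ^ K * binomSum K L ^ 3 ≤ (2 / 5) ^ 3 := by
    have hexp : (4 / 25 : ℝ) ^ K ≤ ((2 / 5) ^ L) ^ 3 := by
      rw [show (4 / 25 : ℝ) = (2 / 5) ^ 2 by norm_num, ← pow_mul, ← pow_mul]
      exact pow_le_pow_of_le_one (by norm_num) (by norm_num) (by omega)
    calc (27 / 125 : ℝ) ^ K * (4 / 25) ^ K * binomSum K L ^ 3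
        ≤ (27 / 125 : ℝ) ^ K * ((2 / 5) ^ L) ^ 3 * binomSum K L ^ 3 := by gcongr
      _ = ((1 - 2 / 5) ^ K * (binomSum K L * (2 / 5) ^ L)) ^ 3 := by
        rw [show (27 / 125 : ℝ) = (1 - 2 / 5) ^ 3 by norm_num, ← pow_mul, mul_comm 3 K, pow_mul]
        ring
      _ ≤ (2 / 5) ^ 3 := by gcongr
  have hgrowth : ((4 ^ 3) ^ 3 * (2 / 5) ^ 3 : ℝ) ≤ (6912 / 3125) ^ K :=
    le_trans (by norm_num) (pow_le_pow_right₀ (by norm_num) hK)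
  refine le_of_pow_le_pow_left₀ three_ne_zero (by positivity) ?_
  have hsplit : ((4 : ℝ) ^ K) ^ 3 * ((27 / 125) ^ K * (4 / 25) ^ K) = (6912 / 3125) ^ K := by
    rw [← pow_mul, mul_comm K, pow_mul, ← mul_pow, ← mul_pow]; norm_num
  refine le_of_mul_le_mul_right ?_ (by positivity : (0 : ℝ) < (27 / 125) ^ K * (4 / 25) ^ K)
  rw [hsplit]
  refine le_trans ?_ hgrowth
  calc (4 ^ 3 * binomSum K L) ^ 3 * ((27 / 125 : ℝ) ^ K * (4 / 25) ^ K)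
      = (4 ^ 3) ^ 3 * ((27 / 125 : ℝ) ^ K * (4 / 25) ^ K * binomSum K L ^ 3) := by ring
    _ ≤ (4 ^ 3) ^ 3 * (2 / 5) ^ 3 := by gcongr

theorem two_mul_abs_le_abs_sin_pi_mul {t : ℝ} (ht : |t| ≤ 1 / 2) :
    2 * |t| ≤ |Real.sin (Real.pi * t)| := by
  have hpi := Real.pi_pos
  have habs : |Real.pi * t| = Real.pi * |t| := by rw [abs_mul, abs_of_pos hpi]
  refine le_of_eq_of_le ?_ (Real.mul_abs_le_abs_sin (by rw [habs]; nlinarith))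
  rw [habs]
  field_simp

theorem abs_sin_pi_mul_le (t : ℝ) : |Real.sin (Real.pi * t)| ≤ 4 * |t| := by
  refine Real.abs_sin_le_abs.trans ?_
  rw [abs_mul, abs_of_pos Real.pi_pos]
  gcongr
  exact Real.pi_le_four

theorem abs_le_abs_sin_pi_mul {t : ℝ} (ht : |t| ≤ 2 / 3) : |t| ≤ |Real.sin (Real.pi * t)| := by
  rcases le_total |t| (1 / 2) with hsmall | hlarge
  · linarith [two_mul_abs_le_abs_sin_pi_mul hsmall, abs_nonneg t]
  · have hreflect : |Real.sin (Real.pi * t)| = |Real.sin (Real.pi * (1 - |t|))| := by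
      rw [mul_sub, mul_one, Real.sin_pi_sub]
      rcases abs_choice t with h | h <;> simp [h]
    have hcompl : |1 - (|t|)| = 1 - |t| := abs_of_nonneg (by linarith)
    have hjordan := two_mul_abs_le_abs_sin_pi_mul (t := 1 - |t|) (by rw [hcompl]; linarith)
    rw [hreflect]
    linarith

theorem prod_cos_mul_sin (ξ : ℝ) (N : ℕ) :
    (∏ j ∈ Finset.range N, Real.cos (Real.pi * (ξ / 2 ^ j))) *
      (2 ^ N * Real.sin (Real.pi * (2 * ξ / 2 ^ N))) = Real.sin (Real.pi * (2 * ξ)) := by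
  induction N with
  | zero => simp
  | succ N ih =>
    have hhalf : Real.pi * (2 * ξ / 2 ^ (N + 1)) = Real.pi * (ξ / 2 ^ N) := by
      rw [pow_succ]; field_simp
    have hdouble : Real.pi * (2 * ξ / 2 ^ N) = 2 * (Real.pi * (ξ / 2 ^ N)) := by ring
    rw [← ih, Finset.prod_range_succ, hhalf, hdouble, Real.sin_two_mul]
    ring

theorem abs_prod_cos_mul_abs_sin (ξ : ℝ) (N : ℕ) :
    |∏ j ∈ Finset.range N, Real.cos (Real.pi * (ξ / 2 ^ j))| *
      (2 ^ N * |Real.sin (Real.pi * (2 * ξ / 2 ^ N))|) = |Real.sin (Real.pi * (2 * ξ))| := by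
  rw [← prod_cos_mul_sin ξ N, abs_mul, abs_mul, abs_of_pos (by positivity : (0 : ℝ) < 2 ^ N)]

theorem abs_prod_cos_le {ξ : ℝ} {n : ℕ} (hle : 2 ^ n ≤ |ξ|) (hlt : |ξ| < 2 ^ (n + 1)) :
    |∏ j ∈ Finset.range (n + 3), Real.cos (Real.pi * (ξ / 2 ^ j))| ≤ 2 / 2 ^ (n + 3) := by
  have habs : |2 * ξ / 2 ^ (n + 3)| = |ξ| / 2 ^ n / 4 := by
    rw [abs_div, abs_mul, abs_two, abs_of_pos (by positivity : (0 : ℝ) < 2 ^ (n + 3)), pow_add]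
    ring
  have hlower : 1 ≤ |ξ| / 2 ^ n := by rwa [one_le_div (by positivity)]
  have hupper : |ξ| / 2 ^ n ≤ 2 := by
    rw [div_le_iff₀ (by positivity), ← pow_succ']; exact hlt.le
  have hsin := two_mul_abs_le_abs_sin_pi_mul (t := 2 * ξ / 2 ^ (n + 3)) (by rw [habs]; linarith)
  rw [le_div_iff₀ (by positivity)]
  calc |∏ j ∈ Finset.range (n + 3), Real.cos (Real.pi * (ξ / 2 ^ j))| * 2 ^ (n + 3)
      = 2 * (|∏ j ∈ Finset.range (n + 3), Real.cos (Real.pi * (ξ / 2 ^ j))| *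
          (2 ^ (n + 3) * (1 / 2))) := by ring
    _ ≤ 2 * (|∏ j ∈ Finset.range (n + 3), Real.cos (Real.pi * (ξ / 2 ^ j))| *
          (2 ^ (n + 3) * |Real.sin (Real.pi * (2 * ξ / 2 ^ (n + 3)))|)) := by
        gcongr; rw [habs] at hsin; linarith
    _ ≤ 2 := by
        rw [abs_prod_cos_mul_abs_sin]; linarith [Real.abs_sin_le_one (Real.pi * (2 * ξ))]

theorem half_le_abs_prod_cos {ξ : ℝ} (hξ : |ξ| ≤ 1 / 4) (N : ℕ) :
    1 / 2 ≤ |∏ j ∈ Finset.range N, Real.cos (Real.pi * (ξ / 2 ^ j))| := by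
  rcases eq_or_ne ξ 0 with rfl | hne
  · simp; norm_num
  have habs : |2 * ξ| = 2 * |ξ| := by rw [abs_mul, abs_two]
  have hsin := two_mul_abs_le_abs_sin_pi_mul (t := 2 * ξ) (by rw [habs]; linarith)
  rw [← abs_prod_cos_mul_abs_sin ξ N, habs] at hsin
  refine le_of_mul_le_mul_right (hsin.trans' ?_ |>.trans ?_) (by positivity : 0 < 8 * |ξ|)
  · linarith
  · gcongr ?_ * ?_
    calc 2 ^ N * |Real.sin (Real.pi * (2 * ξ / 2 ^ N))| ≤ 2 ^ N * (4 * |2 * ξ / 2 ^ N|) := by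
          gcongr; exact abs_sin_pi_mul_le _
      _ = 8 * |ξ| := by
          rw [abs_div, habs, abs_of_pos (by positivity : (0 : ℝ) < 2 ^ N)]; field_simp; norm_num

section Filters

variable {K L s : ℕ} {m₀ m₁ φhat : ℝ → ℂ}

theorem IsLowPassFilter.norm_le (hm₀ : IsLowPassFilter K L m₀)
    (hs : 4 ^ s * binomSum K L ≤ 4 ^ K) (ξ : ℝ) :
    ‖m₀ ξ‖ ≤ (2 * |Real.cos (Real.pi * ξ)|) ^ K / 2 ^ s := by
  refine le_of_pow_le_pow_left₀ two_ne_zero (by positivity) ?_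
  have hpoly : ∑ n ∈ Finset.range L, ((K - 1 + n).choose n : ℝ) * Real.sin (Real.pi * ξ) ^ (2 * n) ≤
      binomSum K L := by
    refine Finset.sum_le_sum fun n _ => mul_le_of_le_one_right (by positivity) ?_
    rw [pow_mul]
    exact pow_le_one₀ (sq_nonneg _) (Real.sin_sq_le_one _)
  have hmass : binomSum K L ≤ 4 ^ K / 4 ^ s := by rwa [le_div_iff₀' (by positivity)]
  calc ‖m₀ ξ‖ ^ 2 = |Real.cos (Real.pi * ξ)| ^ (2 * K) * ∑ n ∈ Finset.range L,
        ((K - 1 + n).choose n : ℝ) * Real.sin (Real.pi * ξ) ^ (2 * n) := by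
        rw [hm₀ ξ, pow_mul |_|, sq_abs, pow_mul]
    _ ≤ |Real.cos (Real.pi * ξ)| ^ (2 * K) * (4 ^ K / 4 ^ s) := by gcongr; exact hpoly.trans hmass
    _ = ((2 * |Real.cos (Real.pi * ξ)|) ^ K / 2 ^ s) ^ 2 := by
        rw [show (4 : ℝ) = 2 ^ 2 by norm_num, div_pow, mul_pow, ← pow_mul, ← pow_mul, ← pow_mul]
        ring

theorem IsLowPassFilter.norm_le_one (hm₀ : IsLowPassFilter K L m₀) (hK : 1 ≤ K) (ξ : ℝ) :
    ‖m₀ ξ‖ ≤ 1 := by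
  have h := one_sub_pow_mul_sum_choose_le_one hK L (sq_nonneg (Real.sin (Real.pi * ξ)))
    (Real.sin_sq_le_one _)
  rw [← sq_le_one_iff₀ (norm_nonneg _), hm₀ ξ]
  simpa only [← Real.cos_sq', ← pow_mul] using h

theorem IsLowPassFilter.le_norm (hm₀ : IsLowPassFilter K L m₀) (hL : 1 ≤ L) (ξ : ℝ) :
    |Real.cos (Real.pi * ξ)| ^ K ≤ ‖m₀ ξ‖ := by
  refine le_of_pow_le_pow_left₀ two_ne_zero (norm_nonneg _) ?_
  have hterm (n : ℕ) : 0 ≤ ((K - 1 + n).choose n : ℝ) * Real.sin (Real.pi * ξ) ^ (2 * n) := by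
    rw [pow_mul]; positivity
  have hone : (1 : ℝ) ≤ ∑ n ∈ Finset.range L,
      ((K - 1 + n).choose n : ℝ) * Real.sin (Real.pi * ξ) ^ (2 * n) :=
    le_of_eq_of_le (by simp) (Finset.single_le_sum (fun n _ => hterm n) (Finset.mem_range.2 hL))
  rw [hm₀ ξ, ← pow_mul, mul_comm K 2, pow_mul, sq_abs, ← pow_mul]
  exact le_mul_of_one_le_right (by rw [pow_mul]; positivity) hone

theorem IsBandPassFilter.norm_eq (hm₁ : IsBandPassFilter m₀ m₁) (ξ : ℝ) :
    ‖m₁ ξ‖ = ‖m₀ (ξ + 1 / 2)‖ := by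
  have h := hm₁ ξ
  rwa [sq_eq_sq₀ (norm_nonneg _) (norm_nonneg _)] at h

theorem abs_cos_pi_mul_add_half (ξ : ℝ) :
    |Real.cos (Real.pi * (ξ + 1 / 2))| = |Real.sin (Real.pi * ξ)| := by
  rw [mul_add, mul_one_div, Real.cos_add_pi_div_two, abs_neg]

theorem IsBandPassFilter.norm_le (hm₁ : IsBandPassFilter m₀ m₁) (hm₀ : IsLowPassFilter K L m₀)
    (hs : 4 ^ s * binomSum K L ≤ 4 ^ K) (hK : 1 ≤ K) (x : ℝ) :
    ‖m₁ (4 * x)‖ ≤ 32 ^ K * min 1 |x| ^ K := by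
  rw [hm₁.norm_eq]
  rcases le_total 1 |x| with hx | hx
  · rw [min_eq_left hx, one_pow, mul_one]
    exact (hm₀.norm_le_one hK _).trans (one_le_pow₀ (by norm_num))
  · calc ‖m₀ (4 * x + 1 / 2)‖ ≤ (2 * |Real.sin (Real.pi * (4 * x))|) ^ K / 2 ^ s := by
          simpa only [abs_cos_pi_mul_add_half] using hm₀.norm_le hs (4 * x + 1 / 2)
      _ ≤ (2 * |Real.sin (Real.pi * (4 * x))|) ^ K :=
          div_le_self (by positivity) (one_le_pow₀ one_le_two)
      _ ≤ (2 * (4 * |4 * x|)) ^ K := by gcongr; exact abs_sin_pi_mul_le _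
      _ = 32 ^ K * min 1 |x| ^ K := by
          rw [min_eq_right hx, ← mul_pow, abs_mul, abs_of_pos (by norm_num : (0 : ℝ) < 4)]
          ring

theorem IsBandPassFilter.le_norm (hm₁ : IsBandPassFilter m₀ m₁) (hm₀ : IsLowPassFilter K L m₀)
    (hL : 1 ≤ L) {x : ℝ} (hx : |x| ≤ 1 / 6) : (4 * |x|) ^ K ≤ ‖m₁ (4 * x)‖ := by
  have habs : |4 * x| = 4 * |x| := by rw [abs_mul, abs_of_pos (by norm_num : (0 : ℝ) < 4)]
  calc (4 * |x|) ^ K ≤ |Real.sin (Real.pi * (4 * x))| ^ K := by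
        rw [← habs]
        exact pow_le_pow_left₀ (abs_nonneg _) (abs_le_abs_sin_pi_mul (by rw [habs]; linarith)) K
    _ ≤ ‖m₁ (4 * x)‖ := by
        rw [hm₁.norm_eq, ← abs_cos_pi_mul_add_half]; exact hm₀.le_norm hL _

/-! ### The infinite product -/

theorem IsInfiniteProduct.measurable (hφ : IsInfiniteProduct m₀ φhat) (hm : Measurable m₀) :
    Measurable φhat :=
  measurable_of_tendsto_metrizable
    (f := fun (N : ℕ) ξ => ∏ j ∈ Finset.range N, m₀ (ξ / 2 ^ j))
    (fun N => by fun_prop) (tendsto_pi_nhds.2 hφ)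

theorem IsInfiniteProduct.tendsto_norm (hφ : IsInfiniteProduct m₀ φhat) (ξ : ℝ) :
    Tendsto (fun N : ℕ => ∏ j ∈ Finset.range N, ‖m₀ (ξ / 2 ^ j)‖) atTop (𝓝 ‖φhat ξ‖) := by
  simpa only [norm_prod] using (hφ ξ).norm

theorem IsInfiniteProduct.norm_le_prod (hφ : IsInfiniteProduct m₀ φhat) (hle : ∀ ξ, ‖m₀ ξ‖ ≤ 1)
    (ξ : ℝ) (N : ℕ) : ‖φhat ξ‖ ≤ ∏ j ∈ Finset.range N, ‖m₀ (ξ / 2 ^ j)‖ := by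
  have hanti : Antitone fun N : ℕ => ∏ j ∈ Finset.range N, ‖m₀ (ξ / 2 ^ j)‖ := by
    refine antitone_nat_of_succ_le fun N => ?_
    rw [Finset.prod_range_succ]
    exact mul_le_of_le_one_right (Finset.prod_nonneg fun _ _ => norm_nonneg _) (hle _)
  exact hanti.le_of_tendsto (hφ.tendsto_norm ξ) N

theorem IsInfiniteProduct.norm_le_one (hφ : IsInfiniteProduct m₀ φhat) (hle : ∀ ξ, ‖m₀ ξ‖ ≤ 1)
    (ξ : ℝ) : ‖φhat ξ‖ ≤ 1 := by
  simpa using hφ.norm_le_prod hle ξ 0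

theorem IsLowPassFilter.prod_norm_le (hm₀ : IsLowPassFilter K L m₀)
    (hs : 4 ^ s * binomSum K L ≤ 4 ^ K) {ξ : ℝ} {n : ℕ} (hle : 2 ^ n ≤ |ξ|)
    (hlt : |ξ| < 2 ^ (n + 1)) :
    ∏ j ∈ Finset.range (n + 3), ‖m₀ (ξ / 2 ^ j)‖ ≤ 2 ^ K / (2 ^ (n + 3)) ^ s := by
  calc ∏ j ∈ Finset.range (n + 3), ‖m₀ (ξ / 2 ^ j)‖
      ≤ ∏ j ∈ Finset.range (n + 3), (2 * |Real.cos (Real.pi * (ξ / 2 ^ j))|) ^ K / 2 ^ s :=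
        Finset.prod_le_prod (fun _ _ => norm_nonneg _) fun j _ => hm₀.norm_le hs _
    _ = (2 ^ (n + 3) * |∏ j ∈ Finset.range (n + 3), Real.cos (Real.pi * (ξ / 2 ^ j))|) ^ K /
          (2 ^ (n + 3)) ^ s := by
        rw [Finset.prod_div_distrib, Finset.prod_pow, Finset.prod_mul_distrib, Finset.abs_prod,
          Finset.prod_const, Finset.prod_const, Finset.card_range, ← pow_mul, ← pow_mul,
          mul_comm s]
    _ ≤ (2 ^ (n + 3) * (2 / 2 ^ (n + 3))) ^ K / (2 ^ (n + 3)) ^ s := by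
        gcongr; exact abs_prod_cos_le hle hlt
    _ = 2 ^ K / (2 ^ (n + 3)) ^ s := by rw [mul_div_cancel₀ _ (by positivity)]

theorem IsInfiniteProduct.norm_le (hφ : IsInfiniteProduct m₀ φhat)
    (hm₀ : IsLowPassFilter K L m₀) (hs : 4 ^ s * binomSum K L ≤ 4 ^ K) (hsK : s ≤ K)
    (hK : 1 ≤ K) (ξ : ℝ) : ‖φhat ξ‖ ≤ 2 ^ K * (1 + |ξ|)⁻¹ ^ s := by
  have hone := hm₀.norm_le_one hK
  rw [inv_pow, ← div_eq_mul_inv, le_div_iff₀ (by positivity)]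
  rcases le_total |ξ| 1 with hξ | hξ
  · calc ‖φhat ξ‖ * (1 + |ξ|) ^ s ≤ 1 * 2 ^ s := by
          gcongr
          · exact hφ.norm_le_one hone ξ
          · linarith
      _ ≤ 2 ^ K := by rw [one_mul]; exact pow_le_pow_right₀ one_le_two hsK
  · obtain ⟨n, hle, hlt⟩ := exists_nat_pow_near hξ one_lt_two
    have hshift : 1 + |ξ| ≤ 2 ^ (n + 3) := by
      rw [show n + 3 = n + 1 + 2 by rfl, pow_add]
      linarith [one_le_pow₀ (n := n + 1) (one_le_two : (1 : ℝ) ≤ 2)]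
    calc ‖φhat ξ‖ * (1 + |ξ|) ^ s ≤ 2 ^ K / (2 ^ (n + 3)) ^ s * (2 ^ (n + 3)) ^ s := by
          gcongr
          exact (hφ.norm_le_prod hone ξ _).trans (hm₀.prod_norm_le hs hle hlt)
      _ = 2 ^ K := div_mul_cancel₀ _ (by positivity)

theorem IsInfiniteProduct.le_norm (hφ : IsInfiniteProduct m₀ φhat)
    (hm₀ : IsLowPassFilter K L m₀) (hL : 1 ≤ L) {ξ : ℝ} (hξ : |ξ| ≤ 1 / 4) :
    (1 / 2) ^ K ≤ ‖φhat ξ‖ := by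
  refine ge_of_tendsto' (hφ.tendsto_norm ξ) fun N => ?_
  calc (1 / 2 : ℝ) ^ K ≤ |∏ j ∈ Finset.range N, Real.cos (Real.pi * (ξ / 2 ^ j))| ^ K := by
        gcongr; exact half_le_abs_prod_cos hξ N
    _ = ∏ j ∈ Finset.range N, |Real.cos (Real.pi * (ξ / 2 ^ j))| ^ K := by
        rw [Finset.abs_prod, Finset.prod_pow]
    _ ≤ ∏ j ∈ Finset.range N, ‖m₀ (ξ / 2 ^ j)‖ :=
        Finset.prod_le_prod (fun _ _ => by positivity) fun j _ => hm₀.le_norm hL _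

/-! ### The generator -/

/-- The majorant `min(1, |η₁|)⁵ ∏ᵢ (1 + |ηᵢ|)⁻³` of the Fourier transform of a generator: the
first factor expresses vanishing moments in the first coordinate, the product its smoothness. -/
def decayProfile (η : E3) : ℝ := min 1 |η 0| ^ 5 * ∏ i, (1 + |η i|)⁻¹ ^ 3

theorem norm_generatorFT_le (hφ : IsInfiniteProduct m₀ φhat)
    (hm₀ : IsLowPassFilter K L m₀) (hm₁ : IsBandPassFilter m₀ m₁)
    (hs : 4 ^ 3 * binomSum K L ≤ 4 ^ K) (hK : 5 ≤ K) (η : E3) :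
    ‖generatorFT m₁ φhat η‖ ≤ 32 ^ K * (2 ^ K) ^ 3 * decayProfile η := by
  have hφhat (x : ℝ) : ‖φhat x‖ ≤ 2 ^ K * (1 + |x|)⁻¹ ^ 3 :=
    hφ.norm_le hm₀ hs (by omega) (by omega) x
  have hφhat_two (x : ℝ) : ‖φhat (2 * x)‖ ≤ 2 ^ K * (1 + |x|)⁻¹ ^ 3 := by
    refine (hφhat _).trans ?_
    gcongr 2 ^ K * (1 + ?_)⁻¹ ^ 3
    rw [abs_mul, abs_two]
    linarith [abs_nonneg x]
  have hmin : min 1 |η 0| ^ K ≤ min 1 |η 0| ^ 5 :=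
    pow_le_pow_of_le_one (by positivity) (min_le_left _ _) hK
  rw [generatorFT, norm_mul, norm_mul, norm_mul, decayProfile, Fin.prod_univ_three]
  calc _ ≤ (32 ^ K * min 1 |η 0| ^ 5) * (2 ^ K * (1 + |η 0|)⁻¹ ^ 3) *
        (2 ^ K * (1 + |η 1|)⁻¹ ^ 3) * (2 ^ K * (1 + |η 2|)⁻¹ ^ 3) := by
        gcongr
        · exact (hm₁.norm_le hm₀ hs (by omega) _).trans (by gcongr)
        · exact hφhat _
        · exact hφhat_two _
        · exact hφhat_two _
    _ = _ := by ring

/-- The truncated wedge `{ρ ≤ |η₁| ≤ 1/6, |η₂|, |η₃| ≤ |η₁|/2}`, on which the Fourier transform of a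
generator is to be bounded below. -/
def core (ρ : ℝ) : Set E3 :=
  {η | ρ ≤ |η 0| ∧ |η 0| ≤ 1 / 6 ∧ |η 1| ≤ |η 0| / 2 ∧ |η 2| ≤ |η 0| / 2}

theorem le_norm_generatorFT (hφ : IsInfiniteProduct m₀ φhat)
    (hm₀ : IsLowPassFilter K L m₀) (hm₁ : IsBandPassFilter m₀ m₁) (hL : 1 ≤ L) {ρ : ℝ}
    (hρ : 0 ≤ ρ) {η : E3} (hη : η ∈ core ρ) :
    (4 * ρ) ^ K * ((1 / 2) ^ K) ^ 3 ≤ ‖generatorFT m₁ φhat η‖ := by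
  obtain ⟨hlower, hupper, hone, htwo⟩ := hη
  have hφhat_two (x : ℝ) (hx : |x| ≤ |η 0| / 2) : (1 / 2) ^ K ≤ ‖φhat (2 * x)‖ :=
    hφ.le_norm hm₀ hL (by rw [abs_mul, abs_two]; linarith)
  rw [generatorFT, norm_mul, norm_mul, norm_mul]
  calc (4 * ρ) ^ K * ((1 / 2 : ℝ) ^ K) ^ 3
      = (4 * ρ) ^ K * (1 / 2) ^ K * (1 / 2) ^ K * (1 / 2) ^ K := by ring
    _ ≤ _ := by
      gcongr
      · exact le_trans (by gcongr) (hm₁.le_norm hm₀ hL hupper)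
      · exact hφ.le_norm hm₀ hL (by linarith)
      · exact hφhat_two _ hone
      · exact hφhat_two _ htwo

theorem measurable_generatorFT (hm₁ : Measurable m₁) (hφ : Measurable φhat) :
    Measurable (generatorFT m₁ φhat) := by
  unfold generatorFT
  fun_prop

end Filters

/-! ### Lattice sums -/

/-- The constant `∑_{k ∈ ℤ} (1 + |k|)⁻²`, which bounds the sums over shears and over the sampling
lattice. -/
def inverseSquareSum : ℝ≥0∞ := ∑' k : ℤ, ENNReal.ofReal ((1 + |(k : ℝ)|)⁻¹ ^ 2)

theorem inverseSquareSum_ne_top : inverseSquareSum ≠ ⊤ := by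
  have hnat : Summable fun n : ℕ => (1 + (n : ℝ))⁻¹ ^ 2 := by
    simpa [add_comm] using (summable_nat_add_iff 1).2 (Real.summable_nat_pow_inv.2 one_lt_two)
  exact (Summable.of_nat_of_neg (f := fun k : ℤ => (1 + |(k : ℝ)|)⁻¹ ^ 2) (by simpa using hnat)
    (by simpa using hnat)).tsum_ofReal_ne_top

theorem tsum_inv_one_add_abs_sub_sq_le (t : ℝ) :
    ∑' k : ℤ, ENNReal.ofReal ((1 + |t - k|)⁻¹ ^ 2) ≤ 4 * inverseSquareSum := by
  rw [← (Equiv.addRight ⌊t⌋).tsum_eq, inverseSquareSum, ← ENNReal.tsum_mul_left]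
  refine ENNReal.tsum_le_tsum fun k => ?_
  rw [show (4 : ℝ≥0∞) = ENNReal.ofReal 4 by simp, ← ENNReal.ofReal_mul (by norm_num)]
  refine ENNReal.ofReal_le_ofReal ?_
  have hfract : t - ((Equiv.addRight ⌊t⌋ k : ℤ) : ℝ) = Int.fract t - k := by
    simp only [Equiv.coe_addRight, Int.cast_add, Int.fract]
    ring
  have hdist : (1 + |(k : ℝ)|) / 2 ≤ 1 + |Int.fract t - k| := by
    have htri := abs_sub (Int.fract t) (Int.fract t - k)
    rw [sub_sub_cancel, abs_of_nonneg (Int.fract_nonneg t)] at htri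
    linarith [Int.fract_lt_one t, abs_nonneg (Int.fract t - k)]
  rw [hfract]
  calc (1 + |Int.fract t - k|)⁻¹ ^ 2 ≤ ((1 + |(k : ℝ)|) / 2)⁻¹ ^ 2 := by gcongr
    _ = 4 * (1 + |(k : ℝ)|)⁻¹ ^ 2 := by rw [inv_div, div_eq_mul_inv, mul_pow]; norm_num

theorem tsum_inv_one_add_abs_sub_mul_sq_le (b : ℝ) {a : ℝ} (ha : a ≠ 0) :
    ∑' k : ℤ, ENNReal.ofReal ((1 + |b - k * a|)⁻¹ ^ 2) ≤
      ENNReal.ofReal ((min 1 |a|)⁻¹ ^ 2) * (4 * inverseSquareSum) := by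
  have hmin : 0 < min 1 |a| := lt_min one_pos (abs_pos.2 ha)
  refine le_trans ?_ (mul_le_mul_right (tsum_inv_one_add_abs_sub_sq_le (b / a)) _)
  rw [← ENNReal.tsum_mul_left]
  refine ENNReal.tsum_le_tsum fun k => ?_
  rw [← ENNReal.ofReal_mul (by positivity), ← mul_pow, ← mul_inv]
  refine ENNReal.ofReal_le_ofReal ?_
  have hscale : |b - k * a| = |a| * |b / a - k| := by
    rw [← abs_mul]
    congr 1
    field_simp
  have hle : min 1 |a| * (1 + |b / a - k|) ≤ 1 + |b - k * a| := by
    rw [hscale, mul_add, mul_one]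
    exact add_le_add (min_le_left _ _) (by gcongr; exact min_le_right _ _)
  gcongr

/-- The constant `∑_{i ∈ ℤ} r^{-|i|}`, which bounds the sums over scales. -/
def twoSidedGeomSum (r : ℝ) : ℝ≥0∞ := ∑' i : ℤ, ENNReal.ofReal (r⁻¹ ^ i.natAbs)

theorem twoSidedGeomSum_ne_top {r : ℝ} (hr : 1 < r) : twoSidedGeomSum r ≠ ⊤ := by
  have hgeom : Summable fun n : ℕ => r⁻¹ ^ n :=
    summable_geometric_of_lt_one (by positivity) (inv_lt_one_of_one_lt₀ hr)
  exact (Summable.of_nat_of_neg (f := fun i : ℤ => r⁻¹ ^ i.natAbs) (by simpa using hgeom)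
    (by simpa using hgeom)).tsum_ofReal_ne_top

theorem tsum_min_div_pow_inv_le {r x : ℝ} (hr : 1 < r) (hx : 1 ≤ x) :
    ∑' j : ℕ, ENNReal.ofReal (min (x / r ^ j) (x / r ^ j)⁻¹) ≤
      ENNReal.ofReal r * twoSidedGeomSum r := by
  obtain ⟨n, hle, hlt⟩ := exists_nat_pow_near hx hr
  have hr0 : 0 < r := by linarith
  rw [twoSidedGeomSum, ← ENNReal.tsum_mul_left]
  refine le_trans ?_ (ENNReal.tsum_comp_le_tsum_of_injective
    (f := fun j : ℕ => (j : ℤ) - n) (fun a b h => by simpa using h) _)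
  refine ENNReal.tsum_le_tsum fun j => ?_
  rw [← ENNReal.ofReal_mul hr0.le]
  refine ENNReal.ofReal_le_ofReal ?_
  rcases le_total n j with hnj | hjn
  · obtain ⟨i, rfl⟩ := Nat.exists_eq_add_of_le hnj
    have hexp : (((n + i : ℕ) : ℤ) - n).natAbs = i := by omega
    calc min (x / r ^ (n + i)) (x / r ^ (n + i))⁻¹ ≤ x / r ^ (n + i) := min_le_left _ _
      _ ≤ r ^ (n + 1) / r ^ (n + i) := by gcongr
      _ = r * r⁻¹ ^ (((n + i : ℕ) : ℤ) - n).natAbs := by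
        rw [hexp, pow_succ, pow_add, inv_pow]; field_simp
  · obtain ⟨i, rfl⟩ := Nat.exists_eq_add_of_le hjn
    have hexp : ((j : ℤ) - (j + i : ℕ)).natAbs = i := by omega
    calc min (x / r ^ j) (x / r ^ j)⁻¹ ≤ (x / r ^ j)⁻¹ := min_le_right _ _
      _ ≤ (r ^ (j + i) / r ^ j)⁻¹ := by gcongr
      _ = r⁻¹ ^ i := by rw [pow_add, mul_div_cancel_left₀ _ (by positivity), inv_pow]
      _ ≤ r * r⁻¹ ^ ((j : ℤ) - (j + i : ℕ)).natAbs := by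
        rw [hexp]; exact le_mul_of_one_le_left (by positivity) hr.le

/-! ### Overlaps of dilated and sheared functions -/

/-- The matrix `S_{-k}ᵀ A_{2^{-j}}` with `p = (j, k)`, through which the Fourier transforms of the
shearlets with index `p` depend on `ξ`. -/
def dualMatrix (α : ℝ) (p : ℕ × ℤ × ℤ) : Matrix (Fin 3) (Fin 3) ℝ :=
  (shearMatrix (-p.2)).transpose * scalingMatrix α (-(p.1 : ℤ))

/-- The overlap `∑ₚ |w(Sₚ ξ)| |w(Sₚ ξ + ω)|` of a generator and its translate, for a family of
linear maps `Sₚ`. -/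
def dualOverlap {ι V : Type*} [AddCommGroup V] [Module ℝ V] (S : ι → V →ₗ[ℝ] V) (w : V → ℂ)
    (ξ ω : V) : ℝ≥0∞ :=
  ∑' p, ‖w (S p ξ)‖ₑ * ‖w (S p ξ + ω)‖ₑ

/-- The function `Φ(ξ, ω)` formed with an arbitrary function `g` in place of `ψ̂`. -/
def overlapSum (α : ℝ) (g : E3 → ℂ) (ξ ω : E3) : ℝ≥0∞ :=
  dualOverlap (fun p : ScaleShear α => Matrix.toEuclideanLin (dualMatrix α p)) g ξ ω

theorem act_apply (M : Matrix (Fin 3) (Fin 3) ℝ) (x : E3) (i : Fin 3) :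
    act M x i = M i 0 * x 0 + M i 1 * x 1 + M i 2 * x 2 := by
  simp [act, Matrix.toLpLin_apply, Matrix.mulVec, dotProduct, Fin.sum_univ_three]

theorem two_rpow_neg_mul_div_two (α : ℝ) (j : ℕ) :
    (2 : ℝ) ^ (((-(j : ℤ) : ℤ) : ℝ) * α / 2) = ((2 ^ (α / 2)) ^ j)⁻¹ := by
  rw [← Real.rpow_natCast, ← Real.rpow_mul two_pos.le, ← Real.rpow_neg two_pos.le]
  congr 1
  push_cast
  ring

section DualCoordinates

variable (α : ℝ) (j : ℕ) (k : ℤ × ℤ) (ξ : E3)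

theorem act_dualMatrix_zero : act (dualMatrix α (j, k)) ξ 0 = ξ 0 / (2 ^ (α / 2)) ^ j := by
  rw [act_apply, dualMatrix, scalingMatrix, two_rpow_neg_mul_div_two]
  simp [shearMatrix, Matrix.mul_apply, Fin.sum_univ_three, div_eq_inv_mul]

theorem act_dualMatrix_one : act (dualMatrix α (j, k)) ξ 1 =
    2 ^ (-(j : ℝ) / 2) * ξ 1 - k.1 * (ξ 0 / (2 ^ (α / 2)) ^ j) := by
  rw [act_apply, dualMatrix, scalingMatrix, two_rpow_neg_mul_div_two]
  simp [shearMatrix, Matrix.mul_apply, Fin.sum_univ_three, div_eq_inv_mul]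
  ring

theorem act_dualMatrix_two : act (dualMatrix α (j, k)) ξ 2 =
    2 ^ (-(j : ℝ) / 2) * ξ 2 - k.2 * (ξ 0 / (2 ^ (α / 2)) ^ j) := by
  rw [act_apply, dualMatrix, scalingMatrix, two_rpow_neg_mul_div_two]
  simp [shearMatrix, Matrix.mul_apply, Fin.sum_univ_three, div_eq_inv_mul]
  ring

end DualCoordinates

/-- The weight `∏ᵢ (1 + |ωᵢ|)⁻²`, which dominates `Γ` and is summable over lattices. -/
def latticeWeight (ω : E3) : ℝ := ∏ i, (1 + |ω i|)⁻¹ ^ 2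

theorem latticeWeight_nonneg (ω : E3) : 0 ≤ latticeWeight ω := by
  unfold latticeWeight
  positivity

/-- The sum `(1 + |t|)⁻² + (1 + |t + v|)⁻²`, in which the decay transverse to the first coordinate
that is not spent on `latticeWeight` is collected. -/
def pairDecay (v t : ℝ) : ℝ := (1 + |t|)⁻¹ ^ 2 + (1 + |t + v|)⁻¹ ^ 2

theorem pairDecay_nonneg (v t : ℝ) : 0 ≤ pairDecay v t := by
  unfold pairDecay
  positivity

theorem inv_one_add_abs_pow_mul_le (t v : ℝ) :
    (1 + |t|)⁻¹ ^ 3 * (1 + |t + v|)⁻¹ ^ 3 ≤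
      (1 + |v|)⁻¹ ^ 2 * ((1 + |t|)⁻¹ * (1 + |t + v|)⁻¹) := by
  have hpeetre : 1 + |v| ≤ (1 + |t|) * (1 + |t + v|) := by
    have htri := abs_sub (t + v) t
    rw [add_sub_cancel_left] at htri
    nlinarith [mul_nonneg (abs_nonneg t) (abs_nonneg (t + v))]
  calc (1 + |t|)⁻¹ ^ 3 * (1 + |t + v|)⁻¹ ^ 3
      = ((1 + |t|) * (1 + |t + v|))⁻¹ ^ 2 * ((1 + |t|)⁻¹ * (1 + |t + v|)⁻¹) := by
        rw [mul_inv]; ring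
    _ ≤ _ := by gcongr

theorem inv_one_add_abs_pow_mul_le_left (t v : ℝ) :
    (1 + |t|)⁻¹ ^ 3 * (1 + |t + v|)⁻¹ ^ 3 ≤ (1 + |v|)⁻¹ ^ 2 * (1 + |t|)⁻¹ := by
  refine (inv_one_add_abs_pow_mul_le t v).trans ?_
  gcongr
  refine mul_le_of_le_one_right (by positivity) (inv_le_one_of_one_le₀ ?_)
  linarith [abs_nonneg (t + v)]

theorem inv_one_add_abs_pow_mul_le_pairDecay (t v : ℝ) :
    (1 + |t|)⁻¹ ^ 3 * (1 + |t + v|)⁻¹ ^ 3 ≤ (1 + |v|)⁻¹ ^ 2 * pairDecay v t := by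
  refine (inv_one_add_abs_pow_mul_le t v).trans ?_
  unfold pairDecay
  gcongr
  have hprod : 0 ≤ (1 + |t|)⁻¹ * (1 + |t + v|)⁻¹ := by positivity
  linarith [sq_nonneg ((1 + |t|)⁻¹ - (1 + |t + v|)⁻¹), add_sq (1 + |t|)⁻¹ (1 + |t + v|)⁻¹]

theorem decayProfile_mul_decayProfile_add_le (η ω : E3) :
    decayProfile η * decayProfile (η + ω) ≤ latticeWeight ω *
      (min 1 |η 0| ^ 5 * (1 + |η 0|)⁻¹ * (pairDecay (ω 1) (η 1) * pairDecay (ω 2) (η 2))) := by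
  have hmin : min 1 |η 0 + ω 0| ^ 5 ≤ 1 := pow_le_one₀ (by positivity) (min_le_left _ _)
  have hone := pairDecay_nonneg (ω 1) (η 1)
  simp only [decayProfile, latticeWeight, Fin.prod_univ_three, PiLp.add_apply]
  calc _ = (min 1 |η 0| ^ 5 * min 1 |η 0 + ω 0| ^ 5) *
        ((1 + |η 0|)⁻¹ ^ 3 * (1 + |η 0 + ω 0|)⁻¹ ^ 3) *
        ((1 + |η 1|)⁻¹ ^ 3 * (1 + |η 1 + ω 1|)⁻¹ ^ 3) *
        ((1 + |η 2|)⁻¹ ^ 3 * (1 + |η 2 + ω 2|)⁻¹ ^ 3) := by ring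
    _ ≤ (min 1 |η 0| ^ 5 * 1) * ((1 + |ω 0|)⁻¹ ^ 2 * (1 + |η 0|)⁻¹) *
        ((1 + |ω 1|)⁻¹ ^ 2 * pairDecay (ω 1) (η 1)) *
        ((1 + |ω 2|)⁻¹ ^ 2 * pairDecay (ω 2) (η 2)) := by
      have hzero := inv_one_add_abs_pow_mul_le_left (η 0) (ω 0)
      have hfirst := inv_one_add_abs_pow_mul_le_pairDecay (η 1) (ω 1)
      have hsecond := inv_one_add_abs_pow_mul_le_pairDecay (η 2) (ω 2)
      gcongr
    _ = _ := by ring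

theorem tsum_pairDecay_le (b v : ℝ) {a : ℝ} (ha : a ≠ 0) :
    ∑' k : ℤ, ENNReal.ofReal (pairDecay v (b - k * a)) ≤
      ENNReal.ofReal ((min 1 |a|)⁻¹ ^ 2) * (8 * inverseSquareSum) := by
  calc _ = ∑' k : ℤ, (ENNReal.ofReal ((1 + |b - k * a|)⁻¹ ^ 2) +
        ENNReal.ofReal ((1 + |(b + v) - k * a|)⁻¹ ^ 2)) := by
        refine tsum_congr fun k => ?_
        rw [pairDecay, ENNReal.ofReal_add (by positivity) (by positivity), add_sub_right_comm]
    _ ≤ ENNReal.ofReal ((min 1 |a|)⁻¹ ^ 2) * (4 * inverseSquareSum) +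
        ENNReal.ofReal ((min 1 |a|)⁻¹ ^ 2) * (4 * inverseSquareSum) := by
        rw [ENNReal.tsum_add]
        exact add_le_add (tsum_inv_one_add_abs_sub_mul_sq_le _ ha)
          (tsum_inv_one_add_abs_sub_mul_sq_le _ ha)
    _ = _ := by ring

theorem min_one_abs_pow_mul_inv_le {a : ℝ} (ha : a ≠ 0) :
    min 1 |a| ^ 5 * (1 + |a|)⁻¹ * ((min 1 |a|)⁻¹ ^ 2 * (min 1 |a|)⁻¹ ^ 2) ≤ min |a| |a|⁻¹ := by
  have habs : 0 < |a| := abs_pos.2 ha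
  have hmin : 0 < min 1 |a| := lt_min one_pos habs
  have hcancel : min 1 |a| ^ 5 * (1 + |a|)⁻¹ * ((min 1 |a|)⁻¹ ^ 2 * (min 1 |a|)⁻¹ ^ 2) =
      min 1 |a| * (1 + |a|)⁻¹ := by field_simp
  rw [hcancel]
  refine le_min ?_ ?_
  · exact (mul_le_of_le_one_right hmin.le (inv_le_one_of_one_le₀ (by linarith))).trans
      (min_le_right _ _)
  · exact (mul_le_of_le_one_left (by positivity) (min_le_left _ _)).trans
      (inv_anti₀ habs (by linarith))

theorem tsum_pairDecay_mul_pairDecay_le (b b' v v' : ℝ) {a : ℝ} (ha : a ≠ 0) :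
    ∑' k : ℤ × ℤ, ENNReal.ofReal (min 1 |a| ^ 5 * (1 + |a|)⁻¹ *
        (pairDecay v (b - k.1 * a) * pairDecay v' (b' - k.2 * a))) ≤
      ENNReal.ofReal (min |a| |a|⁻¹) * (8 * inverseSquareSum) ^ 2 := by
  have hmin : 0 < min 1 |a| := lt_min one_pos (abs_pos.2 ha)
  have hfactor : 0 ≤ min 1 |a| ^ 5 * (1 + |a|)⁻¹ := by positivity
  have hsq : 0 ≤ (min 1 |a|)⁻¹ ^ 2 := by positivity
  calc _ = ENNReal.ofReal (min 1 |a| ^ 5 * (1 + |a|)⁻¹) *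
        ((∑' k : ℤ, ENNReal.ofReal (pairDecay v (b - k * a))) *
          ∑' k : ℤ, ENNReal.ofReal (pairDecay v' (b' - k * a))) := by
        simp only [ENNReal.ofReal_mul hfactor, ENNReal.ofReal_mul (pairDecay_nonneg _ _),
          ENNReal.tsum_mul_left, ENNReal.tsum_prod', ENNReal.tsum_mul_right]
    _ ≤ ENNReal.ofReal (min 1 |a| ^ 5 * (1 + |a|)⁻¹) *
        ((ENNReal.ofReal ((min 1 |a|)⁻¹ ^ 2) * (8 * inverseSquareSum)) *
          (ENNReal.ofReal ((min 1 |a|)⁻¹ ^ 2) * (8 * inverseSquareSum))) := by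
        gcongr <;> exact tsum_pairDecay_le _ _ ha
    _ = ENNReal.ofReal (min 1 |a| ^ 5 * (1 + |a|)⁻¹ *
          ((min 1 |a|)⁻¹ ^ 2 * (min 1 |a|)⁻¹ ^ 2)) * (8 * inverseSquareSum) ^ 2 := by
        rw [ENNReal.ofReal_mul hfactor, ENNReal.ofReal_mul hsq]
        ring
    _ ≤ _ := by
        gcongr
        exact min_one_abs_pow_mul_inv_le ha

theorem one_lt_two_rpow_half {α : ℝ} (hα : 0 < α) : (1 : ℝ) < 2 ^ (α / 2) :=
  Real.one_lt_rpow one_lt_two (half_pos hα)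

theorem tsum_decayProfile_mul_le {α : ℝ} (hα : 0 < α) {ξ : E3} (hξ : 1 ≤ |ξ 0|) (ω : E3) :
    ∑' p : ℕ × ℤ × ℤ, ENNReal.ofReal (decayProfile (act (dualMatrix α p) ξ) *
        decayProfile (act (dualMatrix α p) ξ + ω)) ≤
      ENNReal.ofReal (2 ^ (α / 2)) * twoSidedGeomSum (2 ^ (α / 2)) * (8 * inverseSquareSum) ^ 2 *
        ENNReal.ofReal (latticeWeight ω) := by
  have hr := one_lt_two_rpow_half hα
  set r : ℝ := 2 ^ (α / 2)
  have hξ0 : ξ 0 ≠ 0 := abs_pos.1 (by linarith)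
  have hscale (j : ℕ) : ∑' k : ℤ × ℤ, ENNReal.ofReal (decayProfile (act (dualMatrix α (j, k)) ξ) *
      decayProfile (act (dualMatrix α (j, k)) ξ + ω)) ≤ ENNReal.ofReal (latticeWeight ω) *
        (ENNReal.ofReal (min (|ξ 0| / r ^ j) (|ξ 0| / r ^ j)⁻¹) *
          (8 * inverseSquareSum) ^ 2) := by
    have hpow : (0 : ℝ) < r ^ j := by positivity
    have hshear := tsum_pairDecay_mul_pairDecay_le (2 ^ (-(j : ℝ) / 2) * ξ 1)
      (2 ^ (-(j : ℝ) / 2) * ξ 2) (ω 1) (ω 2) (div_ne_zero hξ0 hpow.ne')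
    rw [abs_div, abs_of_pos hpow] at hshear
    refine le_trans ?_ (mul_le_mul_right hshear _)
    rw [← ENNReal.tsum_mul_left]
    refine ENNReal.tsum_le_tsum fun k => ?_
    rw [← ENNReal.ofReal_mul (latticeWeight_nonneg ω)]
    refine ENNReal.ofReal_le_ofReal ((decayProfile_mul_decayProfile_add_le _ ω).trans_eq ?_)
    rw [act_dualMatrix_zero, act_dualMatrix_one, act_dualMatrix_two, abs_div, abs_of_pos hpow]
  rw [ENNReal.tsum_prod']
  refine (ENNReal.tsum_le_tsum hscale).trans ?_
  rw [ENNReal.tsum_mul_left, ENNReal.tsum_mul_right, mul_comm]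
  gcongr
  exact tsum_min_div_pow_inv_le hr hξ

theorem exists_overlapSum_le {α : ℝ} (hα : 0 < α) {g : E3 → ℂ} {C : ℝ}
    (hg : ∀ η, ‖g η‖ ≤ C * decayProfile η) :
    ∃ X : ℝ≥0∞, X ≠ ⊤ ∧ ∀ ξ ω : E3, 1 ≤ |ξ 0| →
      overlapSum α g ξ ω ≤ X * ENNReal.ofReal (latticeWeight ω) := by
  refine ⟨ENNReal.ofReal (C ^ 2) * (ENNReal.ofReal (2 ^ (α / 2)) *
    twoSidedGeomSum (2 ^ (α / 2)) * (8 * inverseSquareSum) ^ 2), ?_, fun ξ ω hξ => ?_⟩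
  · have hgeom := twoSidedGeomSum_ne_top (one_lt_two_rpow_half hα)
    have hint := ENNReal.mul_ne_top (ENNReal.ofNat_ne_top (n := 8)) inverseSquareSum_ne_top
    exact ENNReal.mul_ne_top ENNReal.ofReal_ne_top (ENNReal.mul_ne_top
      (ENNReal.mul_ne_top ENNReal.ofReal_ne_top hgeom) (ENNReal.pow_ne_top hint))
  · have hterm (η : E3) : ‖g η‖ₑ * ‖g (η + ω)‖ₑ ≤
        ENNReal.ofReal (C ^ 2) * ENNReal.ofReal (decayProfile η * decayProfile (η + ω)) := by
      rw [← ofReal_norm, ← ofReal_norm, ← ENNReal.ofReal_mul (norm_nonneg _),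
        ← ENNReal.ofReal_mul (sq_nonneg C)]
      refine ENNReal.ofReal_le_ofReal ((mul_le_mul (hg η) (hg (η + ω)) (norm_nonneg _)
        ((norm_nonneg _).trans (hg η))).trans_eq ?_)
      ring
    calc overlapSum α g ξ ω ≤ ∑' p : ScaleShear α, ENNReal.ofReal (C ^ 2) *
          ENNReal.ofReal (decayProfile (act (dualMatrix α p) ξ) *
            decayProfile (act (dualMatrix α p) ξ + ω)) :=
          ENNReal.tsum_le_tsum fun p => hterm _
      _ ≤ ENNReal.ofReal (C ^ 2) * ∑' p : ℕ × ℤ × ℤ, ENNReal.ofReal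
          (decayProfile (act (dualMatrix α p) ξ) * decayProfile (act (dualMatrix α p) ξ + ω)) := by
          rw [ENNReal.tsum_mul_left]
          gcongr
          exact ENNReal.tsum_comp_le_tsum_of_injective Subtype.val_injective _
      _ ≤ _ := by
          rw [mul_assoc]
          gcongr
          exact tsum_decayProfile_mul_le hα hξ ω

/-! ### Lower bound for the diagonal overlap -/

theorem one_le_abs_of_mem_pyramid {ξ : E3} (hξ : ξ ∈ pyramid) : 1 ≤ |ξ 0| := by
  rcases hξ with h | h
  · exact h.1.trans (le_abs_self _)
  · exact (le_neg.1 h.1).trans (neg_le_abs _)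

theorem exists_scale_abs_div_pow_mem {r : ℝ} (hr : 1 < r) {x : ℝ} (hx : 1 ≤ |x|) :
    ∃ j : ℕ, (6 * r)⁻¹ ≤ |x / r ^ j| ∧ |x / r ^ j| ≤ 1 / 6 := by
  obtain ⟨n, hle, hlt⟩ := exists_nat_pow_near (show 1 ≤ 6 * |x| by linarith) hr
  have hr0 : 0 < r := by linarith
  refine ⟨n + 1, ?_, ?_⟩ <;> rw [abs_div, abs_of_pos (pow_pos hr0 _)]
  · rw [le_div_iff₀ (by positivity), inv_mul_le_iff₀ (by positivity), pow_succ]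
    nlinarith
  · rw [div_le_iff₀ (by positivity)]
    linarith

theorem abs_round_le_ceil {x s : ℝ} (hx : |x| ≤ s) : |round x| ≤ ⌈s⌉ := by
  obtain ⟨hlow, hup⟩ := abs_le.1 (hx.trans (Int.le_ceil s))
  refine abs_le.2 ⟨?_, ?_⟩
  · have h := Int.floor_le_floor (add_le_add_left hlow (1 / 2))
    rwa [← round_eq, ← round_eq, ← Int.cast_neg, round_intCast] at h
  · have h := Int.floor_le_floor (add_le_add_left hup (1 / 2))
    rwa [← round_eq, ← round_eq, round_intCast] at h

theorem exists_int_abs_le_ceil_and_abs_sub_mul_le {x s : ℝ} (hx : |x| ≤ s) (a : ℝ) :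
    ∃ k : ℤ, |k| ≤ ⌈s⌉ ∧ |x * a - k * a| ≤ |a| / 2 := by
  refine ⟨round x, abs_round_le_ceil hx, ?_⟩
  rw [← sub_mul, abs_mul]
  nlinarith [abs_sub_round x, abs_nonneg a]

theorem exists_dualMatrix_mem_core {α : ℝ} (hα : 0 < α) {ξ : E3} (hξ : ξ ∈ pyramid) :
    ∃ p : ScaleShear α, act (dualMatrix α p) ξ ∈ core (6 * 2 ^ (α / 2))⁻¹ := by
  have hξ0 : ξ 0 ≠ 0 := abs_pos.1 (by linarith [one_le_abs_of_mem_pyramid hξ])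
  obtain ⟨j, hlow, hup⟩ :=
    exists_scale_abs_div_pow_mem (one_lt_two_rpow_half hα) (one_le_abs_of_mem_pyramid hξ)
  set s : ℝ := 2 ^ ((j : ℝ) * (α - 1) / 2)
  have hs : 0 < s := by positivity
  have hscale : (2 : ℝ) ^ (-(j : ℝ) / 2) = s * ((2 ^ (α / 2)) ^ j)⁻¹ := by
    rw [← Real.rpow_natCast, ← Real.rpow_mul two_pos.le, ← Real.rpow_neg two_pos.le,
      ← Real.rpow_add two_pos]
    congr 1
    ring
  -- Rounding `s * (t / ξ 0)` gives the shear; the admissible range of shears is just large enough.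
  have hshear (t : ℝ) (ht : |t / ξ 0| ≤ 1) : ∃ k : ℤ, |k| ≤ ⌈s⌉ ∧
      |2 ^ (-(j : ℝ) / 2) * t - k * (ξ 0 / (2 ^ (α / 2)) ^ j)| ≤
        |ξ 0 / (2 ^ (α / 2)) ^ j| / 2 := by
    have hratio : |s * (t / ξ 0)| ≤ s := by
      rw [abs_mul, abs_of_pos hs]
      exact mul_le_of_le_one_right hs.le ht
    convert exists_int_abs_le_ceil_and_abs_sub_mul_le hratio (ξ 0 / (2 ^ (α / 2)) ^ j) using 6
    rw [hscale]
    field_simp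
  obtain ⟨hone, htwo⟩ : |ξ 1 / ξ 0| ≤ 1 ∧ |ξ 2 / ξ 0| ≤ 1 := hξ.elim And.right And.right
  obtain ⟨k₁, hk₁, hη₁⟩ := hshear _ hone
  obtain ⟨k₂, hk₂, hη₂⟩ := hshear _ htwo
  refine ⟨⟨(j, k₁, k₂), hk₁, hk₂⟩, ?_⟩
  simpa only [core, Set.mem_ofPred_eq, act_dualMatrix_zero, act_dualMatrix_one,
    act_dualMatrix_two] using ⟨hlow, hup, hη₁, hη₂⟩

theorem ofReal_sq_le_overlapSum {α : ℝ} (hα : 0 < α) {g : E3 → ℂ} {ε : ℝ} (hε : 0 ≤ ε)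
    (hg : ∀ η ∈ core (6 * 2 ^ (α / 2))⁻¹, ε ≤ ‖g η‖) {ξ : E3} (hξ : ξ ∈ pyramid) :
    ENNReal.ofReal (ε ^ 2) ≤ overlapSum α g ξ 0 := by
  obtain ⟨p, hp⟩ := exists_dualMatrix_mem_core hα hξ
  refine le_trans ?_ (ENNReal.le_tsum p)
  rw [add_zero, ← ofReal_norm, ← ENNReal.ofReal_mul (norm_nonneg _), sq]
  exact ENNReal.ofReal_le_ofReal (mul_le_mul (hg _ hp) (hg _ hp) hε (norm_nonneg _))

/-! ### Dense sampling makes the off-diagonal terms small -/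

theorem tsum_prod_comp_eq_pow {ι : Type*} (f : ι → ℝ≥0∞) (n : ℕ) :
    ∑' m : Fin n → ι, ∏ i, f (m i) = (∑' k, f k) ^ n := by
  induction n with
  | zero => simp
  | succ n ih =>
    rw [← (Fin.consEquiv fun _ => ι).tsum_eq, ENNReal.tsum_prod']
    simp only [Fin.consEquiv_apply, Fin.prod_univ_succ, Fin.cons_zero, Fin.cons_succ,
      ENNReal.tsum_mul_left, ENNReal.tsum_mul_right, ih, pow_succ']

theorem tsum_latticeWeight_intVec :
    ∑' m : Fin 3 → ℤ, ENNReal.ofReal (latticeWeight (intVec m)) = inverseSquareSum ^ 3 := by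
  rw [inverseSquareSum, ← tsum_prod_comp_eq_pow]
  refine tsum_congr fun m => ?_
  rw [latticeWeight, ENNReal.ofReal_prod_of_nonneg fun i _ => by positivity]
  rfl

theorem latticeWeight_neg (ω : E3) : latticeWeight (-ω) = latticeWeight ω := by
  simp [latticeWeight]

theorem inv_one_add_abs_div_sq_le {c : ℝ} (hc : 0 < c) (hc_one : c ≤ 1) (x : ℝ) :
    (1 + |x / c|)⁻¹ ^ 2 ≤ (1 + |x|)⁻¹ ^ 2 := by
  have habs : |x| ≤ |x / c| := by
    rw [abs_div, abs_of_pos hc, le_div_iff₀ hc]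
    exact mul_le_of_le_one_right (abs_nonneg _) hc_one
  gcongr

theorem inv_one_add_abs_div_sq_le_mul {c c' x : ℝ} (hc : 0 < c) (hcc' : c ≤ c') (hx : 1 ≤ |x|) :
    (1 + |x / c|)⁻¹ ^ 2 ≤ 4 * c' ^ 2 * (1 + |x|)⁻¹ ^ 2 := by
  have hc' : 0 < c' := hc.trans_le hcc'
  have hle : (1 + |x|) / (2 * c') ≤ 1 + |x / c| := by
    calc (1 + |x|) / (2 * c') ≤ (|x| + |x|) / (2 * c) := by gcongr
      _ = |x / c| := by rw [abs_div, abs_of_pos hc]; ring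
      _ ≤ 1 + |x / c| := by linarith
  calc (1 + |x / c|)⁻¹ ^ 2 ≤ ((1 + |x|) / (2 * c'))⁻¹ ^ 2 := by gcongr
    _ = _ := by rw [inv_div, div_eq_mul_inv]; ring

theorem act_samplingMatrix_inv_apply {c₁ c₂ : ℝ} (h₁ : 0 < c₁) (h₂ : 0 < c₂) (x : E3) (i : Fin 3) :
    act (samplingMatrix c₁ c₂)⁻¹ x i = x i / ![c₁, c₂, c₂] i := by
  have hinv : (samplingMatrix c₁ c₂)⁻¹ = Matrix.diagonal fun i => (![c₁, c₂, c₂] i)⁻¹ := by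
    refine Matrix.inv_eq_right_inv ?_
    rw [samplingMatrix, Matrix.diagonal_mul_diagonal, ← Matrix.diagonal_one]
    congr 1
    ext i
    fin_cases i <;> simp [h₁.ne', h₂.ne']
  rw [hinv, act, Matrix.toLpLin_apply, PiLp.toLp_apply, Matrix.mulVec_diagonal,
    div_eq_inv_mul]

theorem latticeWeight_samplingMatrix_inv_le {c₁ c₂ : ℝ} (h₂ : 0 < c₂) (h₂₁ : c₂ ≤ c₁) (h₁ : c₁ ≤ 1)
    {m : Fin 3 → ℤ} (hm : m ≠ 0) :
    latticeWeight (act (samplingMatrix c₁ c₂)⁻¹ (intVec m)) ≤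
      4 * c₁ ^ 2 * latticeWeight (intVec m) := by
  have hpos : ∀ i, 0 < ![c₁, c₂, c₂] i := by
    simpa [Fin.forall_fin_succ] using ⟨h₂.trans_le h₂₁, h₂⟩
  have hle : ∀ i, ![c₁, c₂, c₂] i ≤ c₁ := by simpa [Fin.forall_fin_succ] using h₂₁
  obtain ⟨i, hi⟩ := Function.ne_iff.1 hm
  have habs : (1 : ℝ) ≤ |(m i : ℝ)| := by exact_mod_cast Int.one_le_abs hi
  simp only [latticeWeight, act_samplingMatrix_inv_apply (h₂.trans_le h₂₁) h₂]
  rw [← Finset.mul_prod_erase _ _ (Finset.mem_univ i),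
    ← Finset.mul_prod_erase _ (fun i => (1 + |intVec m i|)⁻¹ ^ 2) (Finset.mem_univ i), ← mul_assoc]
  refine mul_le_mul (inv_one_add_abs_div_sq_le_mul (hpos i) (hle i) habs)
    (Finset.prod_le_prod (fun _ _ => by positivity) fun n _ => ?_)
    (Finset.prod_nonneg fun _ _ => by positivity) (by positivity)
  exact inv_one_add_abs_div_sq_le (hpos n) ((hle n).trans h₁) _

theorem Rsum_le {α : ℝ} {ψ : L2R3} {X : ℝ≥0∞}
    (hX : ∀ ω, maxOverlap α ψ ω ≤ X * ENNReal.ofReal (latticeWeight ω)) {c₁ c₂ : ℝ} (h₂ : 0 < c₂)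
    (h₂₁ : c₂ ≤ c₁) (h₁ : c₁ ≤ 1) :
    Rsum α c₁ c₂ ψ ≤ ENNReal.ofReal (c₁ ^ 2) * (4 * X * inverseSquareSum ^ 3) := by
  have hterm (m : {m : Fin 3 → ℤ // m ≠ 0}) :
      (maxOverlap α ψ (act (samplingMatrix c₁ c₂)⁻¹ (intVec m)) *
        maxOverlap α ψ (-act (samplingMatrix c₁ c₂)⁻¹ (intVec m))) ^ (1 / 2 : ℝ) ≤
      X * ENNReal.ofReal (4 * c₁ ^ 2 * latticeWeight (intVec m)) := by
    set ω := act (samplingMatrix c₁ c₂)⁻¹ (intVec m)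
    have hneg := hX (-ω)
    rw [latticeWeight_neg] at hneg
    calc _ ≤ ((X * ENNReal.ofReal (latticeWeight ω)) ^ (2 : ℝ)) ^ (1 / 2 : ℝ) := by
          rw [ENNReal.rpow_two, sq]
          exact ENNReal.rpow_le_rpow (mul_le_mul' (hX ω) hneg) (by norm_num)
      _ = X * ENNReal.ofReal (latticeWeight ω) := by
          rw [← ENNReal.rpow_mul, mul_one_div_cancel two_ne_zero, ENNReal.rpow_one]
      _ ≤ _ := by
          gcongr
          exact latticeWeight_samplingMatrix_inv_le h₂ h₂₁ h₁ m.2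
  calc Rsum α c₁ c₂ ψ
      ≤ ∑' m : {m : Fin 3 → ℤ // m ≠ 0},
          X * ENNReal.ofReal (4 * c₁ ^ 2 * latticeWeight (intVec m)) := ENNReal.tsum_le_tsum hterm
    _ ≤ ∑' m : Fin 3 → ℤ, X * ENNReal.ofReal (4 * c₁ ^ 2 * latticeWeight (intVec m)) :=
        ENNReal.tsum_comp_le_tsum_of_injective Subtype.val_injective
          fun m => X * ENNReal.ofReal (4 * c₁ ^ 2 * latticeWeight (intVec m))
    _ = X * (ENNReal.ofReal (4 * c₁ ^ 2) * inverseSquareSum ^ 3) := by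
        simp only [ENNReal.tsum_mul_left, tsum_latticeWeight_intVec,
          ENNReal.ofReal_mul (p := 4 * c₁ ^ 2) (by positivity)]
    _ = _ := by
        rw [ENNReal.ofReal_mul (by norm_num), ENNReal.ofReal_ofNat]
        ring

theorem exists_forall_Rsum_lt {α : ℝ} {ψ : L2R3} {X : ℝ≥0∞} (hX : X ≠ ⊤)
    (hΓ : ∀ ω, maxOverlap α ψ ω ≤ X * ENNReal.ofReal (latticeWeight ω)) {ε : ℝ≥0∞} (hε : ε ≠ 0) :
    ∃ c_max > 0, ∀ c₁ c₂ : ℝ, 0 < c₂ → c₂ ≤ c₁ → c₁ ≤ c_max → Rsum α c₁ c₂ ψ < ε := by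
  have hconst : 4 * X * inverseSquareSum ^ 3 ≠ ⊤ :=
    ENNReal.mul_ne_top (ENNReal.mul_ne_top ENNReal.ofNat_ne_top hX)
      (ENNReal.pow_ne_top inverseSquareSum_ne_top)
  have hlim : Tendsto (fun c : ℝ => ENNReal.ofReal (c ^ 2) * (4 * X * inverseSquareSum ^ 3))
      (𝓝[>] 0) (𝓝 0) := by
    have hcont : Continuous fun c : ℝ => ENNReal.ofReal (c ^ 2) :=
      ENNReal.continuous_ofReal.comp (continuous_pow 2)
    simpa using ENNReal.Tendsto.mul_const ((hcont.tendsto 0).mono_left nhdsWithin_le_nhds)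
      (Or.inr hconst)
  obtain ⟨c_max, hsmall, hpos⟩ := ((hlim.eventually (gt_mem_nhds hε.bot_lt)).and
    (Ioc_mem_nhdsGT one_pos)).exists
  refine ⟨c_max, hpos.1, fun c₁ c₂ h₂ h₂₁ hc => lt_of_le_of_lt ?_ hsmall⟩
  refine (Rsum_le hΓ h₂ h₂₁ (hc.trans hpos.2)).trans ?_
  have hc₁ : 0 ≤ c₁ := (h₂.trans_le h₂₁).le
  gcongr

/-! ### Affine changes of variables and the `L²` Fourier transform -/

section Affine

variable {V : Type*} [NormedAddCommGroup V] [InnerProductSpace ℝ V] [FiniteDimensional ℝ V]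
  {T S : V →ₗ[ℝ] V}

theorem det_ne_zero_of_inner_map_map (hTS : ∀ x y, inner ℝ (T x) (S y) = inner ℝ x y) :
    LinearMap.det T ≠ 0 := fun hdet => by
  obtain ⟨x, hker, hx⟩ := (Submodule.ne_bot_iff _).1 (LinearMap.bot_lt_ker_of_det_eq_zero hdet).ne'
  refine hx (inner_self_eq_zero (𝕜 := ℝ).1 ?_)
  rw [← hTS, LinearMap.mem_ker.1 hker, inner_zero_left]

theorem det_ne_zero_of_inner_map_map_right (hTS : ∀ x y, inner ℝ (T x) (S y) = inner ℝ x y) :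
    LinearMap.det S ≠ 0 :=
  det_ne_zero_of_inner_map_map fun x y => by rw [real_inner_comm, hTS, real_inner_comm]

theorem continuous_fourierChar_neg_inner (m : V) (S : V →ₗ[ℝ] V) :
    Continuous fun ξ => Real.fourierChar (-inner ℝ m (S ξ)) :=
  Real.continuous_fourierChar.comp
    (continuous_const.inner (LinearMap.continuous_of_finiteDimensional S)).neg

variable [MeasurableSpace V] [BorelSpace V]

theorem measurableEmbedding_linearMap_sub (hT : LinearMap.det T ≠ 0) (m : V) :
    MeasurableEmbedding fun x => T x - m :=
  ((LinearMap.equivOfDetNeZero T hT).toContinuousLinearEquiv.toHomeomorph.trans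
    (Homeomorph.subRight m)).measurableEmbedding

theorem map_linearMap_sub_volume (hT : LinearMap.det T ≠ 0) (m : V) :
    Measure.map (fun x => T x - m) (volume : Measure V) =
      ENNReal.ofReal |LinearMap.det T|⁻¹ • volume := by
  have hcont : Continuous T := LinearMap.continuous_of_finiteDimensional T
  rw [show (fun x => T x - m) = (fun y => y - m) ∘ T from rfl,
    ← Measure.map_map (by fun_prop) hcont.measurable,
    Measure.map_linearMap_addHaar_eq_smul_addHaar volume hT, Measure.map_smul,
    (measurePreserving_sub_right volume m).map_eq, abs_inv]

theorem lintegral_comp_linearMap (hT : LinearMap.det T ≠ 0) (g : V → ℝ≥0∞) :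
    ∫⁻ x, g (T x) = ENNReal.ofReal |LinearMap.det T|⁻¹ * ∫⁻ y, g y := by
  have h := (measurableEmbedding_linearMap_sub hT 0).lintegral_map (μ := volume) g
  rw [map_linearMap_sub_volume hT, lintegral_smul_measure, smul_eq_mul] at h
  simpa only [sub_zero] using h.symm

theorem integral_comp_linearMap_sub (hT : LinearMap.det T ≠ 0) (m : V) (g : V → ℂ) :
    ∫ x, g (T x - m) = |LinearMap.det T|⁻¹ • ∫ y, g y := by
  rw [← (measurableEmbedding_linearMap_sub hT m).integral_map, map_linearMap_sub_volume hT,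
    integral_smul_measure, ENNReal.toReal_ofReal (by positivity)]

theorem quasiMeasurePreserving_linearMap_sub (hT : LinearMap.det T ≠ 0) (m : V) :
    Measure.QuasiMeasurePreserving (fun x => T x - m) volume volume :=
  ⟨(measurableEmbedding_linearMap_sub hT m).measurable, by
    rw [map_linearMap_sub_volume hT]
    exact Measure.smul_absolutelyContinuous⟩

theorem eLpNorm_smul_comp_linearMap_sub (hT : LinearMap.det T ≠ 0) (m : V) (e : V → Circle)
    (f : V → ℂ) : eLpNorm (fun x => e x • f (T x - m)) 2 volume =
      ENNReal.ofReal |LinearMap.det T|⁻¹ ^ (1 / (2 : ℝ)) * eLpNorm f 2 volume := by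
  calc _ = eLpNorm (fun x => f (T x - m)) 2 volume :=
        eLpNorm_congr_norm_ae (Eventually.of_forall fun x => Circle.norm_smul _ _)
    _ = eLpNorm f 2 (Measure.map (fun x => T x - m) volume) :=
        ((measurableEmbedding_linearMap_sub hT m).eLpNorm_map_measure).symm
    _ = _ := by
        rw [map_linearMap_sub_volume hT, eLpNorm_smul_measure_of_ne_top (by norm_num)]
        simp

theorem memLp_smul_comp_linearMap_sub (hT : LinearMap.det T ≠ 0) (m : V) {e : V → Circle}
    (he : Continuous e) {f : V → ℂ} (hf : MemLp f 2 volume) :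
    MemLp (fun x => e x • f (T x - m)) 2 volume := by
  refine ⟨?_, ?_⟩
  · have hcomp := hf.1.comp_quasiMeasurePreserving (quasiMeasurePreserving_linearMap_sub hT m)
    exact he.aestronglyMeasurable.smul hcomp
  · rw [eLpNorm_smul_comp_linearMap_sub hT]
    exact ENNReal.mul_lt_top (ENNReal.rpow_lt_top_of_nonneg (by norm_num) ENNReal.ofReal_ne_top)
      hf.2

/-- The operator `f ↦ e · f(T · - m)` on `L²(V)`, for an invertible linear map `T` and a unimodular
function `e`. -/
def modulatedPullback (hT : LinearMap.det T ≠ 0) (m : V) {e : V → Circle} (he : Continuous e)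
    (f : Lp ℂ 2 (volume : Measure V)) : Lp ℂ 2 (volume : Measure V) :=
  (memLp_smul_comp_linearMap_sub hT m he (Lp.memLp f)).toLp

theorem coeFn_modulatedPullback (hT : LinearMap.det T ≠ 0) (m : V) {e : V → Circle}
    (he : Continuous e) (f : Lp ℂ 2 (volume : Measure V)) :
    modulatedPullback hT m he f =ᵐ[volume] fun x => e x • f (T x - m) :=
  MemLp.coeFn_toLp _

theorem continuous_modulatedPullback (hT : LinearMap.det T ≠ 0) (m : V) {e : V → Circle}
    (he : Continuous e) : Continuous (modulatedPullback hT m he) := by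
  have hfactor : ENNReal.ofReal |LinearMap.det T|⁻¹ ^ (1 / (2 : ℝ)) ≠ ⊤ :=
    ENNReal.rpow_ne_top_of_nonneg (by norm_num) ENNReal.ofReal_ne_top
  refine LipschitzWith.continuous
    (K := (ENNReal.ofReal |LinearMap.det T|⁻¹ ^ (1 / (2 : ℝ))).toNNReal) fun f g => ?_
  rw [ENNReal.coe_toNNReal hfactor, modulatedPullback, modulatedPullback, Lp.edist_toLp_toLp,
    Lp.edist_def, ← eLpNorm_smul_comp_linearMap_sub hT m e]
  refine le_of_eq (congrArg (eLpNorm · 2 volume) (funext fun x => ?_))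
  simp [smul_sub]

theorem fourier_comp_linearMap_sub (hTS : ∀ x y, inner ℝ (T x) (S y) = inner ℝ x y) (m : V)
    (f : V → ℂ) (ξ : V) : 𝓕 (fun x => f (T x - m)) ξ =
      |LinearMap.det T|⁻¹ • Real.fourierChar (-inner ℝ m (S ξ)) • 𝓕 f (S ξ) := by
  have hphase (x : V) : Real.fourierChar (-inner ℝ x ξ) • f (T x - m) =
      (fun y => Real.fourierChar (-inner ℝ m (S ξ)) •
        Real.fourierChar (-inner ℝ y (S ξ)) • f y) (T x - m) := by
    have hsplit : -inner ℝ x ξ = -inner ℝ m (S ξ) + -inner ℝ (T x - m) (S ξ) := by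
      rw [inner_sub_left, hTS]
      ring
    rw [hsplit, AddChar.map_add_eq_mul, mul_smul]
  rw [Real.fourier_eq, Real.fourier_eq, integral_congr_ae (Eventually.of_forall hphase),
    integral_comp_linearMap_sub (det_ne_zero_of_inner_map_map hTS) m fun y =>
      Real.fourierChar (-inner ℝ m (S ξ)) • Real.fourierChar (-inner ℝ y (S ξ)) • f y]
  simp only [Circle.smul_def, integral_smul]

theorem fourier_modulatedPullback (hT : LinearMap.det T ≠ 0) (hS : LinearMap.det S ≠ 0)
    (hTS : ∀ x y, inner ℝ (T x) (S y) = inner ℝ x y) (m : V) (ψ : Lp ℂ 2 (volume : Measure V)) :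
    𝓕 (modulatedPullback hT m (e := 1) continuous_const ψ) = |LinearMap.det T|⁻¹ •
      modulatedPullback hS 0 (continuous_fourierChar_neg_inner m S) (𝓕 ψ) := by
  refine DenseRange.induction_on
    (SchwartzMap.denseRange_toLpCLM (E := V) (F := ℂ) (p := 2) (μ := volume) ENNReal.ofNat_ne_top)
    ψ (isClosed_eq ?_ ?_) fun f => ?_
  · exact (Lp.fourierTransformₗᵢ V ℂ).continuous.comp (continuous_modulatedPullback hT m _)
  · exact ((continuous_modulatedPullback hS 0 _).comp
      (Lp.fourierTransformₗᵢ V ℂ).continuous).const_smul |LinearMap.det T|⁻¹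
  · let g : SchwartzMap V ℂ := SchwartzMap.compCLMOfContinuousLinearEquiv ℂ
      (LinearMap.equivOfDetNeZero T hT).toContinuousLinearEquiv (f.compSubConstCLM ℂ m)
    have hpullback : modulatedPullback hT m (e := 1) continuous_const (f.toLp 2) = g.toLp 2 := by
      refine Lp.ext ?_
      filter_upwards [coeFn_modulatedPullback hT m (e := 1) continuous_const (f.toLp 2),
        g.coeFn_toLp 2 volume,
        (quasiMeasurePreserving_linearMap_sub hT m).ae (f.coeFn_toLp 2 volume)] with x hx hgx hfx
      rw [hx, hgx, hfx]
      exact one_smul _ _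
    rw [SchwartzMap.toLpCLM_apply, hpullback, SchwartzMap.toLp_fourier_eq,
      SchwartzMap.toLp_fourier_eq]
    refine Lp.ext ?_
    filter_upwards [(𝓕 g).coeFn_toLp 2 volume, Lp.coeFn_smul |LinearMap.det T|⁻¹
        (modulatedPullback hS 0 (continuous_fourierChar_neg_inner m S) ((𝓕 f).toLp 2)),
      coeFn_modulatedPullback hS 0 (continuous_fourierChar_neg_inner m S) ((𝓕 f).toLp 2),
      (quasiMeasurePreserving_linearMap_sub hS 0).ae ((𝓕 f).coeFn_toLp 2 volume)]
      with ξ hleft hsmul hright hf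
    rw [hleft, hsmul, Pi.smul_apply, hright, hf, sub_zero, SchwartzMap.fourier_coe,
      SchwartzMap.fourier_coe]
    exact fourier_comp_linearMap_sub hTS m f ξ

theorem fourier_ae_eq_of_ae_eq_mul_comp_linearMap_sub
    (hTS : ∀ x y, inner ℝ (T x) (S y) = inner ℝ x y) {c : ℂ} {m : V}
    {ψ v : Lp ℂ 2 (volume : Measure V)} (hv : v =ᵐ[volume] fun x => c * ψ (T x - m)) :
    (𝓕 v : Lp ℂ 2 (volume : Measure V)) =ᵐ[volume] fun ξ => c * |LinearMap.det T|⁻¹ •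
      Real.fourierChar (-inner ℝ m (S ξ)) • (𝓕 ψ : Lp ℂ 2 (volume : Measure V)) (S ξ) := by
  have hT := det_ne_zero_of_inner_map_map hTS
  have hS := det_ne_zero_of_inner_map_map_right hTS
  let g := modulatedPullback hT m (e := 1) continuous_const ψ
  have hpullback : v = c • g := by
    refine Lp.ext (hv.trans ?_)
    filter_upwards [Lp.coeFn_smul c g, coeFn_modulatedPullback hT m (e := 1) continuous_const ψ]
      with x hsmul hx
    rw [hsmul, Pi.smul_apply, hx, smul_eq_mul]
    exact congrArg (c * ·) (one_smul Circle (ψ (T x - m))).symm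
  have hfourier : 𝓕 v = c • |LinearMap.det T|⁻¹ •
      modulatedPullback hS 0 (continuous_fourierChar_neg_inner m S) (𝓕 ψ) := by
    rw [hpullback, ← fourier_modulatedPullback hT hS hTS]
    exact (Lp.fourierTransformₗᵢ V ℂ).map_smul c g
  rw [hfourier]
  filter_upwards [Lp.coeFn_smul c (|LinearMap.det T|⁻¹ • modulatedPullback hS 0
      (continuous_fourierChar_neg_inner m S) (𝓕 ψ)),
    Lp.coeFn_smul |LinearMap.det T|⁻¹ (modulatedPullback hS 0
      (continuous_fourierChar_neg_inner m S) (𝓕 ψ)),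
    coeFn_modulatedPullback hS 0 (continuous_fourierChar_neg_inner m S) (𝓕 ψ)]
    with ξ hc hsmul hright
  rw [hc, Pi.smul_apply, hsmul, Pi.smul_apply, hright, sub_zero, smul_eq_mul]

end Affine

/-! ### Autocorrelations of summable families -/

section Autocorrelation

variable {Λ : Type*} [AddCommGroup Λ]

/-- The autocorrelation `d ↦ ∑ₗ aₗ conj(aₗ₊d)` of a family indexed by an abelian group. -/
def autocorrelation (a : Λ → ℂ) (d : Λ) : ℂ := ∑' l, a l * starRingEnd ℂ (a (l + d))

theorem ennreal_tsum_eq_zero_add_tsum_ne (b : Λ → ℝ≥0∞) :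
    ∑' d, b d = b 0 + ∑' d : {d : Λ // d ≠ 0}, b d := by
  rw [← ENNReal.summable.tsum_add_tsum_compl (s := {0}) ENNReal.summable, tsum_singleton (0 : Λ) b]
  rfl

theorem sq_tsum_eq_tsum_mul_add (b : Λ → ℝ≥0∞) :
    (∑' l, b l) ^ 2 = ∑' d, ∑' l, b l * b (l + d) := by
  rw [ENNReal.tsum_comm, sq, ← ENNReal.tsum_mul_right]
  refine tsum_congr fun l => ?_
  rw [ENNReal.tsum_mul_left]
  exact congrArg _ ((Equiv.addLeft l).tsum_eq b).symm

theorem enorm_autocorrelation_le (a : Λ → ℂ) (d : Λ) :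
    ‖autocorrelation a d‖ₑ ≤ ∑' l, ‖a l‖ₑ * ‖a (l + d)‖ₑ :=
  enorm_tsum_le_tsum_enorm.trans_eq (by simp only [enorm_mul, RCLike.enorm_conj])

theorem summable_mul_conj_add {a : Λ → ℂ} (ha : ∑' l, ‖a l‖ₑ ≠ ⊤) :
    Summable fun p : Λ × Λ => a p.2 * starRingEnd ℂ (a (p.2 + p.1)) := by
  refine Summable.of_enorm ?_
  rw [ENNReal.tsum_prod']
  simp only [enorm_mul, RCLike.enorm_conj]
  rw [← sq_tsum_eq_tsum_mul_add fun l => ‖a l‖ₑ]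
  exact ENNReal.pow_ne_top ha

theorem tsum_autocorrelation {a : Λ → ℂ} (ha : ∑' l, ‖a l‖ₑ ≠ ⊤) :
    ∑' d, autocorrelation a d = (∑' l, a l) * starRingEnd ℂ (∑' l, a l) := by
  have hcomm : ∑' d, autocorrelation a d = ∑' l, ∑' d, a l * starRingEnd ℂ (a (l + d)) :=
    (Summable.tsum_comm (f := fun d l => a l * starRingEnd ℂ (a (l + d)))
      (summable_mul_conj_add ha)).symm
  rw [hcomm, ← tsum_mul_right]
  refine tsum_congr fun l => ?_
  rw [tsum_mul_left, Complex.conj_tsum]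
  exact congrArg _ ((Equiv.addLeft l).tsum_eq fun d => starRingEnd ℂ (a d))

theorem enorm_autocorrelation_zero {a : Λ → ℂ} (ha : ∑' l, ‖a l‖ₑ ≠ ⊤) :
    ‖autocorrelation a 0‖ₑ = ∑' l, ‖a l‖ₑ ^ 2 := by
  have hterm (l : Λ) : a l * starRingEnd ℂ (a (l + 0)) = ((‖a l‖ ^ 2 : ℝ) : ℂ) := by
    rw [add_zero, Complex.mul_conj, Complex.normSq_eq_norm_sq]
  have hsum : Summable fun l => ‖a l‖ ^ 2 := by
    have h := (summable_mul_conj_add ha).prod_factor 0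
    simp only [hterm] at h
    exact_mod_cast h
  simp only [autocorrelation, hterm]
  rw [← Complex.ofReal_tsum, ← ofReal_norm, Complex.norm_real,
    Real.norm_of_nonneg (tsum_nonneg fun _ => sq_nonneg _),
    ENNReal.ofReal_tsum_of_nonneg (fun _ => sq_nonneg _) hsum]
  simp only [ENNReal.ofReal_pow (norm_nonneg _), ofReal_norm]

theorem enorm_tsum_sq_le (a : Λ → ℂ) : ‖∑' l, a l‖ₑ ^ 2 ≤
    ∑' l, ‖a l‖ₑ ^ 2 + ∑' d : {d : Λ // d ≠ 0}, ∑' l, ‖a l‖ₑ * ‖a (l + d)‖ₑ := by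
  calc _ ≤ (∑' l, ‖a l‖ₑ) ^ 2 := by gcongr; exact enorm_tsum_le_tsum_enorm
    _ = _ := by
      rw [sq_tsum_eq_tsum_mul_add, ennreal_tsum_eq_zero_add_tsum_ne]
      simp only [add_zero, sq]

theorem tsum_enorm_sq_le {a : Λ → ℂ} (ha : ∑' l, ‖a l‖ₑ ≠ ⊤) : ∑' l, ‖a l‖ₑ ^ 2 ≤
    ‖∑' l, a l‖ₑ ^ 2 + ∑' d : {d : Λ // d ≠ 0}, ∑' l, ‖a l‖ₑ * ‖a (l + d)‖ₑ := by
  have hsum : Summable (autocorrelation a) := (summable_mul_conj_add ha).prod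
  have hzero : autocorrelation a 0 =
      ∑' d, autocorrelation a d - ∑' d : {d : Λ // d ≠ 0}, autocorrelation a d := by
    rw [eq_sub_iff_add_eq, ← tsum_singleton (0 : Λ) (autocorrelation a)]
    exact Summable.tsum_add_tsum_compl (s := {0}) (hsum.subtype _) (hsum.subtype _)
  rw [← enorm_autocorrelation_zero ha, hzero, tsum_autocorrelation ha]
  refine enorm_sub_le.trans (add_le_add ?_ ?_)
  · rw [enorm_mul, RCLike.enorm_conj, sq]
  · exact enorm_tsum_le_tsum_enorm.trans
      (ENNReal.tsum_le_tsum fun d => enorm_autocorrelation_le a d)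

end Autocorrelation

/-! ### Periodization and Parseval's identity -/

theorem lintegral_enorm_sq_coeFn {X : Type*} [MeasurableSpace X] {μ : Measure X} (f : Lp ℂ 2 μ) :
    ∫⁻ x, ‖f x‖ₑ ^ 2 ∂μ = ‖f‖ₑ ^ 2 := by
  have h := eLpNorm_nnreal_pow_eq_lintegral (f := f) (μ := μ) (p := 2) two_ne_zero
  simp only [NNReal.coe_ofNat, ENNReal.rpow_two, ENNReal.coe_ofNat] at h
  rw [Lp.enorm_def, h]

section Periodization

/-- The Haar probability measure on `ℝ / ℤ`, with respect to which the Fourier coefficients on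
`UnitAddTorus` are taken. -/
local instance : MeasureSpace UnitAddCircle := ⟨AddCircle.haarAddCircle⟩

local instance : IsProbabilityMeasure (volume : Measure UnitAddCircle) :=
  inferInstanceAs (IsProbabilityMeasure AddCircle.haarAddCircle)

variable {d : Type*}

/-- The half-open unit cube `(0, 1]ᵈ`, in the form in which it is the target of
`UnitAddTorus.measurableEquivPiIoc 0`. -/
def unitCube (d : Type*) : Set (d → ℝ) := {x | ∀ i, x i ∈ Set.Ioc (0 : ℝ) (0 + 1)}

/-- An integer vector as an element of `ℝᵈ`. -/
def intShift (l : d → ℤ) : d → ℝ := fun i => (l i : ℝ)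

theorem intShift_add (l l' : d → ℤ) : intShift (l + l') = intShift l + intShift l' := by
  ext i
  simp [intShift]

theorem intShift_neg (l : d → ℤ) : intShift (-l) = -intShift l := by
  ext i
  simp [intShift]

theorem iUnion_preimage_add_unitCube :
    ⋃ l : d → ℤ, (fun x => x + intShift (-l)) ⁻¹' unitCube d = Set.univ := by
  refine Set.eq_univ_of_forall fun x => Set.mem_iUnion.2 ⟨fun i => ⌈x i⌉ - 1, fun i => ?_⟩
  simp only [intShift, Pi.add_apply, Pi.neg_apply, Set.mem_Ioc]
  push_cast
  constructor <;> linarith [Int.le_ceil (x i), Int.ceil_lt_add_one (x i)]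

theorem pairwise_disjoint_preimage_add_unitCube :
    Pairwise (Function.onFun Disjoint fun l : d → ℤ =>
      (fun x => x + intShift (-l)) ⁻¹' unitCube d) := by
  intro l l' hne
  refine Set.disjoint_left.2 fun x hx hx' => hne (funext fun i => ?_)
  have hl := hx i
  have hl' := hx' i
  simp only [intShift, Pi.add_apply, Pi.neg_apply, Set.mem_Ioc] at hl hl'
  push_cast at hl hl'
  have hlt : l i < l' i + 1 := by exact_mod_cast (by linarith : (l i : ℝ) < l' i + 1)
  have hgt : l' i < l i + 1 := by exact_mod_cast (by linarith : (l' i : ℝ) < l i + 1)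
  omega

theorem preimage_add_preimage_add_unitCube (l : d → ℤ) :
    (fun x => x + intShift l) ⁻¹' ((fun x => x + intShift (-l)) ⁻¹' unitCube d) = unitCube d := by
  ext x
  simp only [Set.mem_preimage, intShift_neg, add_neg_cancel_right]

/-- The representative in the unit cube of a point of the torus. -/
def cubeCoord (t : UnitAddTorus d) : d → ℝ := (UnitAddTorus.measurableEquivPiIoc (fun _ => 0) t).1

theorem coe_cubeCoord (t : UnitAddTorus d) : (fun i => (cubeCoord t i : UnitAddCircle)) = t :=
  (UnitAddTorus.measurableEquivPiIoc fun _ : d => (0 : ℝ)).symm_apply_apply t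

section Countable

variable [Countable d]

theorem measurableSet_unitCube : MeasurableSet (unitCube d) :=
  MeasurableSet.univ_pi' fun _ => measurableSet_Ioc

theorem measurableEmbedding_cubeCoord : MeasurableEmbedding (cubeCoord (d := d)) :=
  (MeasurableEmbedding.subtype_coe measurableSet_unitCube).comp
    (UnitAddTorus.measurableEquivPiIoc fun _ : d => (0 : ℝ)).measurableEmbedding

end Countable

variable [Fintype d]

theorem lintegral_eq_tsum_unitCube (g : (d → ℝ) → ℝ≥0∞) :
    ∫⁻ x, g x = ∑' l : d → ℤ, ∫⁻ x in unitCube d, g (x + intShift l) := by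
  rw [← setLIntegral_univ, ← iUnion_preimage_add_unitCube, lintegral_iUnion
    (fun l => (measurable_add_const _) measurableSet_unitCube)
    pairwise_disjoint_preimage_add_unitCube]
  refine tsum_congr fun l => ?_
  rw [← (measurePreserving_add_right volume (intShift l)).setLIntegral_comp_preimage_emb
    (measurableEmbedding_addRight _), preimage_add_preimage_add_unitCube]

theorem integral_eq_tsum_unitCube {g : (d → ℝ) → ℂ} (hg : Integrable g) :
    ∫ x, g x = ∑' l : d → ℤ, ∫ x in unitCube d, g (x + intShift l) := by
  have h := hasSum_integral_iUnion (μ := volume) (f := g)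
    (fun l : d → ℤ => (measurable_add_const (intShift (-l))) measurableSet_unitCube)
    pairwise_disjoint_preimage_add_unitCube hg.integrableOn
  rw [iUnion_preimage_add_unitCube, setIntegral_univ] at h
  rw [← h.tsum_eq]
  refine tsum_congr fun l => ?_
  rw [← (measurePreserving_add_right volume (intShift l)).setIntegral_preimage_emb
    (measurableEmbedding_addRight _), preimage_add_preimage_add_unitCube]

/-- The character `x ↦ e^{2πi⟨n, x⟩}` of `ℝᵈ`, obtained from the torus. -/
def cubeChar (n : d → ℤ) (x : d → ℝ) : ℂ :=
  UnitAddTorus.mFourier n (fun i => (x i : UnitAddCircle))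

theorem continuous_cubeChar (n : d → ℤ) : Continuous (cubeChar n) :=
  (UnitAddTorus.mFourier n).continuous.comp
    (continuous_pi fun i => (AddCircle.continuous_mk' 1).comp (continuous_apply i))

theorem cubeChar_add_intShift (n : d → ℤ) (x : d → ℝ) (l : d → ℤ) :
    cubeChar n (x + intShift l) = cubeChar n x := by
  refine congrArg (UnitAddTorus.mFourier n) (funext fun i => ?_)
  simp [intShift]

theorem cubeChar_eq_fourierChar (n : d → ℤ) (x : d → ℝ) :
    cubeChar n x = Real.fourierChar (∑ i, (n i : ℝ) * x i) := by
  simp only [cubeChar, UnitAddTorus.mFourier, ContinuousMap.coe_mk, fourier_coe_apply,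
    Real.fourierChar_apply, ← Complex.exp_sum]
  congr 1
  push_cast
  rw [Finset.mul_sum, Finset.sum_mul]
  exact Finset.sum_congr rfl fun i _ => by ring

theorem norm_cubeChar (n : d → ℤ) (x : d → ℝ) : ‖cubeChar n x‖ = 1 := by
  rw [cubeChar_eq_fourierChar, Circle.norm_coe]

theorem tsum_enorm_sq_mFourierCoeff (f : Lp ℂ 2 (volume : Measure (UnitAddTorus d))) :
    ∑' n : d → ℤ, ‖UnitAddTorus.mFourierCoeff f n‖ₑ ^ 2 = ∫⁻ t, ‖f t‖ₑ ^ 2 := by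
  have hsum := UnitAddTorus.hasSum_sq_mFourierCoeff f
  have hint : Integrable fun t => ‖f t‖ ^ 2 := (Lp.memLp f).integrable_norm_pow two_ne_zero
  have hofReal (z : ℂ) : ‖z‖ₑ ^ 2 = ENNReal.ofReal (‖z‖ ^ 2) := by
    rw [ENNReal.ofReal_pow (norm_nonneg _), ofReal_norm]
  simp only [hofReal]
  rw [← ENNReal.ofReal_tsum_of_nonneg (fun _ => sq_nonneg _) hsum.summable, hsum.tsum_eq,
    ofReal_integral_eq_lintegral_ofReal hint (Eventually.of_forall fun _ => sq_nonneg _)]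

theorem measurePreserving_cubeCoord :
    MeasurePreserving (cubeCoord (d := d)) volume (volume.restrict (unitCube d)) :=
  (MeasurePreserving.mk measurable_subtype_coe
    (map_comap_subtype_coe measurableSet_unitCube (volume : Measure (d → ℝ)))).comp
    (UnitAddTorus.measurePreserving_equivPiIoc fun _ : d => (0 : ℝ))

theorem mFourierCoeff_comp_cubeCoord (G : (d → ℝ) → ℂ) (n : d → ℤ) :
    UnitAddTorus.mFourierCoeff (G ∘ cubeCoord) n = ∫ x in unitCube d, cubeChar (-n) x * G x := by
  rw [← measurePreserving_cubeCoord.integral_comp measurableEmbedding_cubeCoord]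
  simp only [UnitAddTorus.mFourierCoeff, cubeChar, coe_cubeCoord, Function.comp_apply, smul_eq_mul]

theorem tsum_enorm_sq_setIntegral_cubeChar_mul {G : (d → ℝ) → ℂ}
    (hG : AEStronglyMeasurable G (volume.restrict (unitCube d)))
    (hfin : ∫⁻ x in unitCube d, ‖G x‖ₑ ^ 2 ≠ ⊤) :
    ∑' n : d → ℤ, ‖∫ x in unitCube d, cubeChar n x * G x‖ₑ ^ 2 =
      ∫⁻ x in unitCube d, ‖G x‖ₑ ^ 2 := by
  have hlint : ∫⁻ t, ‖(G ∘ cubeCoord) t‖ₑ ^ 2 = ∫⁻ x in unitCube d, ‖G x‖ₑ ^ 2 :=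
    measurePreserving_cubeCoord.lintegral_comp_emb measurableEmbedding_cubeCoord
      fun x => ‖G x‖ₑ ^ 2
  have hmem : MemLp (G ∘ cubeCoord) 2 volume := by
    refine ⟨hG.comp_measurePreserving measurePreserving_cubeCoord, ?_⟩
    rw [eLpNorm_lt_top_iff_lintegral_rpow_enorm_lt_top two_ne_zero ENNReal.ofNat_ne_top]
    simpa only [ENNReal.toReal_ofNat, ENNReal.rpow_two, hlint] using hfin.lt_top
  have hcoeff (n : d → ℤ) : UnitAddTorus.mFourierCoeff hmem.toLp n =
      ∫ x in unitCube d, cubeChar (-n) x * G x := by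
    rw [← mFourierCoeff_comp_cubeCoord]
    exact integral_congr_ae (by filter_upwards [hmem.coeFn_toLp] with t ht; rw [ht])
  calc _ = ∑' n : d → ℤ, ‖∫ x in unitCube d, cubeChar (-n) x * G x‖ₑ ^ 2 :=
        ((Equiv.neg (d → ℤ)).tsum_eq fun n =>
          ‖∫ x in unitCube d, cubeChar n x * G x‖ₑ ^ 2).symm
    _ = ∫⁻ t, ‖hmem.toLp (G ∘ cubeCoord) t‖ₑ ^ 2 := by
        simp only [← hcoeff, tsum_enorm_sq_mFourierCoeff]
    _ = ∫⁻ t, ‖(G ∘ cubeCoord) t‖ₑ ^ 2 :=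
        lintegral_congr_ae (by filter_upwards [hmem.coeFn_toLp] with t ht; rw [ht])
    _ = _ := hlint

/-- The `ℤᵈ`-periodization of a function on `ℝᵈ`. -/
def periodization (F : (d → ℝ) → ℂ) (x : d → ℝ) : ℂ := ∑' l : d → ℤ, F (x + intShift l)

/-- `∑_{l ≠ 0} ∫ |F(x)| |F(x + l)| dx`, which bounds the cross terms in the square of the
periodization of `F`. -/
def offDiagonal (F : (d → ℝ) → ℂ) : ℝ≥0∞ :=
  ∑' l : {l : d → ℤ // l ≠ 0}, ∫⁻ x, ‖F x‖ₑ * ‖F (x + intShift l)‖ₑ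

variable {F : (d → ℝ) → ℂ}

theorem setLIntegral_tsum_enorm_sq (hF : Measurable F) :
    ∫⁻ x in unitCube d, ∑' l : d → ℤ, ‖F (x + intShift l)‖ₑ ^ 2 = ∫⁻ x, ‖F x‖ₑ ^ 2 := by
  rw [lintegral_tsum fun l => by fun_prop, lintegral_eq_tsum_unitCube]

theorem setLIntegral_tsum_tsum_enorm_mul (hF : Measurable F) :
    ∫⁻ x in unitCube d, ∑' k : {k : d → ℤ // k ≠ 0}, ∑' l : d → ℤ,
      ‖F (x + intShift l)‖ₑ * ‖F (x + intShift (l + k.1))‖ₑ = offDiagonal F := by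
  rw [lintegral_tsum fun k => by fun_prop]
  refine tsum_congr fun k => ?_
  rw [lintegral_tsum fun l => by fun_prop, lintegral_eq_tsum_unitCube]
  simp only [intShift_add, add_assoc]

theorem ae_tsum_enorm_add_intShift_ne_top (hF : Measurable F) (hint : Integrable F) :
    ∀ᵐ x ∂(volume.restrict (unitCube d)), ∑' l : d → ℤ, ‖F (x + intShift l)‖ₑ ≠ ⊤ := by
  have hfin : ∫⁻ x in unitCube d, ∑' l : d → ℤ, ‖F (x + intShift l)‖ₑ ≠ ⊤ := by
    rw [lintegral_tsum fun l => by fun_prop, ← lintegral_eq_tsum_unitCube fun x => ‖F x‖ₑ]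
    exact hint.2.ne
  filter_upwards [ae_lt_top (by fun_prop) hfin] with x hx using hx.ne

theorem aestronglyMeasurable_periodization (hF : Measurable F) (hint : Integrable F) :
    AEStronglyMeasurable (periodization F) (volume.restrict (unitCube d)) := by
  refine aestronglyMeasurable_of_tendsto_ae (atTop : Filter (Finset (d → ℤ)))
    (f := fun s x => ∑ l ∈ s, F (x + intShift l))
    (fun s => Measurable.aestronglyMeasurable (by fun_prop)) ?_
  filter_upwards [ae_tsum_enorm_add_intShift_ne_top hF hint] with x hx
    using (Summable.of_enorm hx).hasSum

theorem setLIntegral_enorm_sq_periodization_le (hF : Measurable F) :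
    ∫⁻ x in unitCube d, ‖periodization F x‖ₑ ^ 2 ≤ (∫⁻ x, ‖F x‖ₑ ^ 2) + offDiagonal F := by
  rw [← setLIntegral_tsum_enorm_sq hF, ← setLIntegral_tsum_tsum_enorm_mul hF,
    ← lintegral_add_left (by fun_prop)]
  exact lintegral_mono fun x => enorm_tsum_sq_le fun l : d → ℤ => F (x + intShift l)

theorem lintegral_enorm_sq_le_periodization (hF : Measurable F) (hint : Integrable F) :
    ∫⁻ x, ‖F x‖ₑ ^ 2 ≤ (∫⁻ x in unitCube d, ‖periodization F x‖ₑ ^ 2) + offDiagonal F := by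
  rw [← setLIntegral_tsum_enorm_sq hF, ← setLIntegral_tsum_tsum_enorm_mul hF,
    ← lintegral_add_right _ (by fun_prop)]
  refine lintegral_mono_ae ?_
  filter_upwards [ae_tsum_enorm_add_intShift_ne_top hF hint] with x hx using tsum_enorm_sq_le hx

theorem setIntegral_cubeChar_mul_periodization (hF : Measurable F) (hint : Integrable F)
    (n : d → ℤ) :
    ∫ x in unitCube d, cubeChar n x * periodization F x = ∫ x, cubeChar n x * F x := by
  have hchar : Measurable (cubeChar n) := (continuous_cubeChar n).measurable
  have henorm (x : d → ℝ) : ‖cubeChar n x‖ₑ = 1 := by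
    rw [← ofReal_norm, norm_cubeChar, ENNReal.ofReal_one]
  have hmul : Integrable fun x => cubeChar n x * F x :=
    hint.bdd_mul (c := 1) hchar.aestronglyMeasurable
      (Eventually.of_forall fun x => (norm_cubeChar n x).le)
  rw [integral_eq_tsum_unitCube hmul, ← integral_tsum
    (fun l => Measurable.aestronglyMeasurable (by fun_prop))]
  · simp only [periodization, cubeChar_add_intShift, tsum_mul_left]
  · simp only [enorm_mul, henorm, one_mul]
    rw [← lintegral_eq_tsum_unitCube fun x => ‖F x‖ₑ]
    exact hint.2.ne

theorem tsum_enorm_sq_integral_cubeChar_mul (hF : Measurable F) (hint : Integrable F)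
    (hsq : ∫⁻ x, ‖F x‖ₑ ^ 2 ≠ ⊤) (hoff : offDiagonal F ≠ ⊤) :
    ∑' n : d → ℤ, ‖∫ x, cubeChar n x * F x‖ₑ ^ 2 =
      ∫⁻ x in unitCube d, ‖periodization F x‖ₑ ^ 2 := by
  simp only [← setIntegral_cubeChar_mul_periodization hF hint]
  exact tsum_enorm_sq_setIntegral_cubeChar_mul (aestronglyMeasurable_periodization hF hint)
    (ne_top_of_le_ne_top (ENNReal.add_ne_top.2 ⟨hsq, hoff⟩)
      (setLIntegral_enorm_sq_periodization_le hF))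

end Periodization

/-! ### Fourier coefficients along a lattice -/

section Lattice

theorem ofReal_sq_mul_ofReal_inv {a : ℝ} (ha : 0 < a) :
    ENNReal.ofReal (a ^ 2) * ENNReal.ofReal a⁻¹ = ENNReal.ofReal a := by
  rw [← ENNReal.ofReal_mul (sq_nonneg a), sq, mul_assoc, mul_inv_cancel₀ ha.ne', mul_one]

variable {d : Type*}

theorem measurable_comp_lattice [Finite d] {G : EuclideanSpace ℝ d → ℂ} (hG : Measurable G)
    (Q : EuclideanSpace ℝ d →ₗ[ℝ] EuclideanSpace ℝ d) :
    Measurable fun x : d → ℝ => G (Q (WithLp.toLp 2 x)) := by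
  cases nonempty_fintype d
  exact hG.comp ((LinearMap.continuous_of_finiteDimensional Q).measurable.comp
    (MeasurableEquiv.toLp 2 (d → ℝ)).measurable)

variable [Fintype d]

/-- An integer vector as a point of Euclidean space. -/
abbrev latticePoint (l : d → ℤ) : EuclideanSpace ℝ d := WithLp.toLp 2 (intShift l)

theorem cubeChar_eq_fourierChar_inner (n : d → ℤ) (x : d → ℝ) :
    cubeChar n x = Real.fourierChar (inner ℝ (latticePoint n) (WithLp.toLp 2 x)) := by
  rw [cubeChar_eq_fourierChar]
  simp [PiLp.inner_apply, intShift, mul_comm]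

theorem lintegral_comp_toLp (g : EuclideanSpace ℝ d → ℝ≥0∞) :
    ∫⁻ x : d → ℝ, g (WithLp.toLp 2 x) = ∫⁻ y, g y :=
  (PiLp.volume_preserving_toLp d).lintegral_comp_emb
    (MeasurableEquiv.toLp 2 (d → ℝ)).measurableEmbedding g

theorem integral_comp_toLp (g : EuclideanSpace ℝ d → ℂ) :
    ∫ x : d → ℝ, g (WithLp.toLp 2 x) = ∫ y, g y :=
  (PiLp.volume_preserving_toLp d).integral_comp
    (MeasurableEquiv.toLp 2 (d → ℝ)).measurableEmbedding g

/-- `∑_{l ≠ 0} ∫ |G(ξ)| |G(ξ + Q l)| dξ`, the analogue of `offDiagonal` for the lattice `Q ℤᵈ`. -/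
def latticeOffDiagonal (Q : EuclideanSpace ℝ d →ₗ[ℝ] EuclideanSpace ℝ d)
    (G : EuclideanSpace ℝ d → ℂ) : ℝ≥0∞ :=
  ∑' l : {l : d → ℤ // l ≠ 0}, ∫⁻ ξ, ‖G ξ‖ₑ * ‖G (ξ + Q (latticePoint l.1))‖ₑ

variable {Q R : EuclideanSpace ℝ d →ₗ[ℝ] EuclideanSpace ℝ d} {G : EuclideanSpace ℝ d → ℂ}

theorem lintegral_enorm_sq_comp_lattice (hQ : LinearMap.det Q ≠ 0) :
    ∫⁻ x : d → ℝ, ‖G (Q (WithLp.toLp 2 x))‖ₑ ^ 2 =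
      ENNReal.ofReal |LinearMap.det Q|⁻¹ * ∫⁻ ξ, ‖G ξ‖ₑ ^ 2 := by
  rw [lintegral_comp_toLp fun y => ‖G (Q y)‖ₑ ^ 2,
    lintegral_comp_linearMap hQ fun ξ => ‖G ξ‖ₑ ^ 2]

theorem offDiagonal_comp_lattice (hQ : LinearMap.det Q ≠ 0) :
    offDiagonal (fun x : d → ℝ => G (Q (WithLp.toLp 2 x))) =
      ENNReal.ofReal |LinearMap.det Q|⁻¹ * latticeOffDiagonal Q G := by
  rw [offDiagonal, latticeOffDiagonal, ← ENNReal.tsum_mul_left]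
  refine tsum_congr fun l => ?_
  rw [← lintegral_comp_linearMap hQ fun ξ => ‖G ξ‖ₑ * ‖G (ξ + Q (latticePoint l.1))‖ₑ,
    ← lintegral_comp_toLp]
  simp only [WithLp.toLp_add, map_add]

theorem integrable_comp_lattice (hQ : LinearMap.det Q ≠ 0) (hG : Measurable G)
    (hint : Integrable G) : Integrable fun x : d → ℝ => G (Q (WithLp.toLp 2 x)) := by
  refine ⟨(measurable_comp_lattice hG Q).aestronglyMeasurable, ?_⟩
  rw [hasFiniteIntegral_iff_enorm, lintegral_comp_toLp fun y => ‖G (Q y)‖ₑ,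
    lintegral_comp_linearMap hQ fun ξ => ‖G ξ‖ₑ]
  exact ENNReal.mul_lt_top ENNReal.ofReal_lt_top hint.2

theorem integral_fourierChar_mul_eq_cubeChar (hRQ : ∀ x y, inner ℝ (R x) (Q y) = inner ℝ x y)
    (n : d → ℤ) :
    ∫ ξ, (Real.fourierChar (inner ℝ (R (latticePoint n)) ξ) : ℂ) * G ξ =
      |LinearMap.det Q| • ∫ x : d → ℝ, cubeChar n x * G (Q (WithLp.toLp 2 x)) := by
  have hQ : LinearMap.det Q ≠ 0 := det_ne_zero_of_inner_map_map_right hRQ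
  have hsub := integral_comp_linearMap_sub hQ 0 fun ξ =>
    (Real.fourierChar (inner ℝ (R (latticePoint n)) ξ) : ℂ) * G ξ
  simp only [sub_zero, hRQ] at hsub
  simp only [cubeChar_eq_fourierChar_inner]
  rw [integral_comp_toLp fun y =>
    (Real.fourierChar (inner ℝ (latticePoint n) y) : ℂ) * G (Q y), hsub, smul_smul,
    mul_inv_cancel₀ (abs_ne_zero.2 hQ), one_smul]

theorem tsum_enorm_sq_integral_fourierChar_mul (hRQ : ∀ x y, inner ℝ (R x) (Q y) = inner ℝ x y)
    (hG : Measurable G) (hint : Integrable G) (hsq : ∫⁻ ξ, ‖G ξ‖ₑ ^ 2 ≠ ⊤)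
    (hoff : latticeOffDiagonal Q G ≠ ⊤) :
    ∑' n : d → ℤ, ‖∫ ξ, (Real.fourierChar (inner ℝ (R (latticePoint n)) ξ) : ℂ) * G ξ‖ₑ ^ 2 =
      ENNReal.ofReal (|LinearMap.det Q| ^ 2) *
        ∫⁻ x in unitCube d, ‖periodization (fun x => G (Q (WithLp.toLp 2 x))) x‖ₑ ^ 2 := by
  have hQ : LinearMap.det Q ≠ 0 := det_ne_zero_of_inner_map_map_right hRQ
  rw [← tsum_enorm_sq_integral_cubeChar_mul (measurable_comp_lattice hG Q)
    (integrable_comp_lattice hQ hG hint), ← ENNReal.tsum_mul_left]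
  · refine tsum_congr fun n => ?_
    rw [integral_fourierChar_mul_eq_cubeChar hRQ, enorm_smul, mul_pow, Real.enorm_eq_ofReal_abs,
      abs_abs, ENNReal.ofReal_pow (abs_nonneg _)]
  · exact (lintegral_enorm_sq_comp_lattice hQ).trans_ne
      (ENNReal.mul_ne_top ENNReal.ofReal_ne_top hsq)
  · exact (offDiagonal_comp_lattice hQ).trans_ne (ENNReal.mul_ne_top ENNReal.ofReal_ne_top hoff)

theorem tsum_enorm_sq_integral_fourierChar_mul_le
    (hRQ : ∀ x y, inner ℝ (R x) (Q y) = inner ℝ x y) (hG : Measurable G) (hint : Integrable G)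
    (hsq : ∫⁻ ξ, ‖G ξ‖ₑ ^ 2 ≠ ⊤) (hoff : latticeOffDiagonal Q G ≠ ⊤) :
    ∑' n : d → ℤ, ‖∫ ξ, (Real.fourierChar (inner ℝ (R (latticePoint n)) ξ) : ℂ) * G ξ‖ₑ ^ 2 ≤
      ENNReal.ofReal |LinearMap.det Q| * ((∫⁻ ξ, ‖G ξ‖ₑ ^ 2) + latticeOffDiagonal Q G) := by
  have hQ : LinearMap.det Q ≠ 0 := det_ne_zero_of_inner_map_map_right hRQ
  calc _ ≤ ENNReal.ofReal (|LinearMap.det Q| ^ 2) *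
        (ENNReal.ofReal |LinearMap.det Q|⁻¹ * (∫⁻ ξ, ‖G ξ‖ₑ ^ 2) +
          ENNReal.ofReal |LinearMap.det Q|⁻¹ * latticeOffDiagonal Q G) := by
        rw [tsum_enorm_sq_integral_fourierChar_mul hRQ hG hint hsq hoff,
          ← lintegral_enorm_sq_comp_lattice hQ, ← offDiagonal_comp_lattice hQ]
        gcongr
        exact setLIntegral_enorm_sq_periodization_le (measurable_comp_lattice hG Q)
    _ = _ := by
        rw [← mul_add, ← mul_assoc, ofReal_sq_mul_ofReal_inv (abs_pos.2 hQ)]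

theorem le_tsum_enorm_sq_integral_fourierChar_mul_add
    (hRQ : ∀ x y, inner ℝ (R x) (Q y) = inner ℝ x y) (hG : Measurable G) (hint : Integrable G)
    (hsq : ∫⁻ ξ, ‖G ξ‖ₑ ^ 2 ≠ ⊤) (hoff : latticeOffDiagonal Q G ≠ ⊤) :
    ENNReal.ofReal |LinearMap.det Q| * ∫⁻ ξ, ‖G ξ‖ₑ ^ 2 ≤
      ∑' n : d → ℤ, ‖∫ ξ, (Real.fourierChar (inner ℝ (R (latticePoint n)) ξ) : ℂ) * G ξ‖ₑ ^ 2 +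
        ENNReal.ofReal |LinearMap.det Q| * latticeOffDiagonal Q G := by
  have hQ : LinearMap.det Q ≠ 0 := det_ne_zero_of_inner_map_map_right hRQ
  rw [tsum_enorm_sq_integral_fourierChar_mul hRQ hG hint hsq hoff,
    ← ofReal_sq_mul_ofReal_inv (abs_pos.2 hQ), mul_assoc, mul_assoc, ← mul_add,
    ← lintegral_enorm_sq_comp_lattice hQ, ← offDiagonal_comp_lattice hQ]
  gcongr
  exact lintegral_enorm_sq_le_periodization (measurable_comp_lattice hG Q)
    (integrable_comp_lattice hQ hG hint)

end Lattice

/-! ### The coefficients at a fixed scale and shear -/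

section DualPair

theorem linearMap_det_adjoint {𝕜 E : Type*} [RCLike 𝕜] [NormedAddCommGroup E]
    [InnerProductSpace 𝕜 E] [FiniteDimensional 𝕜 E] (T : E →ₗ[𝕜] E) :
    LinearMap.det (LinearMap.adjoint T) = star (LinearMap.det T) := by
  let b := stdOrthonormalBasis 𝕜 E
  rw [← LinearMap.det_toMatrix b.toBasis, ← LinearMap.det_toMatrix b.toBasis,
    LinearMap.toMatrix_adjoint, Matrix.det_conjTranspose]

variable {V : Type*} [NormedAddCommGroup V] [InnerProductSpace ℝ V] [FiniteDimensional ℝ V]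
  {T S : V →ₗ[ℝ] V}

theorem map_adjoint_apply_of_inner_map_map (hTS : ∀ x y, inner ℝ (T x) (S y) = inner ℝ x y)
    (x : V) : S (LinearMap.adjoint T x) = x := by
  have hcomp : LinearMap.adjoint T * S = 1 := LinearMap.ext fun y =>
    ext_inner_left ℝ fun x => by
      rw [Module.End.mul_apply, LinearMap.adjoint_inner_right, hTS, Module.End.one_apply]
  exact LinearMap.congr_fun (mul_eq_one_comm.1 hcomp) x

theorem det_mul_det_of_inner_map_map (hTS : ∀ x y, inner ℝ (T x) (S y) = inner ℝ x y) :
    LinearMap.det T * LinearMap.det S = 1 := by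
  have hcomp : S * LinearMap.adjoint T = 1 :=
    LinearMap.ext (map_adjoint_apply_of_inner_map_map hTS)
  have hdet := congrArg LinearMap.det hcomp
  rwa [map_mul, map_one, linearMap_det_adjoint, star_trivial, mul_comm] at hdet

variable [MeasurableSpace V] [BorelSpace V]

/-- The correlation `∫ |u(ξ)| |u(ξ + T* ω)| |w(S ξ)| |w(S ξ + ω)| dξ`. It is used for a dual pair
`(T, S)`, for which `S T* = 1` and both shifts therefore correspond to each other, and with `u`, `w`
the Fourier transforms of a function to be expanded and of a generator. -/
def dualCorrelation (T S : V →ₗ[ℝ] V) (u w : V → ℂ) (ω : V) : ℝ≥0∞ :=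
  ∫⁻ ξ, ‖u ξ‖ₑ * ‖u (ξ + LinearMap.adjoint T ω)‖ₑ * (‖w (S ξ)‖ₑ * ‖w (S ξ + ω)‖ₑ)

/-- The product `ξ ↦ u(ξ) conj(w(S ξ))`, whose Fourier coefficients along a lattice are the frame
coefficients at a fixed scale. -/
def dualProduct {V : Type*} [AddCommGroup V] [Module ℝ V] (S : V →ₗ[ℝ] V) (u w : V → ℂ)
    (ξ : V) : ℂ :=
  u ξ * starRingEnd ℂ (w (S ξ))

theorem measurable_dualProduct (S : V →ₗ[ℝ] V) {u w : V → ℂ} (hu : Measurable u)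
    (hw : Measurable w) : Measurable (dualProduct S u w) :=
  hu.mul (Complex.continuous_conj.measurable.comp
    (hw.comp (LinearMap.continuous_of_finiteDimensional S).measurable))

theorem lintegral_enorm_sq_dualProduct (T S : V →ₗ[ℝ] V) (u w : V → ℂ) :
    ∫⁻ ξ, ‖dualProduct S u w ξ‖ₑ ^ 2 = dualCorrelation T S u w 0 := by
  refine lintegral_congr fun ξ => ?_
  simp only [dualProduct, enorm_mul, RCLike.enorm_conj, map_zero, add_zero]
  ring

end DualPair

section FixedScale

variable {d : Type*} [Fintype d] {T S M N : EuclideanSpace ℝ d →ₗ[ℝ] EuclideanSpace ℝ d}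
  {u w : EuclideanSpace ℝ d → ℂ}

theorem integrable_dualProduct (hS : LinearMap.det S ≠ 0) (hu : MemLp u 2 volume)
    (hw : MemLp w 2 volume) : Integrable (dualProduct S u w) := by
  have hcomp := memLp_smul_comp_linearMap_sub hS 0 (e := 1) continuous_const hw
  simp only [Pi.one_apply, one_smul, sub_zero] at hcomp
  exact hu.integrable_mul hcomp.star

theorem latticeOffDiagonal_dualProduct (hTS : ∀ x y, inner ℝ (T x) (S y) = inner ℝ x y) :
    latticeOffDiagonal (LinearMap.adjoint T ∘ₗ N) (dualProduct S u w) =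
      ∑' l : {l : d → ℤ // l ≠ 0}, dualCorrelation T S u w (N (latticePoint l.1)) := by
  refine tsum_congr fun l => lintegral_congr fun ξ => ?_
  simp only [dualProduct, enorm_mul, RCLike.enorm_conj, LinearMap.comp_apply, map_add,
    map_adjoint_apply_of_inner_map_map hTS]
  ring

theorem inner_adjoint_comp_adjoint_comp (hTS : ∀ x y, inner ℝ (T x) (S y) = inner ℝ x y)
    (hMN : ∀ x y, inner ℝ (M x) (N y) = inner ℝ x y) (x y : EuclideanSpace ℝ d) :
    inner ℝ ((LinearMap.adjoint S ∘ₗ M) x) ((LinearMap.adjoint T ∘ₗ N) y) = inner ℝ x y := by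
  rw [LinearMap.comp_apply, LinearMap.comp_apply, LinearMap.adjoint_inner_left,
    map_adjoint_apply_of_inner_map_map hTS, hMN]

variable {c : ℝ} {f ψ : Lp ℂ 2 (volume : Measure (EuclideanSpace ℝ d))}

theorem inner_eq_integral_fourierChar_mul_dualProduct
    (hTS : ∀ x y, inner ℝ (T x) (S y) = inner ℝ x y) {x₀ : EuclideanSpace ℝ d}
    {v : Lp ℂ 2 (volume : Measure (EuclideanSpace ℝ d))}
    (hv : v =ᵐ[volume] fun x => (c : ℂ) * ψ (T x - M x₀)) :
    inner ℂ v f = (c * |LinearMap.det T|⁻¹) •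
      ∫ ξ, (Real.fourierChar (inner ℝ ((LinearMap.adjoint S ∘ₗ M) x₀) ξ) : ℂ) *
        dualProduct S (𝓕 f : Lp ℂ 2 volume) (𝓕 ψ : Lp ℂ 2 volume) ξ := by
  rw [← Lp.inner_fourier_eq, L2.inner_def, ← integral_smul]
  refine integral_congr_ae ?_
  filter_upwards [fourier_ae_eq_of_ae_eq_mul_comp_linearMap_sub hTS hv] with ξ hξ
  simp only [RCLike.inner_apply, hξ, dualProduct, Circle.smul_def, Complex.real_smul, smul_eq_mul,
    map_mul, Complex.conj_ofReal, LinearMap.comp_apply, LinearMap.adjoint_inner_left,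
    AddChar.map_neg_eq_inv, Circle.coe_inv_eq_conj, Complex.conj_conj]
  push_cast
  ring

variable {v : (d → ℤ) → Lp ℂ 2 (volume : Measure (EuclideanSpace ℝ d))}

theorem tsum_enorm_sq_inner_eq (hTS : ∀ x y, inner ℝ (T x) (S y) = inner ℝ x y)
    (hc : c ^ 2 = |LinearMap.det T|)
    (hv : ∀ n, v n =ᵐ[volume] fun x => (c : ℂ) * ψ (T x - M (latticePoint n))) :
    ∑' n, ‖inner ℂ (v n) f‖ₑ ^ 2 = ENNReal.ofReal |LinearMap.det T|⁻¹ *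
      ∑' n : d → ℤ,
        ‖∫ ξ, (Real.fourierChar (inner ℝ ((LinearMap.adjoint S ∘ₗ M) (latticePoint n)) ξ) : ℂ) *
          dualProduct S (𝓕 f : Lp ℂ 2 volume) (𝓕 ψ : Lp ℂ 2 volume) ξ‖ₑ ^ 2 := by
  have hT : |LinearMap.det T| ≠ 0 := abs_ne_zero.2 (det_ne_zero_of_inner_map_map hTS)
  have hconst : (c * |LinearMap.det T|⁻¹) ^ 2 = |LinearMap.det T|⁻¹ := by
    rw [mul_pow, hc]
    field_simp
  rw [← ENNReal.tsum_mul_left]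
  refine tsum_congr fun n => ?_
  rw [inner_eq_integral_fourierChar_mul_dualProduct hTS (hv n), enorm_smul, mul_pow,
    Real.enorm_eq_ofReal_abs, ← ENNReal.ofReal_pow (abs_nonneg _), sq_abs, hconst]

theorem ofReal_abs_det_inv_mul (hTS : ∀ x y, inner ℝ (T x) (S y) = inner ℝ x y)
    (hMN : ∀ x y, inner ℝ (M x) (N y) = inner ℝ x y) :
    ENNReal.ofReal |LinearMap.det T|⁻¹ *
      ENNReal.ofReal |LinearMap.det (LinearMap.adjoint T ∘ₗ N)| =
        ENNReal.ofReal |LinearMap.det M|⁻¹ := by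
  have hT : |LinearMap.det T| ≠ 0 := abs_ne_zero.2 (det_ne_zero_of_inner_map_map hTS)
  rw [← ENNReal.ofReal_mul (by positivity), LinearMap.det_comp, linearMap_det_adjoint,
    star_trivial, abs_mul, inv_mul_cancel_left₀ hT, ← abs_inv,
    inv_eq_of_mul_eq_one_right (det_mul_det_of_inner_map_map hMN)]

theorem tsum_enorm_sq_inner_le (hTS : ∀ x y, inner ℝ (T x) (S y) = inner ℝ x y)
    (hMN : ∀ x y, inner ℝ (M x) (N y) = inner ℝ x y) (hc : c ^ 2 = |LinearMap.det T|)
    (hv : ∀ n, v n =ᵐ[volume] fun x => (c : ℂ) * ψ (T x - M (latticePoint n)))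
    (hdiag : dualCorrelation T S (𝓕 f : Lp ℂ 2 volume) (𝓕 ψ : Lp ℂ 2 volume) 0 ≠ ⊤)
    (hoff : ∑' l : {l : d → ℤ // l ≠ 0}, dualCorrelation T S (𝓕 f : Lp ℂ 2 volume)
      (𝓕 ψ : Lp ℂ 2 volume) (N (latticePoint l.1)) ≠ ⊤) :
    ∑' n, ‖inner ℂ (v n) f‖ₑ ^ 2 ≤ ENNReal.ofReal |LinearMap.det M|⁻¹ *
      (dualCorrelation T S (𝓕 f : Lp ℂ 2 volume) (𝓕 ψ : Lp ℂ 2 volume) 0 +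
        ∑' l : {l : d → ℤ // l ≠ 0}, dualCorrelation T S (𝓕 f : Lp ℂ 2 volume)
          (𝓕 ψ : Lp ℂ 2 volume) (N (latticePoint l.1))) := by
  rw [← lintegral_enorm_sq_dualProduct] at hdiag ⊢
  rw [← latticeOffDiagonal_dualProduct hTS] at hoff ⊢
  rw [tsum_enorm_sq_inner_eq hTS hc hv, ← ofReal_abs_det_inv_mul hTS hMN, mul_assoc]
  gcongr
  exact tsum_enorm_sq_integral_fourierChar_mul_le (inner_adjoint_comp_adjoint_comp hTS hMN)
    (measurable_dualProduct S (Lp.stronglyMeasurable _).measurable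
      (Lp.stronglyMeasurable _).measurable)
    (integrable_dualProduct (det_ne_zero_of_inner_map_map_right hTS) (Lp.memLp _) (Lp.memLp _))
    hdiag hoff

theorem le_tsum_enorm_sq_inner_add (hTS : ∀ x y, inner ℝ (T x) (S y) = inner ℝ x y)
    (hMN : ∀ x y, inner ℝ (M x) (N y) = inner ℝ x y) (hc : c ^ 2 = |LinearMap.det T|)
    (hv : ∀ n, v n =ᵐ[volume] fun x => (c : ℂ) * ψ (T x - M (latticePoint n)))
    (hdiag : dualCorrelation T S (𝓕 f : Lp ℂ 2 volume) (𝓕 ψ : Lp ℂ 2 volume) 0 ≠ ⊤)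
    (hoff : ∑' l : {l : d → ℤ // l ≠ 0}, dualCorrelation T S (𝓕 f : Lp ℂ 2 volume)
      (𝓕 ψ : Lp ℂ 2 volume) (N (latticePoint l.1)) ≠ ⊤) :
    ENNReal.ofReal |LinearMap.det M|⁻¹ *
        dualCorrelation T S (𝓕 f : Lp ℂ 2 volume) (𝓕 ψ : Lp ℂ 2 volume) 0 ≤
      ∑' n, ‖inner ℂ (v n) f‖ₑ ^ 2 + ENNReal.ofReal |LinearMap.det M|⁻¹ *
        ∑' l : {l : d → ℤ // l ≠ 0}, dualCorrelation T S (𝓕 f : Lp ℂ 2 volume)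
          (𝓕 ψ : Lp ℂ 2 volume) (N (latticePoint l.1)) := by
  rw [← lintegral_enorm_sq_dualProduct] at hdiag ⊢
  rw [← latticeOffDiagonal_dualProduct hTS] at hoff ⊢
  rw [tsum_enorm_sq_inner_eq hTS hc hv, ← ofReal_abs_det_inv_mul hTS hMN, mul_assoc, mul_assoc,
    ← mul_add]
  gcongr
  exact le_tsum_enorm_sq_integral_fourierChar_mul_add (inner_adjoint_comp_adjoint_comp hTS hMN)
    (measurable_dualProduct S (Lp.stronglyMeasurable _).measurable
      (Lp.stronglyMeasurable _).measurable)
    (integrable_dualProduct (det_ne_zero_of_inner_map_map_right hTS) (Lp.memLp _) (Lp.memLp _))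
    hdiag hoff

end FixedScale

/-! ### Cauchy–Schwarz across scales and shears -/

theorem ennreal_rpow_half_sq (t : ℝ≥0∞) : (t ^ (1 / 2 : ℝ)) ^ 2 = t := by
  rw [← ENNReal.rpow_two, ← ENNReal.rpow_mul, one_div_mul_cancel two_ne_zero, ENNReal.rpow_one]

section CauchySchwarz

variable {ι X : Type*} [MeasurableSpace X]

theorem lintegral_mul_mul_le (μ : Measure X) {a b s : X → ℝ≥0∞} (ha : Measurable a)
    (hb : Measurable b) (hs : Measurable s) :
    ∫⁻ x, a x * b x * s x ∂μ ≤
      (∫⁻ x, a x ^ 2 * s x ∂μ) ^ (1 / 2 : ℝ) * (∫⁻ x, b x ^ 2 * s x ∂μ) ^ (1 / 2 : ℝ) := by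
  have hholder := ENNReal.lintegral_mul_le_Lp_mul_Lq μ Real.HolderConjugate.two_two
    (f := fun x => a x * s x ^ (1 / 2 : ℝ)) (g := fun x => b x * s x ^ (1 / 2 : ℝ))
    (by fun_prop) (by fun_prop)
  simp only [Pi.mul_apply, ENNReal.rpow_two, mul_pow, ennreal_rpow_half_sq] at hholder
  refine le_trans (le_of_eq (lintegral_congr fun x => ?_)) hholder
  calc a x * b x * s x = a x * b x * (s x ^ (1 / 2 : ℝ)) ^ 2 := by rw [ennreal_rpow_half_sq]
    _ = _ := by ring

theorem tsum_rpow_mul_rpow_le (a b : ι → ℝ≥0∞) :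
    ∑' p, a p ^ (1 / 2 : ℝ) * b p ^ (1 / 2 : ℝ) ≤
      (∑' p, a p) ^ (1 / 2 : ℝ) * (∑' p, b p) ^ (1 / 2 : ℝ) := by
  let _ : MeasurableSpace ι := ⊤
  have hcount := lintegral_mul_mul_le (Measure.count : Measure ι)
    (a := fun p => a p ^ (1 / 2 : ℝ)) (b := fun p => b p ^ (1 / 2 : ℝ)) (s := fun _ => 1)
    measurable_from_top measurable_from_top measurable_from_top
  simpa only [ennreal_rpow_half_sq, mul_one, lintegral_count' measurable_from_top] using hcount

theorem tsum_lintegral_mul_mul_le (μ : Measure X) {a b s : ι → X → ℝ≥0∞}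
    (ha : ∀ p, Measurable (a p)) (hb : ∀ p, Measurable (b p)) (hs : ∀ p, Measurable (s p)) :
    ∑' p, ∫⁻ x, a p x * b p x * s p x ∂μ ≤
      (∑' p, ∫⁻ x, a p x ^ 2 * s p x ∂μ) ^ (1 / 2 : ℝ) *
        (∑' p, ∫⁻ x, b p x ^ 2 * s p x ∂μ) ^ (1 / 2 : ℝ) :=
  (ENNReal.tsum_le_tsum fun p => lintegral_mul_mul_le μ (ha p) (hb p) (hs p)).trans
    (tsum_rpow_mul_rpow_le _ _)

end CauchySchwarz

section DualFamily

variable {ι V : Type*} [Countable ι] [NormedAddCommGroup V] [InnerProductSpace ℝ V]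
  [FiniteDimensional ℝ V] [MeasurableSpace V] [BorelSpace V] {T S : ι → V →ₗ[ℝ] V} {u w : V → ℂ}

omit [Countable ι] in
theorem measurable_enorm_mul_enorm_comp_linearMap (S : V →ₗ[ℝ] V) (hw : Measurable w) (ω : V) :
    Measurable fun ξ => ‖w (S ξ)‖ₑ * ‖w (S ξ + ω)‖ₑ := by
  have hS := (LinearMap.continuous_of_finiteDimensional S).measurable
  fun_prop

theorem tsum_lintegral_enorm_sq_mul (hu : Measurable u) (hw : Measurable w) (ω : V) :
    ∑' p, ∫⁻ ξ, ‖u ξ‖ₑ ^ 2 * (‖w (S p ξ)‖ₑ * ‖w (S p ξ + ω)‖ₑ) =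
      ∫⁻ ξ, ‖u ξ‖ₑ ^ 2 * dualOverlap S w ξ ω := by
  simp only [dualOverlap, ← ENNReal.tsum_mul_left]
  exact (lintegral_tsum fun p => ((hu.enorm.pow_const 2).mul
    (measurable_enorm_mul_enorm_comp_linearMap (S p) hw ω)).aemeasurable).symm

theorem tsum_dualCorrelation_zero (hu : Measurable u) (hw : Measurable w) :
    ∑' p, dualCorrelation (T p) (S p) u w 0 = ∫⁻ ξ, ‖u ξ‖ₑ ^ 2 * dualOverlap S w ξ 0 := by
  rw [← tsum_lintegral_enorm_sq_mul hu hw]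
  simp only [dualCorrelation, map_zero, add_zero, sq]

theorem tsum_dualCorrelation_le (hTS : ∀ p x y, inner ℝ (T p x) (S p y) = inner ℝ x y)
    (hu : Measurable u) (hw : Measurable w) (ω : V) :
    ∑' p, dualCorrelation (T p) (S p) u w ω ≤
      (∫⁻ ξ, ‖u ξ‖ₑ ^ 2 * dualOverlap S w ξ ω) ^ (1 / 2 : ℝ) *
        (∫⁻ ξ, ‖u ξ‖ₑ ^ 2 * dualOverlap S w ξ (-ω)) ^ (1 / 2 : ℝ) := by
  refine (tsum_lintegral_mul_mul_le volume (a := fun _ ξ => ‖u ξ‖ₑ)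
    (b := fun p ξ => ‖u (ξ + LinearMap.adjoint (T p) ω)‖ₑ) (fun _ => hu.enorm)
    (fun p => by fun_prop)
    fun p => measurable_enorm_mul_enorm_comp_linearMap (S p) hw ω).trans_eq ?_
  rw [tsum_lintegral_enorm_sq_mul hu hw, ← tsum_lintegral_enorm_sq_mul hu hw (-ω)]
  congr 2
  refine tsum_congr fun p => ?_
  rw [← lintegral_add_right_eq_self (fun ξ => ‖u ξ‖ₑ ^ 2 * (‖w (S p ξ)‖ₑ * ‖w (S p ξ + -ω)‖ₑ))
    (LinearMap.adjoint (T p) ω)]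
  refine lintegral_congr fun ξ => ?_
  rw [map_add, map_adjoint_apply_of_inner_map_map (hTS p), add_neg_cancel_right,
    mul_comm ‖w (S p ξ)‖ₑ]

end DualFamily

section FrameSum

variable {ι d : Type*} [Fintype d] {T S : ι → EuclideanSpace ℝ d →ₗ[ℝ] EuclideanSpace ℝ d}
  {M N : EuclideanSpace ℝ d →ₗ[ℝ] EuclideanSpace ℝ d} {c : ι → ℝ}
  {f ψ : Lp ℂ 2 (volume : Measure (EuclideanSpace ℝ d))}
  {v : ι × (d → ℤ) → Lp ℂ 2 (volume : Measure (EuclideanSpace ℝ d))} {I J : ℝ≥0∞}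

theorem frameSum_le (hTS : ∀ p x y, inner ℝ (T p x) (S p y) = inner ℝ x y)
    (hMN : ∀ x y, inner ℝ (M x) (N y) = inner ℝ x y) (hc : ∀ p, c p ^ 2 = |LinearMap.det (T p)|)
    (hv : ∀ p n, v (p, n) =ᵐ[volume] fun x => (c p : ℂ) * ψ (T p x - M (latticePoint n)))
    (hdiag : ∑' p, dualCorrelation (T p) (S p) (𝓕 f : Lp ℂ 2 volume) (𝓕 ψ : Lp ℂ 2 volume) 0 ≤ I)
    (hoff : ∑' l : {l : d → ℤ // l ≠ 0}, ∑' p, dualCorrelation (T p) (S p)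
      (𝓕 f : Lp ℂ 2 volume) (𝓕 ψ : Lp ℂ 2 volume) (N (latticePoint l.1)) ≤ J)
    (hI : I ≠ ⊤) (hJ : J ≠ ⊤) :
    frameSum v f ≤ ENNReal.ofReal |LinearMap.det M|⁻¹ * (I + J) := by
  rw [ENNReal.tsum_comm] at hoff
  calc frameSum v f = ∑' p, ∑' n, ‖inner ℂ (v (p, n)) f‖ₑ ^ 2 := ENNReal.tsum_prod'
    _ ≤ _ := ENNReal.tsum_le_tsum fun p => tsum_enorm_sq_inner_le (hTS p) hMN (hc p) (hv p)
        (ENNReal.ne_top_of_tsum_ne_top (ne_top_of_le_ne_top hI hdiag) p)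
        (ENNReal.ne_top_of_tsum_ne_top (ne_top_of_le_ne_top hJ hoff) p)
    _ ≤ _ := by
        rw [ENNReal.tsum_mul_left, ENNReal.tsum_add]
        gcongr

theorem le_frameSum_add (hTS : ∀ p x y, inner ℝ (T p x) (S p y) = inner ℝ x y)
    (hMN : ∀ x y, inner ℝ (M x) (N y) = inner ℝ x y) (hc : ∀ p, c p ^ 2 = |LinearMap.det (T p)|)
    (hv : ∀ p n, v (p, n) =ᵐ[volume] fun x => (c p : ℂ) * ψ (T p x - M (latticePoint n)))
    (hdiag : I ≤ ∑' p, dualCorrelation (T p) (S p) (𝓕 f : Lp ℂ 2 volume) (𝓕 ψ : Lp ℂ 2 volume) 0)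
    (hoff : ∑' l : {l : d → ℤ // l ≠ 0}, ∑' p, dualCorrelation (T p) (S p)
      (𝓕 f : Lp ℂ 2 volume) (𝓕 ψ : Lp ℂ 2 volume) (N (latticePoint l.1)) ≤ J)
    (hfin : ∑' p, dualCorrelation (T p) (S p) (𝓕 f : Lp ℂ 2 volume) (𝓕 ψ : Lp ℂ 2 volume) 0 ≠ ⊤)
    (hJ : J ≠ ⊤) :
    ENNReal.ofReal |LinearMap.det M|⁻¹ * I ≤
      frameSum v f + ENNReal.ofReal |LinearMap.det M|⁻¹ * J := by
  have hframeSum : frameSum v f = ∑' p, ∑' n, ‖inner ℂ (v (p, n)) f‖ₑ ^ 2 := ENNReal.tsum_prod'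
  rw [ENNReal.tsum_comm] at hoff
  calc _ ≤ ∑' p, ENNReal.ofReal |LinearMap.det M|⁻¹ * dualCorrelation (T p) (S p)
          (𝓕 f : Lp ℂ 2 volume) (𝓕 ψ : Lp ℂ 2 volume) 0 := by
        rw [ENNReal.tsum_mul_left]
        gcongr
    _ ≤ _ := ENNReal.tsum_le_tsum fun p => le_tsum_enorm_sq_inner_add (hTS p) hMN (hc p) (hv p)
        (ENNReal.ne_top_of_tsum_ne_top hfin p)
        (ENNReal.ne_top_of_tsum_ne_top (ne_top_of_le_ne_top hJ hoff) p)
    _ ≤ _ := by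
        rw [ENNReal.tsum_add, ENNReal.tsum_mul_left, hframeSum]
        gcongr

end FrameSum

/-! ### The frame inequalities of the shearlet system -/

theorem det_toEuclideanLin {d : Type*} [Fintype d] [DecidableEq d] (A : Matrix d d ℝ) :
    LinearMap.det (Matrix.toEuclideanLin A) = A.det := by
  change LinearMap.det (Matrix.toLpLin 2 2 A) = A.det
  rw [Matrix.toLpLin_eq_toLin, LinearMap.det_toLin]

theorem inner_toEuclideanLin_toEuclideanLin {d : Type*} [Fintype d] [DecidableEq d]
    {A B : Matrix d d ℝ} (hAB : A.transpose * B = 1) (x y : EuclideanSpace ℝ d) :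
    inner ℝ (Matrix.toEuclideanLin A x) (Matrix.toEuclideanLin B y) = inner ℝ x y := by
  simp only [EuclideanSpace.inner_eq_star_dotProduct, star_trivial, Matrix.ofLp_toLpLin,
    Matrix.toLin'_apply]
  rw [Matrix.dotProduct_mulVec, ← Matrix.mulVec_transpose, Matrix.mulVec_mulVec, hAB,
    Matrix.one_mulVec]

/-- The matrix `S_k A_{2^j}` with `p = (j, k)`, by which the shearlets with index `p` are dilated
and sheared. -/
def dilationMatrix (α : ℝ) (p : ℕ × ℤ × ℤ) : Matrix (Fin 3) (Fin 3) ℝ :=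
  shearMatrix p.2 * scalingMatrix α p.1

theorem scalingMatrix_mul_scalingMatrix_neg (α : ℝ) (j : ℤ) :
    scalingMatrix α j * scalingMatrix α (-j) = 1 := by
  rw [scalingMatrix, scalingMatrix, Matrix.diagonal_mul_diagonal, ← Matrix.diagonal_one]
  congr 1
  ext i
  fin_cases i <;> simp [← Real.rpow_add, neg_div]

theorem shearMatrix_neg_mul_shearMatrix (k : ℤ × ℤ) : shearMatrix (-k) * shearMatrix k = 1 := by
  ext i j
  fin_cases i <;> fin_cases j <;> simp [shearMatrix, Matrix.mul_apply, Fin.sum_univ_three]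

theorem transpose_dilationMatrix_mul_dualMatrix (α : ℝ) (p : ℕ × ℤ × ℤ) :
    (dilationMatrix α p).transpose * dualMatrix α p = 1 := by
  have hscaling : (scalingMatrix α p.1).transpose = scalingMatrix α p.1 :=
    Matrix.diagonal_transpose _
  rw [dilationMatrix, dualMatrix, Matrix.transpose_mul, Matrix.mul_assoc,
    ← Matrix.mul_assoc (shearMatrix p.2).transpose, ← Matrix.transpose_mul,
    shearMatrix_neg_mul_shearMatrix, Matrix.transpose_one, Matrix.one_mul, hscaling,
    scalingMatrix_mul_scalingMatrix_neg]

theorem det_dilationMatrix (α : ℝ) (p : ℕ × ℤ × ℤ) :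
    (dilationMatrix α p).det = (2 : ℝ) ^ ((p.1 : ℝ) * (α + 2) / 2) := by
  have hshear : (shearMatrix p.2).det = 1 := by simp [shearMatrix, Matrix.det_fin_three]
  rw [dilationMatrix, Matrix.det_mul, hshear, one_mul]
  simp only [scalingMatrix, Matrix.det_diagonal, Fin.prod_univ_three, Matrix.cons_val_zero,
    Matrix.cons_val_one, Matrix.cons_val, Int.cast_natCast]
  rw [← Real.rpow_add two_pos, ← Real.rpow_add two_pos]
  congr 1
  ring

theorem sq_two_rpow_eq_abs_det_dilationMatrix (α : ℝ) (p : ℕ × ℤ × ℤ) :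
    ((2 : ℝ) ^ ((p.1 : ℝ) * (α + 2) / 4)) ^ 2 =
      |LinearMap.det (Matrix.toEuclideanLin (dilationMatrix α p))| := by
  rw [det_toEuclideanLin, det_dilationMatrix, abs_of_pos (by positivity), ← Real.rpow_natCast,
    ← Real.rpow_mul two_pos.le]
  congr 1
  push_cast
  ring

theorem inner_dilationMatrix_dualMatrix (α : ℝ) (p : ℕ × ℤ × ℤ) (x y : E3) :
    inner ℝ (Matrix.toEuclideanLin (dilationMatrix α p) x)
      (Matrix.toEuclideanLin (dualMatrix α p) y) = inner ℝ x y :=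
  inner_toEuclideanLin_toEuclideanLin (transpose_dilationMatrix_mul_dualMatrix α p) x y

section

variable {α c₁ c₂ : ℝ} {ψ f : L2R3}

theorem det_samplingMatrix : (samplingMatrix c₁ c₂).det = c₁ * c₂ * c₂ := by
  simp [samplingMatrix, Matrix.det_diagonal, Fin.prod_univ_three]

theorem inner_samplingMatrix_inv (hdet : (samplingMatrix c₁ c₂).det ≠ 0) (x y : E3) :
    inner ℝ (Matrix.toEuclideanLin (samplingMatrix c₁ c₂) x)
      (Matrix.toEuclideanLin (samplingMatrix c₁ c₂)⁻¹ y) = inner ℝ x y := by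
  refine inner_toEuclideanLin_toEuclideanLin ?_ x y
  rw [samplingMatrix, Matrix.diagonal_transpose, ← samplingMatrix]
  exact Matrix.mul_nonsing_inv _ (isUnit_iff_ne_zero.2 hdet)

theorem coeFn_shearletSystem (p : ScaleShear α) (n : Fin 3 → ℤ) :
    shearletSystem α c₁ c₂ ψ (p, n) =ᵐ[volume] fun x =>
      (((2 : ℝ) ^ ((p.1.1 : ℝ) * (α + 2) / 4) : ℝ) : ℂ) *
        ψ (Matrix.toEuclideanLin (dilationMatrix α p) x -
          Matrix.toEuclideanLin (samplingMatrix c₁ c₂) (latticePoint n)) :=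
  MemLp.coeFn_toLp _

theorem lintegral_enorm_sq_fourier : ∫⁻ ξ, ‖(𝓕 f : L2R3) ξ‖ₑ ^ 2 = ‖f‖ₑ ^ 2 := by
  rw [lintegral_enorm_sq_coeFn, ← ofReal_norm, Lp.norm_fourier_eq, ofReal_norm]

theorem lintegral_overlap_le (hf : f ∈ pyramidSpace) (ω : E3) :
    ∫⁻ ξ, ‖(𝓕 f : L2R3) ξ‖ₑ ^ 2 * overlap α ψ ξ ω ≤ maxOverlap α ψ ω * ‖f‖ₑ ^ 2 := by
  have hmeas : Measurable (𝓕 f : L2R3) := (Lp.stronglyMeasurable _).measurable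
  rw [← lintegral_enorm_sq_fourier, ← lintegral_const_mul _ (hmeas.enorm.pow_const 2)]
  refine lintegral_mono_ae ?_
  filter_upwards [hf, ae_imp_of_ae_restrict
    (ENNReal.ae_le_essSup (μ := volume.restrict pyramid) fun ξ => overlap α ψ ξ ω)]
    with ξ hsupp hle
  by_cases hξ : ξ ∈ pyramid
  · rw [mul_comm]
    exact mul_le_mul_left (hle hξ) _
  · simp [hsupp hξ]

theorem le_lintegral_overlap (hf : f ∈ pyramidSpace) :
    Linf α ψ * ‖f‖ₑ ^ 2 ≤ ∫⁻ ξ, ‖(𝓕 f : L2R3) ξ‖ₑ ^ 2 * overlap α ψ ξ 0 := by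
  have hmeas : Measurable (𝓕 f : L2R3) := (Lp.stronglyMeasurable _).measurable
  rw [← lintegral_enorm_sq_fourier, ← lintegral_const_mul _ (hmeas.enorm.pow_const 2)]
  refine lintegral_mono_ae ?_
  filter_upwards [hf, ae_imp_of_ae_restrict
    (ae_essInf_le (μ := volume.restrict pyramid) (f := fun ξ => overlap α ψ ξ 0))]
    with ξ hsupp hle
  by_cases hξ : ξ ∈ pyramid
  · rw [mul_comm]
    exact mul_le_mul_right (hle hξ) _
  · simp [hsupp hξ]

/-- The correlation of `f̂` with the generator at the dual lattice point `ω`, summed over all scales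
and shears of the shearlet system. -/
def shearletCorrelation (α : ℝ) (ψ f : L2R3) (ω : E3) : ℝ≥0∞ :=
  ∑' p : ScaleShear α, dualCorrelation (Matrix.toEuclideanLin (dilationMatrix α p))
    (Matrix.toEuclideanLin (dualMatrix α p)) (𝓕 f : L2R3) (𝓕 ψ : L2R3) ω

theorem shearletCorrelation_zero :
    shearletCorrelation α ψ f 0 = ∫⁻ ξ, ‖(𝓕 f : L2R3) ξ‖ₑ ^ 2 * overlap α ψ ξ 0 :=
  tsum_dualCorrelation_zero (Lp.stronglyMeasurable _).measurable
    (Lp.stronglyMeasurable _).measurable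

theorem shearletCorrelation_zero_le (hf : f ∈ pyramidSpace) :
    shearletCorrelation α ψ f 0 ≤ Lsup α ψ * ‖f‖ₑ ^ 2 :=
  shearletCorrelation_zero.trans_le (lintegral_overlap_le hf 0)

theorem le_shearletCorrelation_zero (hf : f ∈ pyramidSpace) :
    Linf α ψ * ‖f‖ₑ ^ 2 ≤ shearletCorrelation α ψ f 0 :=
  (le_lintegral_overlap hf).trans_eq shearletCorrelation_zero.symm

theorem shearletCorrelation_le (hf : f ∈ pyramidSpace) (ω : E3) :
    shearletCorrelation α ψ f ω ≤
      (maxOverlap α ψ ω * maxOverlap α ψ (-ω)) ^ (1 / 2 : ℝ) * ‖f‖ₑ ^ 2 := by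
  have hhalf : (0 : ℝ) ≤ 1 / 2 := by norm_num
  calc shearletCorrelation α ψ f ω
      ≤ (∫⁻ ξ, ‖(𝓕 f : L2R3) ξ‖ₑ ^ 2 * overlap α ψ ξ ω) ^ (1 / 2 : ℝ) *
          (∫⁻ ξ, ‖(𝓕 f : L2R3) ξ‖ₑ ^ 2 * overlap α ψ ξ (-ω)) ^ (1 / 2 : ℝ) :=
        tsum_dualCorrelation_le (fun p : ScaleShear α => inner_dilationMatrix_dualMatrix α p)
          (Lp.stronglyMeasurable _).measurable (Lp.stronglyMeasurable _).measurable ω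
    _ ≤ (maxOverlap α ψ ω * ‖f‖ₑ ^ 2) ^ (1 / 2 : ℝ) *
          (maxOverlap α ψ (-ω) * ‖f‖ₑ ^ 2) ^ (1 / 2 : ℝ) := by
        gcongr <;> exact lintegral_overlap_le hf _
    _ = (maxOverlap α ψ ω * maxOverlap α ψ (-ω)) ^ (1 / 2 : ℝ) *
          ((‖f‖ₑ ^ 2) ^ (1 / 2 : ℝ)) ^ 2 := by
        simp only [ENNReal.mul_rpow_of_nonneg _ _ hhalf]
        ring
    _ = _ := by rw [ennreal_rpow_half_sq]

theorem tsum_shearletCorrelation_le (hf : f ∈ pyramidSpace) :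
    ∑' l : {l : Fin 3 → ℤ // l ≠ 0}, shearletCorrelation α ψ f
      (Matrix.toEuclideanLin (samplingMatrix c₁ c₂)⁻¹ (latticePoint l.1)) ≤
      Rsum α c₁ c₂ ψ * ‖f‖ₑ ^ 2 := by
  rw [Rsum, ← ENNReal.tsum_mul_right]
  exact ENNReal.tsum_le_tsum fun l => shearletCorrelation_le hf _

theorem frameSum_shearletSystem_le (hdet : (samplingMatrix c₁ c₂).det ≠ 0)
    (hL : Lsup α ψ ≠ ⊤) (hR : Rsum α c₁ c₂ ψ ≠ ⊤) (hf : f ∈ pyramidSpace) :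
    frameSum (shearletSystem α c₁ c₂ ψ) f ≤ ENNReal.ofReal |(samplingMatrix c₁ c₂).det|⁻¹ *
      (Lsup α ψ * ‖f‖ₑ ^ 2 + Rsum α c₁ c₂ ψ * ‖f‖ₑ ^ 2) := by
  rw [← det_toEuclideanLin]
  exact frameSum_le (fun p => inner_dilationMatrix_dualMatrix α p) (inner_samplingMatrix_inv hdet)
    (fun p => sq_two_rpow_eq_abs_det_dilationMatrix α p) coeFn_shearletSystem
    (shearletCorrelation_zero_le hf) (tsum_shearletCorrelation_le hf)
    (ENNReal.mul_ne_top hL (by finiteness)) (ENNReal.mul_ne_top hR (by finiteness))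

theorem le_frameSum_shearletSystem_add (hdet : (samplingMatrix c₁ c₂).det ≠ 0)
    (hL : Lsup α ψ ≠ ⊤) (hR : Rsum α c₁ c₂ ψ ≠ ⊤) (hf : f ∈ pyramidSpace) :
    ENNReal.ofReal |(samplingMatrix c₁ c₂).det|⁻¹ * (Linf α ψ * ‖f‖ₑ ^ 2) ≤
      frameSum (shearletSystem α c₁ c₂ ψ) f +
        ENNReal.ofReal |(samplingMatrix c₁ c₂).det|⁻¹ * (Rsum α c₁ c₂ ψ * ‖f‖ₑ ^ 2) := by
  rw [← det_toEuclideanLin]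
  exact le_frameSum_add (fun p => inner_dilationMatrix_dualMatrix α p)
    (inner_samplingMatrix_inv hdet) (fun p => sq_two_rpow_eq_abs_det_dilationMatrix α p)
    coeFn_shearletSystem (le_shearletCorrelation_zero hf) (tsum_shearletCorrelation_le hf)
    (ne_top_of_le_ne_top (ENNReal.mul_ne_top hL (by finiteness)) (shearletCorrelation_zero_le hf))
    (ENNReal.mul_ne_top hR (by finiteness))

end

/-! ### Optimal frame bounds -/

section Optimal

variable {ι H : Type*} [NormedAddCommGroup H] [InnerProductSpace ℂ H] {W : Submodule ℂ H}
  {v : ι → H}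

theorem isClosed_setOf_isLowerFrameBound : IsClosed {a | IsLowerFrameBound W v a} := by
  simp only [IsLowerFrameBound, Set.ofPred_forall]
  refine isClosed_iInter fun f => isClosed_iInter fun _ => ?_
  exact isClosed_Iic.preimage (f := fun a : ℝ => ENNReal.ofReal (a * ‖f‖ ^ 2))
    (ENNReal.continuous_ofReal.comp (by fun_prop))

theorem isClosed_setOf_isUpperFrameBound : IsClosed {b | IsUpperFrameBound W v b} := by
  simp only [IsUpperFrameBound, Set.ofPred_forall]
  refine isClosed_iInter fun f => isClosed_iInter fun _ => ?_
  exact isClosed_Ici.preimage (f := fun b : ℝ => ENNReal.ofReal (b * ‖f‖ ^ 2))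
    (ENNReal.continuous_ofReal.comp (by fun_prop))

theorem IsUpperFrameBound.pos {A b : ℝ} (hb : IsUpperFrameBound W v b) (hA : 0 < A)
    (hl : IsLowerFrameBound W v A) {f : H} (hf : f ∈ W) (hf0 : f ≠ 0) : 0 < b := by
  have hnorm : 0 < ‖f‖ ^ 2 := by positivity
  have hofReal : 0 < ENNReal.ofReal (b * ‖f‖ ^ 2) :=
    (ENNReal.ofReal_pos.2 (by positivity)).trans_le ((hl f hf).trans (hb f hf))
  exact pos_of_mul_pos_left (ENNReal.ofReal_pos.1 hofReal) hnorm.le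

theorem IsLowerFrameBound.le_isUpperFrameBound {a b : ℝ} (ha : IsLowerFrameBound W v a)
    (hb : IsUpperFrameBound W v b) (hb0 : 0 ≤ b) {f : H} (hf : f ∈ W) (hf0 : f ≠ 0) : a ≤ b := by
  have hnorm : 0 < ‖f‖ ^ 2 := by positivity
  have hle := (ENNReal.ofReal_le_ofReal_iff (by positivity)).1 ((ha f hf).trans (hb f hf))
  exact le_of_mul_le_mul_right hle hnorm

theorem exists_optimal_frameBounds {A₀ B₀ : ℝ} (hA₀ : 0 < A₀) (hl : IsLowerFrameBound W v A₀)
    (hu : IsUpperFrameBound W v B₀) {f : H} (hf : f ∈ W) (hf0 : f ≠ 0) :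
    ∃ A B : ℝ, IsGreatest {a | IsLowerFrameBound W v a} A ∧
      IsLeast {b | IsUpperFrameBound W v b} B ∧ A₀ ≤ A ∧ A ≤ B ∧ B ≤ B₀ := by
  have hle {a b : ℝ} (ha : IsLowerFrameBound W v a) (hb : IsUpperFrameBound W v b) : a ≤ b :=
    ha.le_isUpperFrameBound hb (hb.pos hA₀ hl hf hf0).le hf hf0
  have hA : IsGreatest {a | IsLowerFrameBound W v a} (sSup {a | IsLowerFrameBound W v a}) :=
    isClosed_setOf_isLowerFrameBound.isGreatest_csSup ⟨A₀, hl⟩ ⟨B₀, fun a ha => hle ha hu⟩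
  have hB : IsLeast {b | IsUpperFrameBound W v b} (sInf {b | IsUpperFrameBound W v b}) :=
    isClosed_setOf_isUpperFrameBound.isLeast_csInf ⟨B₀, hu⟩ ⟨A₀, fun b hb => hle hl hb⟩
  exact ⟨_, _, hA, hB, hA.2 hl, hle hA.1 hB.1, hB.2 hu⟩

end Optimal

/-! ### Functions with a prescribed Fourier transform -/

section Prescribed

variable {E : Type*} [NormedAddCommGroup E] [InnerProductSpace ℝ E]
  [FiniteDimensional ℝ E] [MeasurableSpace E] [BorelSpace E]

theorem exists_fourier_ae_eq {g : E → ℂ} (hg : MemLp g 2 volume) :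
    ∃ f : Lp (α := E) ℂ 2 volume, (𝓕 f : Lp (α := E) ℂ 2 volume) =ᵐ[volume] g :=
  ⟨𝓕⁻ hg.toLp, by rw [FourierTransform.fourier_fourierInv_eq]; exact hg.coeFn_toLp⟩

theorem memLp_two_of_norm_le_inv_one_add_norm_pow {s : ℕ} (hs : Module.finrank ℝ E < 2 * s)
    {g : E → ℂ} (hg : Measurable g) {C : ℝ} (hC : ∀ x, ‖g x‖ ≤ C * (1 + ‖x‖)⁻¹ ^ s) :
    MemLp g 2 volume := by
  rw [memLp_two_iff_integrable_sq_norm hg.aestronglyMeasurable]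
  have hint : Integrable (fun x : E => C ^ 2 * (1 + ‖x‖) ^ (-((2 * s : ℕ) : ℝ))) volume :=
    (integrable_one_add_norm (by exact_mod_cast hs)).const_mul _
  refine hint.mono' (hg.norm.pow_const 2).aestronglyMeasurable (Eventually.of_forall fun x => ?_)
  rw [Real.norm_of_nonneg (by positivity)]
  calc ‖g x‖ ^ 2 ≤ (C * (1 + ‖x‖)⁻¹ ^ s) ^ 2 := by gcongr; exact hC x
    _ = C ^ 2 * (1 + ‖x‖) ^ (-((2 * s : ℕ) : ℝ)) := by
      rw [Real.rpow_neg (by positivity), Real.rpow_natCast, mul_pow, inv_pow, inv_pow, ← pow_mul,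
        mul_comm s]

end Prescribed

theorem one_add_norm_le_prod {ι : Type*} [Fintype ι] (x : EuclideanSpace ℝ ι) :
    1 + ‖x‖ ≤ ∏ i, (1 + |x i|) := by
  have hnorm : ‖x‖ ≤ ∑ i, |x i| := by
    rw [EuclideanSpace.norm_eq]
    refine Real.sqrt_le_iff.2 ⟨by positivity, ?_⟩
    exact Finset.sum_sq_le_sq_sum_of_nonneg fun i _ => abs_nonneg (x i)
  have hprod (s : Finset ι) : 1 + ∑ i ∈ s, |x i| ≤ ∏ i ∈ s, (1 + |x i|) := by
    classical
    induction s using Finset.induction_on with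
    | empty => simp
    | insert i s hi ih =>
      rw [Finset.sum_insert hi, Finset.prod_insert hi]
      have hsum : 0 ≤ ∑ j ∈ s, |x j| := by positivity
      nlinarith [abs_nonneg (x i), mul_nonneg (abs_nonneg (x i)) hsum]
  exact (add_le_add_right hnorm 1).trans (hprod Finset.univ)

theorem decayProfile_le (η : E3) : decayProfile η ≤ (1 + ‖η‖)⁻¹ ^ 3 := by
  calc decayProfile η ≤ 1 * ∏ i, (1 + |η i|)⁻¹ ^ 3 := by
        rw [decayProfile]
        gcongr
        exact pow_le_one₀ (by positivity) (min_le_left _ _)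
    _ = (∏ i, (1 + |η i|))⁻¹ ^ 3 := by rw [one_mul, Finset.prod_pow, Finset.prod_inv_distrib]
    _ ≤ (1 + ‖η‖)⁻¹ ^ 3 := by gcongr; exact one_add_norm_le_prod η

theorem IsInfiniteProduct.memLp {K L : ℕ} {m₀ φhat : ℝ → ℂ} (hφ : IsInfiniteProduct m₀ φhat)
    (hm₀_meas : Measurable m₀) (hm₀ : IsLowPassFilter K L m₀) {s : ℕ} (hs1 : 1 ≤ s)
    (hs : 4 ^ s * binomSum K L ≤ 4 ^ K) (hsK : s ≤ K) : MemLp φhat 2 volume :=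
  memLp_two_of_norm_le_inv_one_add_norm_pow
    (by rw [Module.finrank_self]; omega) (hφ.measurable hm₀_meas)
    fun x => hφ.norm_le hm₀ hs hsK (hs1.trans hsK) x

theorem memLp_of_norm_le_decayProfile {g : E3 → ℂ} (hg : Measurable g) {C : ℝ} (hC0 : 0 ≤ C)
    (hC : ∀ η, ‖g η‖ ≤ C * decayProfile η) : MemLp g 2 volume :=
  memLp_two_of_norm_le_inv_one_add_norm_pow (s := 3) (by simp) hg fun η =>
    (hC η).trans (mul_le_mul_of_nonneg_left (decayProfile_le η) hC0)

/-! ### The pyramid -/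

theorem measurableSet_pyramid : MeasurableSet pyramid := by
  have hcoord (i : Fin 3) : Measurable fun ξ : E3 => ξ i := by fun_prop
  have hratio (i : Fin 3) : MeasurableSet {ξ : E3 | |ξ i / ξ 0| ≤ 1} :=
    measurableSet_le ((hcoord i).div (hcoord 0)).abs measurable_const
  have hratios := (hratio 1).inter (hratio 2)
  exact ((measurableSet_le measurable_const (hcoord 0)).inter hratios).union
    ((measurableSet_le (hcoord 0) measurable_const).inter hratios)

theorem ball_subset_pyramid : Metric.ball (!₂[2, 0, 0] : E3) (1 / 2) ⊆ pyramid := by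
  intro ξ hξ
  rw [Metric.mem_ball, dist_eq_norm] at hξ
  have hcoord (i : Fin 3) := (PiLp.norm_apply_le (ξ - !₂[2, 0, 0]) i).trans hξ.le
  obtain ⟨hzero, hone, htwo⟩ : |ξ 0 - 2| ≤ 1 / 2 ∧ |ξ 1| ≤ 1 / 2 ∧ |ξ 2| ≤ 1 / 2 :=
    ⟨by simpa using hcoord 0, by simpa using hcoord 1, by simpa using hcoord 2⟩
  have hlower : 3 / 2 ≤ ξ 0 := by linarith [(abs_le.1 hzero).1]
  refine Or.inl ⟨by linarith, ?_, ?_⟩ <;>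
  · rw [abs_div, abs_of_pos (by linarith : 0 < ξ 0), div_le_one (by linarith)]
    linarith

theorem exists_mem_pyramidSpace_ne_zero : ∃ f ∈ pyramidSpace, f ≠ 0 := by
  set s := Metric.ball (!₂[2, 0, 0] : E3) (1 / 2)
  obtain ⟨f, hf⟩ := exists_fourier_ae_eq (memLp_indicator_const (μ := volume) (s := s) 2
    measurableSet_ball (1 : ℂ) (Or.inr measure_ball_lt_top.ne))
  refine ⟨f, ?_, ?_⟩
  · filter_upwards [hf] with ξ hξ hξ_notMem
    rw [hξ, Set.indicator_of_notMem fun hs => hξ_notMem (ball_subset_pyramid hs)]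
  · rintro rfl
    rw [FourierTransform.fourier_zero] at hf
    have hnull := Set.indicator_ae_eq_zero.1 (hf.symm.trans (Lp.coeFn_zero _ _ _))
    rw [Function.support_const one_ne_zero, Set.inter_univ] at hnull
    exact (Metric.measure_ball_pos volume _ (by norm_num)).ne' hnull

/-! ### The covering quantities of a generator with prescribed Fourier transform -/

theorem dualOverlap_ae_eq {ι V : Type*} [Countable ι] [NormedAddCommGroup V]
    [InnerProductSpace ℝ V] [FiniteDimensional ℝ V] [MeasurableSpace V] [BorelSpace V]
    {S : ι → V →ₗ[ℝ] V} (hS : ∀ p, LinearMap.det (S p) ≠ 0) {w g : V → ℂ}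
    (hwg : w =ᵐ[volume] g) (ω : V) :
    (fun ξ => dualOverlap S w ξ ω) =ᵐ[volume] fun ξ => dualOverlap S g ξ ω := by
  have hshift (η : V) : ∀ᵐ ξ ∂(volume : Measure V), ∀ p, w (S p ξ + η) = g (S p ξ + η) :=
    ae_all_iff.2 fun p => by
      simpa only [sub_neg_eq_add] using (quasiMeasurePreserving_linearMap_sub (hS p) (-η)).ae hwg
  filter_upwards [hshift 0, hshift ω] with ξ hzero hω
  simp only [add_zero] at hzero
  simp only [dualOverlap, hzero, hω]

section

variable {α : ℝ} {ψ : L2R3} {g : E3 → ℂ}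

theorem overlap_ae_eq (hψ : (𝓕 ψ : L2R3) =ᵐ[volume] g) (ω : E3) :
    (fun ξ => overlap α ψ ξ ω) =ᵐ[volume.restrict pyramid] fun ξ => overlapSum α g ξ ω :=
  ae_restrict_of_ae (dualOverlap_ae_eq (fun p : ScaleShear α =>
    det_ne_zero_of_inner_map_map_right (inner_dilationMatrix_dualMatrix α p)) hψ ω)

theorem maxOverlap_le (hψ : (𝓕 ψ : L2R3) =ᵐ[volume] g) {ω : E3} {X : ℝ≥0∞}
    (hX : ∀ ξ ∈ pyramid, overlapSum α g ξ ω ≤ X) : maxOverlap α ψ ω ≤ X := by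
  refine essSup_le_of_ae_le _ ?_
  filter_upwards [overlap_ae_eq hψ ω, ae_restrict_mem measurableSet_pyramid] with ξ heq hξ
  exact heq.trans_le (hX ξ hξ)

theorem le_Linf (hψ : (𝓕 ψ : L2R3) =ᵐ[volume] g) {X : ℝ≥0∞}
    (hX : ∀ ξ ∈ pyramid, X ≤ overlapSum α g ξ 0) : X ≤ Linf α ψ := by
  refine le_essInf_of_ae_le _ ?_
  filter_upwards [overlap_ae_eq hψ 0, ae_restrict_mem measurableSet_pyramid] with ξ heq hξ
  exact (hX ξ hξ).trans_eq heq.symm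

theorem Linf_ne_top (hL : Lsup α ψ ≠ ⊤) : Linf α ψ ≠ ⊤ := by
  obtain ⟨f, hf, hf0⟩ := exists_mem_pyramidSpace_ne_zero
  have hnorm : ‖f‖ₑ ^ 2 ≠ 0 := by simpa using hf0
  have hle := (le_shearletCorrelation_zero (α := α) (ψ := ψ) hf).trans
    (shearletCorrelation_zero_le hf)
  intro htop
  rw [htop, ENNReal.top_mul hnorm, top_le_iff] at hle
  exact ENNReal.mul_ne_top hL (by finiteness) hle

theorem exists_forall_Rsum_lt_Linf (hα : 0 < α) (hψ : (𝓕 ψ : L2R3) =ᵐ[volume] g) {C ε : ℝ}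
    (hdecay : ∀ η, ‖g η‖ ≤ C * decayProfile η) (hε : 0 < ε)
    (hcore : ∀ η ∈ core (6 * 2 ^ (α / 2))⁻¹, ε ≤ ‖g η‖) :
    Lsup α ψ ≠ ⊤ ∧ ∃ c_max > 0, ∀ c₁ c₂ : ℝ, 0 < c₂ → c₂ ≤ c₁ → c₁ ≤ c_max →
      Rsum α c₁ c₂ ψ < Linf α ψ := by
  obtain ⟨X, hX, hoverlap⟩ := exists_overlapSum_le hα hdecay
  have hΓ (ω : E3) : maxOverlap α ψ ω ≤ X * ENNReal.ofReal (latticeWeight ω) :=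
    maxOverlap_le hψ fun ξ hξ => hoverlap ξ ω (one_le_abs_of_mem_pyramid hξ)
  have hLinf : ENNReal.ofReal (ε ^ 2) ≤ Linf α ψ :=
    le_Linf hψ fun ξ hξ => ofReal_sq_le_overlapSum hα hε.le hcore hξ
  have hLinf_ne : Linf α ψ ≠ 0 := ((ENNReal.ofReal_pos.2 (by positivity)).trans_le hLinf).ne'
  exact ⟨ne_top_of_le_ne_top (ENNReal.mul_ne_top hX ENNReal.ofReal_ne_top) (hΓ 0),
    exists_forall_Rsum_lt hX hΓ hLinf_ne⟩

end

/-! ### Frame bounds of the shearlet system -/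

theorem ofReal_toReal_div_mul_norm_sq {E : Type*} [SeminormedAddCommGroup E] {X : ℝ≥0∞}
    (hX : X ≠ ⊤) {δ : ℝ} (hδ : 0 ≤ δ) (f : E) :
    ENNReal.ofReal (X.toReal / δ * ‖f‖ ^ 2) = ENNReal.ofReal δ⁻¹ * (X * ‖f‖ₑ ^ 2) := by
  rw [← ofReal_norm, ← ENNReal.ofReal_pow (norm_nonneg f), div_eq_inv_mul, mul_assoc,
    ENNReal.ofReal_mul (by positivity), ENNReal.ofReal_mul ENNReal.toReal_nonneg,
    ENNReal.ofReal_toReal hX]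

section

variable {α c₁ c₂ : ℝ} {ψ : L2R3}

theorem isUpperFrameBound_shearletSystem (hdet : (samplingMatrix c₁ c₂).det ≠ 0)
    (hL : Lsup α ψ ≠ ⊤) (hR : Rsum α c₁ c₂ ψ ≠ ⊤) :
    IsUpperFrameBound pyramidSpace (shearletSystem α c₁ c₂ ψ)
      (((Lsup α ψ).toReal + (Rsum α c₁ c₂ ψ).toReal) / |(samplingMatrix c₁ c₂).det|) := by
  intro f hf
  rw [add_div, add_mul, ENNReal.ofReal_add (by positivity) (by positivity),
    ofReal_toReal_div_mul_norm_sq hL (abs_nonneg _),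
    ofReal_toReal_div_mul_norm_sq hR (abs_nonneg _), ← mul_add]
  exact frameSum_shearletSystem_le hdet hL hR hf

theorem isLowerFrameBound_shearletSystem (hdet : (samplingMatrix c₁ c₂).det ≠ 0)
    (hL : Lsup α ψ ≠ ⊤) (hR : Rsum α c₁ c₂ ψ ≠ ⊤) :
    IsLowerFrameBound pyramidSpace (shearletSystem α c₁ c₂ ψ)
      (((Linf α ψ).toReal - (Rsum α c₁ c₂ ψ).toReal) / |(samplingMatrix c₁ c₂).det|) := by
  intro f hf
  rw [sub_div, sub_mul, ENNReal.ofReal_sub _ (by positivity), tsub_le_iff_right,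
    ofReal_toReal_div_mul_norm_sq (Linf_ne_top hL) (abs_nonneg _),
    ofReal_toReal_div_mul_norm_sq hR (abs_nonneg _)]
  exact le_frameSum_shearletSystem_add hdet hL hR hf

theorem frameBound_pos (hdet : (samplingMatrix c₁ c₂).det ≠ 0) (hR : Rsum α c₁ c₂ ψ < Linf α ψ)
    (hL : Lsup α ψ ≠ ⊤) : 0 <
      ((Linf α ψ).toReal - (Rsum α c₁ c₂ ψ).toReal) / |(samplingMatrix c₁ c₂).det| :=
  div_pos (sub_pos.2 ((ENNReal.toReal_lt_toReal hR.ne_top (Linf_ne_top hL)).2 hR))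
    (abs_pos.2 hdet)

theorem exists_optimal_frameBounds_shearletSystem (hdet : (samplingMatrix c₁ c₂).det ≠ 0)
    (hR : Rsum α c₁ c₂ ψ < Linf α ψ) (hL : Lsup α ψ ≠ ⊤) :
    ∃ A B : ℝ,
      IsGreatest {a | IsLowerFrameBound pyramidSpace (shearletSystem α c₁ c₂ ψ) a} A ∧
      IsLeast {b | IsUpperFrameBound pyramidSpace (shearletSystem α c₁ c₂ ψ) b} B ∧
      ((Linf α ψ).toReal - (Rsum α c₁ c₂ ψ).toReal) / |(samplingMatrix c₁ c₂).det| ≤ A ∧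
      A ≤ B ∧
      B ≤ ((Lsup α ψ).toReal + (Rsum α c₁ c₂ ψ).toReal) / |(samplingMatrix c₁ c₂).det| := by
  obtain ⟨f, hf, hf0⟩ := exists_mem_pyramidSpace_ne_zero
  exact exists_optimal_frameBounds (frameBound_pos hdet hR hL)
    (isLowerFrameBound_shearletSystem hdet hL hR.ne_top)
    (isUpperFrameBound_shearletSystem hdet hL hR.ne_top) hf hf0

theorem isFrameFor_shearletSystem (hdet : (samplingMatrix c₁ c₂).det ≠ 0)
    (hR : Rsum α c₁ c₂ ψ < Linf α ψ) (hL : Lsup α ψ ≠ ⊤) :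
    IsFrameFor pyramidSpace (shearletSystem α c₁ c₂ ψ) := by
  obtain ⟨A, B, hA, hB, hlower, hAB, -⟩ := exists_optimal_frameBounds_shearletSystem hdet hR hL
  exact ⟨A, B, (frameBound_pos hdet hR hL).trans_le hlower, hAB, hA.1, hB.1⟩

end

end

end Shearlet

open Shearlet in
theorem mainTheorem5_general (α : ℝ) (hα : 0 < α) (K L : ℕ) (hL : 1 ≤ L) (hK : 13 ≤ K)
    (hKL : 3 * L ≤ 2 * K) (m₀ m₁ φhat : ℝ → ℂ) (hm₀_meas : Measurable m₀)
    (hm₁_meas : Measurable m₁) (hm₀ : IsLowPassFilter K L m₀) (hm₁ : IsBandPassFilter m₀ m₁)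
    (hφhat : IsInfiniteProduct m₀ φhat) :
    (∃ φ : L2R, (𝓕 φ : L2R) =ᵐ[volume] φhat) ∧
    ∃ ψ : L2R3, (𝓕 ψ : L2R3) =ᵐ[volume] generatorFT m₁ φhat ∧
      ∃ c₁_max : ℝ, 0 < c₁_max ∧
        ∀ c₁ c₂ : ℝ, 0 < c₂ → c₂ ≤ c₁ → c₁ ≤ c₁_max →
          IsFrameFor pyramidSpace (shearletSystem α c₁ c₂ ψ) ∧
          Rsum α c₁ c₂ ψ < Linf α ψ ∧ Lsup α ψ < ⊤ ∧
          ∃ A B : ℝ,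
            IsGreatest {a | IsLowerFrameBound pyramidSpace (shearletSystem α c₁ c₂ ψ) a} A ∧
            IsLeast {b | IsUpperFrameBound pyramidSpace (shearletSystem α c₁ c₂ ψ) b} B ∧
            ((Linf α ψ).toReal - (Rsum α c₁ c₂ ψ).toReal) / |(samplingMatrix c₁ c₂).det| ≤ A ∧
            A ≤ B ∧
            B ≤ ((Lsup α ψ).toReal + (Rsum α c₁ c₂ ψ).toReal) /
              |(samplingMatrix c₁ c₂).det| := by
  have hbinom := binomSum_le_four_pow hK hKL
  have hdecay := norm_generatorFT_le hφhat hm₀ hm₁ hbinom (by omega)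
  have hgen : MemLp (generatorFT m₁ φhat) 2 volume :=
    memLp_of_norm_le_decayProfile
      (measurable_generatorFT hm₁_meas (hφhat.measurable hm₀_meas)) (by positivity) hdecay
  refine ⟨exists_fourier_ae_eq
    (hφhat.memLp hm₀_meas hm₀ (by norm_num) hbinom (by omega)), ?_⟩
  obtain ⟨ψ, hψ⟩ := exists_fourier_ae_eq hgen
  obtain ⟨hLsup, c_max, hc_max, hR⟩ := exists_forall_Rsum_lt_Linf hα hψ hdecay (by positivity)
    fun η hη => le_norm_generatorFT hφhat hm₀ hm₁ hL (by positivity) hη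
  refine ⟨ψ, hψ, c_max, hc_max, fun c₁ c₂ h₂ h₂₁ h₁ => ?_⟩
  have hdet : (samplingMatrix c₁ c₂).det ≠ 0 := by
    have hc₁ : 0 < c₁ := h₂.trans_le h₂₁
    rw [det_samplingMatrix]
    positivity
  have hRc := hR c₁ c₂ h₂ h₂₁ h₁
  exact ⟨isFrameFor_shearletSystem hdet hRc hLsup, hRc, hLsup.lt_top,
    exists_optimal_frameBounds_shearletSystem hdet hRc hLsup⟩

open Shearlet in
theorem mainTheorem5 (α : ℝ) (hα : α ∈ Set.Ioc (1 : ℝ) 2)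
    (K L : ℕ) (hL : 10 ≤ L) (hKL : 3 * (L : ℝ) / 2 ≤ K) (hKL' : (K : ℝ) ≤ 3 * L - 2)
    (m₀ m₁ φhat : ℝ → ℂ) (hm₀_meas : Measurable m₀) (hm₁_meas : Measurable m₁)
    (hm₀ : IsLowPassFilter K L m₀) (hm₁ : IsBandPassFilter m₀ m₁)
    (hφhat : IsInfiniteProduct m₀ φhat) :
    (∃ φ : L2R, (𝓕 φ : L2R) =ᵐ[volume] φhat) ∧
    ∃ ψ : L2R3, (𝓕 ψ : L2R3) =ᵐ[volume] generatorFT m₁ φhat ∧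
      ∃ c₁_max : ℝ, 0 < c₁_max ∧
        ∀ c₁ c₂ : ℝ, 0 < c₂ → c₂ ≤ c₁ → c₁ ≤ c₁_max →
          IsFrameFor pyramidSpace (shearletSystem α c₁ c₂ ψ) ∧
          Rsum α c₁ c₂ ψ < Linf α ψ ∧ Lsup α ψ < ⊤ ∧
          ∃ A B : ℝ,
            IsGreatest {a | IsLowerFrameBound pyramidSpace (shearletSystem α c₁ c₂ ψ) a} A ∧
            IsLeast {b | IsUpperFrameBound pyramidSpace (shearletSystem α c₁ c₂ ψ) b} B ∧
            ((Linf α ψ).toReal - (Rsum α c₁ c₂ ψ).toReal) / |(samplingMatrix c₁ c₂).det| ≤ A ∧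
            A ≤ B ∧
            B ≤ ((Lsup α ψ).toReal + (Rsum α c₁ c₂ ψ).toReal) /
              |(samplingMatrix c₁ c₂).det| := by
  have hKL_nat : 3 * L ≤ 2 * K := by exact_mod_cast (by linarith : 3 * (L : ℝ) ≤ 2 * K)
  exact mainTheorem5_general α (by linarith [hα.1]) K L (by omega) (by omega) hKL_nat m₀ m₁ φhat
    hm₀_meas hm₁_meas hm₀ hm₁ hφhat
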